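/- For an integer $n\ge 1$ let $$K_n=(S^1)^n/\big((z_1,\ldots,z_{n-1},z_n)\sim(\bar z_1,\ldots,\bar z_{n-1},-z_n)\big),$$ where $S^1$ is the unit circle in $\mathbb C$, with the quotient topology. For $m\ge 0$ let $M^{m+2}(2)=S^{m+1}\cup_2 e^{m+2}$ be the mod-2 Moore space, obtained by attaching a closed $(m+2)$-ball to $S^{m+1}$ along a map of degree $2$ from its boundary sphere to $S^{m+1}$. Then for every $n\ge 1$ and every choice of basepoint of $K_n$, the reduced suspension of $K_n$ is (pointed) homotopy equivalent to a wedge of spheres and Moore spaces: $$\Sigma K_n\simeq S^2\vee\bigvee_{i>0\text{ even}}\tbinom{n-1}{i}\,(S^{i+1}\vee S^{i+2})\vee\bigvee_{i>0\text{ odd}}\tbinom{n-1}{i}\,M^{i+2}(2),$$ where $\binom{n-1}{i}X$ denotes the wedge of $\binom{n-1}{i}$ copies of $X$ (a point if $\binom{n-1}{i}=0$). -/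

import Mathlib

noncomputable section

namespace HigherKlein

/-- A topological space with a basepoint. -/
structure PointedSpace where
  carrier : Type
  [top : TopologicalSpace carrier]
  pt : carrier

instance : CoeSort PointedSpace Type := ⟨PointedSpace.carrier⟩

instance (X : PointedSpace) : TopologicalSpace X := X.top

/-- `X` and `Y` are homotopy equivalent as pointed spaces: the maps in both directions and both
homotopies preserve the basepoint. -/
def PointedHomotopyEquivalent (X Y : PointedSpace) : Prop :=
  ∃ (f : C(X, Y)) (g : C(Y, X)), f X.pt = Y.pt ∧ g Y.pt = X.pt ∧
    (g.comp f).HomotopicRel (ContinuousMap.id X) {X.pt} ∧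
    (f.comp g).HomotopicRel (ContinuousMap.id Y) {Y.pt}

/-- The equivalence relation that identifies all points of `A` with one another. -/
def collapseSetoid {X : Type} (A : Set X) : Setoid X where
  r x y := x = y ∨ (x ∈ A ∧ y ∈ A)
  iseqv :=
    { refl := fun _ => Or.inl rfl
      symm := by
        rintro x y (h | h)
        · exact Or.inl h.symm
        · exact Or.inr ⟨h.2, h.1⟩
      trans := by
        rintro x y z (rfl | h) (rfl | h')
        · exact Or.inl rfl
        · exact Or.inr h'
        · exact Or.inr h
        · exact Or.inr ⟨h.1, h'.2⟩ }

/-- The quotient space `X / A`, with the quotient topology, pointed by the class of `a`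
(used only with `a ∈ A`). -/
def collapse {X : Type} [TopologicalSpace X] (A : Set X) (a : X) : PointedSpace where
  carrier := Quotient (collapseSetoid A)
  pt := Quotient.mk (collapseSetoid A) a

/-- The reduced suspension `X × [0,1] / (X × {0} ∪ X × {1} ∪ {pt} × [0,1])`. -/
def reducedSuspension (X : PointedSpace) : PointedSpace :=
  collapse {p : X × unitInterval | p.2 = 0 ∨ p.2 = 1 ∨ p.1 = X.pt} (X.pt, 0)

/-- The wedge `X ∨ Y` of two pointed spaces. -/
def wedge (X Y : PointedSpace) : PointedSpace :=
  collapse ({Sum.inl X.pt, Sum.inr Y.pt} : Set (X ⊕ Y)) (Sum.inl X.pt)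

/-- The wedge of a family of pointed spaces: the quotient of the disjoint union of the family and
a one-point space that identifies all basepoints. The wedge of the empty family is a point. -/
def bigWedge {ι : Type} (X : ι → PointedSpace) : PointedSpace :=
  collapse ({Sum.inl ()} ∪ Set.range (fun i => Sum.inr ⟨i, (X i).pt⟩) :
    Set (Unit ⊕ (Σ i, X i))) (Sum.inl ())

/-- The unit sphere `S^k` in Euclidean space of dimension `k + 1`, pointed by `(1, 0, …, 0)`. -/
def sphere (k : ℕ) : PointedSpace where
  carrier := Metric.sphere (0 : EuclideanSpace ℝ (Fin (k + 1))) 1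
  pt := ⟨EuclideanSpace.single 0 1, by simp⟩

/-- The map `(z, y) ↦ (z ^ 2 / ‖z‖, y)` of `ℂ × ℝ^m = ℝ^(m+2)`, with value `(0, y)` at `z = 0`;
that is, the angle in the plane of the first two coordinates is doubled. -/
def angleDouble (m : ℕ) (x : EuclideanSpace ℝ (Fin (m + 2))) : EuclideanSpace ℝ (Fin (m + 2)) :=
  WithLp.toLp 2 (Fin.cons ((x 0 ^ 2 - x 1 ^ 2) / √(x 0 ^ 2 + x 1 ^ 2))
    (Fin.cons (2 * x 0 * x 1 / √(x 0 ^ 2 + x 1 ^ 2)) (fun j : Fin m => x j.succ.succ)))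

theorem norm_angleDouble (m : ℕ) (x : EuclideanSpace ℝ (Fin (m + 2))) :
    ‖angleDouble m x‖ = ‖x‖ := by
  rw [EuclideanSpace.norm_eq, EuclideanSpace.norm_eq]
  congr 1
  simp only [angleDouble, Fin.sum_univ_succ, Real.norm_eq_abs, sq_abs, Fin.cons_zero,
    Fin.cons_succ, Fin.succ_zero_eq_one]
  rw [← add_assoc, ← add_assoc]
  congr 1
  have hr : 0 ≤ x 0 ^ 2 + x 1 ^ 2 := by positivity
  rw [div_pow, div_pow, Real.sq_sqrt hr]
  rcases hr.eq_or_lt with h | h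
  · rw [← h]
    simp
  · field_simp
    ring

theorem continuous_angleDouble (m : ℕ) : Continuous (angleDouble m) := by
  have key : ∀ P : ℝ → ℝ → ℝ, Continuous (fun p : ℝ × ℝ => P p.1 p.2) →
      (∀ a b, |P a b| ≤ a ^ 2 + b ^ 2) →
      Continuous (fun x : EuclideanSpace ℝ (Fin (m + 2)) =>
        P (x 0) (x 1) / √(x 0 ^ 2 + x 1 ^ 2)) := by
    intro P hP hb
    have h0 : Continuous (fun x : EuclideanSpace ℝ (Fin (m + 2)) => x 0) := by fun_prop
    have h1 : Continuous (fun x : EuclideanSpace ℝ (Fin (m + 2)) => x 1) := by fun_prop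
    have hs : Continuous (fun x : EuclideanSpace ℝ (Fin (m + 2)) => √(x 0 ^ 2 + x 1 ^ 2)) := by
      fun_prop
    rw [continuous_iff_continuousAt]
    intro y
    by_cases hy : √(y 0 ^ 2 + y 1 ^ 2) = 0
    · have hle : ∀ x : EuclideanSpace ℝ (Fin (m + 2)),
          ‖P (x 0) (x 1) / √(x 0 ^ 2 + x 1 ^ 2)‖ ≤ √(x 0 ^ 2 + x 1 ^ 2) := by
        intro x
        rw [Real.norm_eq_abs, abs_div, abs_of_nonneg (Real.sqrt_nonneg _)]
        refine div_le_of_le_mul₀ (Real.sqrt_nonneg _) (Real.sqrt_nonneg _) ?_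
        rw [Real.mul_self_sqrt (by positivity)]
        exact hb _ _
      have ht := hs.tendsto y
      rw [hy] at ht
      have h := squeeze_zero_norm hle ht
      rw [ContinuousAt, hy, div_zero]
      exact h
    · exact ((hP.comp (h0.prodMk h1)).continuousAt).div hs.continuousAt hy
  refine (PiLp.continuous_toLp 2 _).comp (continuous_pi fun j => ?_)
  refine Fin.cases ?_ (fun j => Fin.cases ?_ (fun j => ?_) j) j
  · refine key (fun a b => a ^ 2 - b ^ 2) (by fun_prop) fun a b => ?_
    rw [abs_le]
    constructor <;> nlinarith [sq_nonneg a, sq_nonneg b]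
  · refine key (fun a b => 2 * a * b) (by fun_prop) fun a b => ?_
    rw [abs_le]
    constructor <;> nlinarith [sq_nonneg (a + b), sq_nonneg (a - b)]
  · simp only [Fin.cons_succ]
    fun_prop

/-- The standard self-map of degree two of the sphere `S^(m+1)`. -/
def degreeTwo (m : ℕ) : C(sphere (m + 1), sphere (m + 1)) where
  toFun x := ⟨angleDouble m x.1, by
    have h := x.2
    rw [mem_sphere_zero_iff_norm] at h ⊢
    rw [norm_angleDouble, h]⟩
  continuous_toFun :=
    ((continuous_angleDouble m).comp continuous_subtype_val).subtype_mk _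

/-- The mod-2 Moore space `M^(m+2)(2) = S^(m+1) ∪_2 e^(m+2)`: the closed unit ball of `ℝ^(m+2)` is
attached to `S^(m+1)` along the map of degree two on its boundary sphere. -/
def moore (m : ℕ) : PointedSpace where
  carrier := Quot (fun (a b : sphere (m + 1) ⊕
      Metric.closedBall (0 : EuclideanSpace ℝ (Fin (m + 2))) 1) =>
    ∃ x : sphere (m + 1), a = Sum.inr ⟨x.1, Metric.sphere_subset_closedBall x.2⟩ ∧
      b = Sum.inl (degreeTwo m x))
  pt := Quot.mk _ (Sum.inl (sphere (m + 1)).pt)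

/-- The map `(z_1, …, z_{n-1}, z_n) ↦ (z̄_1, …, z̄_{n-1}, -z_n)` of the `n`-torus; on the unit circle
the conjugate is the inverse. -/
def torusInvolution (n : ℕ) (z : Fin n → Circle) : Fin n → Circle :=
  fun j => if (j : ℕ) + 1 = n then -z j else (z j)⁻¹

/-- The `n`-dimensional Klein bottle
`K_n = (S^1)^n / (z_1, …, z_{n-1}, z_n) ∼ (z̄_1, …, z̄_{n-1}, -z_n)`, for `n ≥ 1`. -/
def Klein (n : ℕ) : Type :=
  Quot (fun z w : Fin n → Circle => w = torusInvolution n z)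

instance (n : ℕ) : TopologicalSpace (Klein n) :=
  inferInstanceAs (TopologicalSpace (Quot _))

end HigherKlein

end

/-!
`K_n` is the quotient of a torus `(S¹)^ι × S¹` by `(z, w) ∼ (z⁻¹, -w)`, where `ι` has `n - 1`
elements. For `S ⊆ J ⊆ ι`, keep the coordinates in `J` and collapse the points some coordinate of
which in `S` is `1`. Setting one more coordinate `j` to `1` retracts such a quotient `X` onto the
one `A` in which `j` has been dropped, and `X / A` is the one in which `j` has been added to `S`.
As the half-circle around `1` contracts to `1` compatibly with inversion, the points of `X` near
`A` can be deformed to their images in `A`. This makes the suspension split: the loop of a point of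
`X` is sent to its loop in `X / A` followed by the loop of its image in `A`, and the loop of a
point of `X / A` is lifted by running along the loop of the point in `X` and then back along the
loop of its image in `A`. Hence `ΣX ≃ ΣA ∨ Σ(X / A)`, and by induction `ΣK_n` is the wedge over
`K ⊆ ι` of the suspensions of the quotients with `S = J = K`.

By the Cayley transform, the quotient with `S = J = K ≠ ∅` is the one-point compactification of
`(ℝ^K × S¹) / ((a, w) ∼ (-a, -w))`. Two coordinates form a factor `ℂ`, which rotation by `w`
untwists. If `|K|` is even this leaves `ℂ^b × S¹`, with `2 b = |K|`, whose one-point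
compactification is a half-smash product with suspension `S^(|K|+1) ∨ S^(|K|+2)`. If `|K|` is odd
it leaves `ℂ^b` times an open Möbius strip; its suspension compactifies the product of `ℝ^|K|` and
an open Möbius strip, and so does the quotient of `M^(|K|+2)(2)` by a contractible half of a great
sphere of the bottom sphere.
-/

noncomputable section

namespace HigherKlein

open Topology Set
open scoped unitInterval

/-! ### Pointed maps -/

/-- A continuous map that preserves the basepoint. -/
structure PointedMap (X Y : PointedSpace) extends C(X, Y) where
  map_pt' : toFun X.pt = Y.pt

namespace PointedMap

variable {X Y Z : PointedSpace}

instance : FunLike (PointedMap X Y) X Y where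
  coe f := f.toFun
  coe_injective := by
    rintro ⟨⟨f, _⟩, _⟩ ⟨⟨g, _⟩, _⟩ h
    congr

instance : ContinuousMapClass (PointedMap X Y) X Y where
  map_continuous f := f.continuous_toFun

@[ext]
theorem ext {f g : PointedMap X Y} (h : ∀ x, f x = g x) : f = g := DFunLike.ext f g h

@[simp]
theorem map_pt (f : PointedMap X Y) : f X.pt = Y.pt := f.map_pt'

/-- The identity as a pointed map. -/
protected def id (X : PointedSpace) : PointedMap X X := ⟨ContinuousMap.id X, rfl⟩

@[simp]
theorem id_apply (x : X) : PointedMap.id X x = x := rfl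

/-- The composite of two pointed maps. -/
def comp (g : PointedMap Y Z) (f : PointedMap X Y) : PointedMap X Z :=
  ⟨g.toContinuousMap.comp f.toContinuousMap, (congrArg g f.map_pt).trans g.map_pt⟩

@[simp]
theorem comp_apply (g : PointedMap Y Z) (f : PointedMap X Y) (x : X) : g.comp f x = g (f x) := rfl

/-- Homotopy of pointed maps through pointed maps. -/
def Homotopic (f g : PointedMap X Y) : Prop :=
  f.toContinuousMap.HomotopicRel g.toContinuousMap {X.pt}

theorem homotopic_iff {f g : PointedMap X Y} :
    f.Homotopic g ↔ ∃ H : C(I × X, Y), (∀ x, H (0, x) = f x) ∧ (∀ x, H (1, x) = g x) ∧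
      ∀ t, H (t, X.pt) = Y.pt := by
  constructor
  · rintro ⟨H⟩
    exact ⟨H.toContinuousMap, H.apply_zero, H.apply_one, fun t => (H.eq_fst t rfl).trans f.map_pt⟩
  · rintro ⟨H, h0, h1, hpt⟩
    refine ⟨⟨⟨H, h0, h1⟩, ?_⟩⟩
    rintro t _ rfl
    exact (hpt t).trans f.map_pt.symm

namespace Homotopic

@[refl]
theorem refl (f : PointedMap X Y) : f.Homotopic f := ContinuousMap.HomotopicRel.refl _

@[symm]
theorem symm {f g : PointedMap X Y} (h : f.Homotopic g) : g.Homotopic f :=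
  ContinuousMap.HomotopicRel.symm h

@[trans]
theorem trans {f g h : PointedMap X Y} (hfg : f.Homotopic g) (hgh : g.Homotopic h) :
    f.Homotopic h :=
  ContinuousMap.HomotopicRel.trans hfg hgh

theorem comp {f f' : PointedMap X Y} {g g' : PointedMap Y Z} (hg : g.Homotopic g')
    (hf : f.Homotopic f') : (g.comp f).Homotopic (g'.comp f') := by
  obtain ⟨F, hF0, hF1, hF⟩ := homotopic_iff.1 hf
  obtain ⟨G, hG0, hG1, hG⟩ := homotopic_iff.1 hg
  exact homotopic_iff.2 ⟨⟨fun p => G (p.1, F p), by fun_prop⟩, by simp [hF0, hG0],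
    by simp [hF1, hG1], by simp [hF, hG]⟩

end Homotopic

end PointedMap

theorem pointedHomotopyEquivalent_iff {X Y : PointedSpace} :
    PointedHomotopyEquivalent X Y ↔ ∃ (f : PointedMap X Y) (g : PointedMap Y X),
      (g.comp f).Homotopic (.id X) ∧ (f.comp g).Homotopic (.id Y) :=
  ⟨fun ⟨f, g, hf, hg, hgf, hfg⟩ => ⟨⟨f, hf⟩, ⟨g, hg⟩, hgf, hfg⟩,
    fun ⟨f, g, hgf, hfg⟩ => ⟨f.toContinuousMap, g.toContinuousMap, f.map_pt, g.map_pt, hgf, hfg⟩⟩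

namespace PointedHomotopyEquivalent

variable {X Y Z : PointedSpace}

theorem refl (X : PointedSpace) : PointedHomotopyEquivalent X X :=
  pointedHomotopyEquivalent_iff.2 ⟨.id X, .id X, .refl _, .refl _⟩

theorem symm (h : PointedHomotopyEquivalent X Y) : PointedHomotopyEquivalent Y X := by
  obtain ⟨f, g, hf, hg, hgf, hfg⟩ := h
  exact ⟨g, f, hg, hf, hfg, hgf⟩

theorem trans (hXY : PointedHomotopyEquivalent X Y) (hYZ : PointedHomotopyEquivalent Y Z) :
    PointedHomotopyEquivalent X Z := by
  obtain ⟨f, g, hgf, hfg⟩ := pointedHomotopyEquivalent_iff.1 hXY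
  obtain ⟨f', g', hgf', hfg'⟩ := pointedHomotopyEquivalent_iff.1 hYZ
  exact pointedHomotopyEquivalent_iff.2 ⟨f'.comp f, g.comp g',
    ((PointedMap.Homotopic.refl g).comp (hgf'.comp (.refl f))).trans hgf,
    ((PointedMap.Homotopic.refl f').comp (hfg.comp (.refl g'))).trans hfg'⟩

theorem of_inverse (f : PointedMap X Y) (g : PointedMap Y X) (hgf : ∀ x, g (f x) = x)
    (hfg : ∀ y, f (g y) = y) : PointedHomotopyEquivalent X Y := by
  have hgf' : g.comp f = .id X := PointedMap.ext hgf
  have hfg' : f.comp g = .id Y := PointedMap.ext hfg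
  exact pointedHomotopyEquivalent_iff.2 ⟨f, g, hgf' ▸ .refl _, hfg' ▸ .refl _⟩

theorem of_homeomorph (e : X ≃ₜ Y) (he : e X.pt = Y.pt) : PointedHomotopyEquivalent X Y :=
  of_inverse ⟨e, he⟩ ⟨e.symm, e.symm_apply_eq.2 he.symm⟩ e.symm_apply_apply e.apply_symm_apply

end PointedHomotopyEquivalent

/-! ### Quotient spaces -/

section Quotient

variable {E X Y : Type*} [TopologicalSpace E] [TopologicalSpace X] [TopologicalSpace Y] {π : E → X}

theorem isQuotientMap_prodMap_id [LocallyCompactSpace Y] (hπ : IsQuotientMap π) :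
    IsQuotientMap (Prod.map π (id : Y → Y)) := by
  refine isQuotientMap_iff_isClosed.2 ⟨hπ.surjective.prodMap Function.surjective_id,
    fun s => ⟨fun h => h.preimage (hπ.continuous.prodMap continuous_id), fun h => ?_⟩⟩
  have : Continuous fun p : X × Y => p ∈ sᶜ :=
    hπ.continuous_lift_prod_left (continuous_Prop.2 h.isOpen_compl)
  exact isOpen_compl_iff.1 (continuous_Prop.1 this)

end Quotient

namespace PointedMap

variable {E : Type*} [TopologicalSpace E] {X Y : PointedSpace} {π : C(E, X)}

/-- The pointed map that a map on `E` induces on a quotient `X` of `E`. -/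
def ofQuotient (hπ : IsQuotientMap π) (F : E → Y) (hF : Continuous F)
    (hc : ∀ e e', π e = π e' → F e = F e') (hpt : ∀ e, π e = X.pt → F e = Y.pt) :
    PointedMap X Y where
  toContinuousMap := hπ.lift ⟨F, hF⟩ fun {e e'} => hc e e'
  map_pt' := by
    obtain ⟨e, he⟩ := hπ.surjective X.pt
    rw [← he]
    exact (DFunLike.congr_fun (hπ.lift_comp ⟨F, hF⟩ fun {e e'} => hc e e') e).trans (hpt e he)

@[simp]
theorem ofQuotient_apply (hπ : IsQuotientMap π) (F : E → Y) (hF : Continuous F)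
    (hc : ∀ e e', π e = π e' → F e = F e') (hpt : ∀ e, π e = X.pt → F e = Y.pt) (e : E) :
    ofQuotient hπ F hF hc hpt (π e) = F e :=
  DFunLike.congr_fun (hπ.lift_comp ⟨F, hF⟩ fun {e e'} => hc e e') e

theorem Homotopic.of_quotient (hπ : IsQuotientMap π) {f g : PointedMap X Y} (H : I → E → Y)
    (hH : Continuous fun p : I × E => H p.1 p.2)
    (hc : ∀ t e e', π e = π e' → H t e = H t e') (hpt : ∀ t e, π e = X.pt → H t e = Y.pt)
    (h0 : ∀ e, H 0 e = f (π e)) (h1 : ∀ e, H 1 e = g (π e)) : f.Homotopic g := by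
  let K (t : I) (x : X) : Y := H t (Function.surjInv hπ.surjective x)
  have hK (t : I) (e : E) : K t (π e) = H t e := hc t _ _ (Function.surjInv_eq hπ.surjective _)
  have hK' : Continuous fun p : I × X => K p.1 p.2 :=
    hπ.continuous_lift_prod_right (by simpa only [hK] using hH)
  refine homotopic_iff.2 ⟨⟨_, hK'⟩, hπ.surjective.forall.2 fun e => (hK 0 e).trans (h0 e),
    hπ.surjective.forall.2 fun e => (hK 1 e).trans (h1 e), fun t => ?_⟩
  obtain ⟨e, he⟩ := hπ.surjective X.pt
  exact he ▸ (hK t e).trans (hpt t e he)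

end PointedMap

theorem PointedHomotopyEquivalent.of_quotients {E : Type*} [TopologicalSpace E] {X Y : PointedSpace}
    {π : C(E, X)} {ρ : C(E, Y)} (hπ : IsQuotientMap π) (hρ : IsQuotientMap ρ)
    (h : ∀ e e', π e = π e' ↔ ρ e = ρ e') {e₀ : E} (hX : π e₀ = X.pt) (hY : ρ e₀ = Y.pt) :
    PointedHomotopyEquivalent X Y :=
  of_inverse
    (.ofQuotient hπ ρ ρ.continuous (fun e e' => (h e e').1)
      fun e he => hY ▸ (h e e₀).1 (he.trans hX.symm))
    (.ofQuotient hρ π π.continuous (fun e e' => (h e e').2)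
      fun e he => hX ▸ (h e e₀).2 (he.trans hY.symm))
    (hπ.surjective.forall.2 fun e => by simp) (hρ.surjective.forall.2 fun e => by simp)

/-! ### Collapsing a subset -/

section Collapse

variable {X : Type} [TopologicalSpace X] {A : Set X} {a : X} {Z : PointedSpace}

/-- The projection `X → X / A`. -/
def collapseMk (A : Set X) (a : X) : C(X, collapse A a) where
  toFun := Quotient.mk (collapseSetoid A)
  continuous_toFun := continuous_quotient_mk'

theorem isQuotientMap_collapseMk : IsQuotientMap (collapseMk A a) := isQuotientMap_quotient_mk'

theorem collapseMk_eq_iff {x y : X} :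
    collapseMk A a x = collapseMk A a y ↔ x = y ∨ (x ∈ A ∧ y ∈ A) := Quotient.eq

theorem collapseMk_eq_pt_iff (ha : a ∈ A) {x : X} :
    collapseMk A a x = (collapse A a).pt ↔ x ∈ A :=
  collapseMk_eq_iff.trans ⟨by rintro (rfl | h); exacts [ha, h.1], fun hx => Or.inr ⟨hx, ha⟩⟩

theorem eq_of_collapseMk_eq {β : Type*} {F : X → β} {z : β} (hF : ∀ x ∈ A, F x = z) {x y : X}
    (h : collapseMk A a x = collapseMk A a y) : F x = F y := by
  rcases collapseMk_eq_iff.1 h with rfl | ⟨hx, hy⟩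
  exacts [rfl, (hF x hx).trans (hF y hy).symm]

/-- The pointed map that a map sending `A` to the basepoint induces on `X / A`. -/
def collapseLift (ha : a ∈ A) (F : X → Z) (hF : Continuous F) (hA : ∀ x ∈ A, F x = Z.pt) :
    PointedMap (collapse A a) Z :=
  .ofQuotient isQuotientMap_collapseMk F hF (fun _ _ => eq_of_collapseMk_eq hA)
    fun x hx => hA x ((collapseMk_eq_pt_iff ha).1 hx)

@[simp]
theorem collapseLift_mk (ha : a ∈ A) (F : X → Z) (hF : Continuous F)
    (hA : ∀ x ∈ A, F x = Z.pt) (x : X) :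
    collapseLift ha F hF hA (collapseMk A a x) = F x :=
  PointedMap.ofQuotient_apply ..

theorem PointedMap.Homotopic.of_collapse (ha : a ∈ A) {f g : PointedMap (collapse A a) Z}
    (H : I → X → Z) (hH : Continuous fun p : I × X => H p.1 p.2)
    (hA : ∀ t, ∀ x ∈ A, H t x = Z.pt) (h0 : ∀ x, H 0 x = f (collapseMk A a x))
    (h1 : ∀ x, H 1 x = g (collapseMk A a x)) : f.Homotopic g :=
  .of_quotient isQuotientMap_collapseMk H hH (fun t _ _ => eq_of_collapseMk_eq (hA t))
    (fun t x hx => hA t x ((collapseMk_eq_pt_iff ha).1 hx)) h0 h1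

end Collapse

theorem PointedHomotopyEquivalent.collapse_of_contraction (X : PointedSpace) (A : Set X)
    (H : C(I × X, X)) (h0 : ∀ x, H (0, x) = x) (hA : ∀ t, ∀ x ∈ A, H (t, x) ∈ A)
    (h1 : ∀ x ∈ A, H (1, x) = X.pt) (hpt : ∀ t, H (t, X.pt) = X.pt) (hX : X.pt ∈ A) :
    PointedHomotopyEquivalent X (collapse A X.pt) := by
  let q : PointedMap X (collapse A X.pt) := ⟨collapseMk A X.pt, rfl⟩
  let r : PointedMap (collapse A X.pt) X :=
    collapseLift hX (fun x => H (1, x)) (by fun_prop) h1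
  have hr (x : X) : r (q x) = H (1, x) := collapseLift_mk ..
  have hqH : Continuous fun p : I × X => q (H (p.1, p.2)) :=
    (map_continuous q).comp H.continuous
  refine pointedHomotopyEquivalent_iff.2 ⟨q, r, ?_, ?_⟩
  · exact .symm (PointedMap.homotopic_iff.2 ⟨H, h0, fun x => (hr x).symm, hpt⟩)
  · refine .symm (.of_collapse hX (fun t x => q (H (t, x))) hqH
      (fun t x hx => (collapseMk_eq_pt_iff hX).2 (hA t x hx)) (fun x => ?_) fun x => ?_)
    · rw [h0]
      rfl
    · exact congrArg q (hr x).symm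

theorem PointedHomotopyEquivalent.collapse_congr {X Y : Type} [TopologicalSpace X]
    [TopologicalSpace Y] {A : Set X} {B : Set Y} {a : X} {b : Y} (e : X ≃ₜ Y) (hab : e a = b)
    (hAB : ∀ x, e x ∈ B ↔ x ∈ A) : PointedHomotopyEquivalent (collapse A a) (collapse B b) :=
  of_quotients (ρ := (collapseMk B b).comp e) (e₀ := a) isQuotientMap_collapseMk
    (isQuotientMap_collapseMk.comp e.isQuotientMap)
    (fun x y => by
      simp only [ContinuousMap.comp_apply, collapseMk_eq_iff, ContinuousMap.coe_coe, hAB,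
        e.injective.eq_iff]) rfl (congrArg _ hab)

/-! ### Reduced suspensions -/

section Suspension

variable {X Y : PointedSpace}

/-- The point of the reduced suspension at height `s` over `x`; heights outside `[0, 1]` give the
basepoint. -/
def suspPoint (X : PointedSpace) : C(X × ℝ, reducedSuspension X) :=
  (collapseMk {p : X × I | p.2 = 0 ∨ p.2 = 1 ∨ p.1 = X.pt} (X.pt, 0)).comp
    ⟨fun p : X × ℝ => (p.1, projIcc 0 1 zero_le_one p.2), by fun_prop⟩

theorem suspPoint_coe (x : X) (s : I) :
    suspPoint X (x, s) = collapseMk {p : X × I | p.2 = 0 ∨ p.2 = 1 ∨ p.1 = X.pt} (X.pt, 0) (x, s) :=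
  congrArg (fun s => collapseMk _ _ (x, s)) (projIcc_val zero_le_one s)

theorem suspPoint_projIcc (x : X) (s : ℝ) :
    suspPoint X (x, (projIcc 0 1 zero_le_one s : I)) = suspPoint X (x, s) := by
  rw [suspPoint_coe]
  rfl

theorem suspPoint_eq_iff {x y : X} {s t : I} :
    suspPoint X (x, s) = suspPoint X (y, t) ↔ (x = y ∧ s = t) ∨
      ((s = 0 ∨ s = 1 ∨ x = X.pt) ∧ (t = 0 ∨ t = 1 ∨ y = X.pt)) := by
  rw [suspPoint_coe, suspPoint_coe, ← Prod.mk.injEq]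
  exact collapseMk_eq_iff

theorem suspPoint_eq_pt_iff {x : X} {s : I} :
    suspPoint X (x, s) = (reducedSuspension X).pt ↔ s = 0 ∨ s = 1 ∨ x = X.pt := by
  rw [suspPoint_coe]
  exact collapseMk_eq_pt_iff (A := {p : X × I | p.2 = 0 ∨ p.2 = 1 ∨ p.1 = X.pt}) (Or.inl rfl)

theorem suspPoint_eq_pt {x : X} {s : ℝ} (h : s ≤ 0 ∨ 1 ≤ s ∨ x = X.pt) :
    suspPoint X (x, s) = (reducedSuspension X).pt := by
  rw [← suspPoint_projIcc, suspPoint_eq_pt_iff]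
  exact h.imp (projIcc_of_le_left zero_le_one) (Or.imp_left (projIcc_of_right_le zero_le_one))

@[simp]
theorem suspPoint_zero (x : X) : suspPoint X (x, 0) = (reducedSuspension X).pt :=
  suspPoint_eq_pt (by simp)

@[simp]
theorem suspPoint_base (s : ℝ) : suspPoint X (X.pt, s) = (reducedSuspension X).pt :=
  suspPoint_eq_pt (by simp)

section Cover

variable {E : Type*} [TopologicalSpace E] {π : C(E, X)} {Z : PointedSpace}

/-- The map `E × [0, 1] → ΣX` that is induced by `π : E → X`. -/
def suspCover (π : C(E, X)) : C(E × I, reducedSuspension X) :=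
  (suspPoint X).comp ⟨fun p => (π p.1, (p.2 : ℝ)), by fun_prop⟩

theorem isQuotientMap_suspCover (hπ : IsQuotientMap π) : IsQuotientMap (suspCover π) := by
  have h := (isQuotientMap_collapseMk (A := {p : X × I | p.2 = 0 ∨ p.2 = 1 ∨ p.1 = X.pt})
    (a := (X.pt, 0))).comp (isQuotientMap_prodMap_id (Y := I) hπ)
  exact (funext fun p : E × I => suspPoint_coe (π p.1) p.2 :
    ⇑(suspCover π) = collapseMk _ _ ∘ Prod.map π id) ▸ h

theorem eq_of_suspCover_eq {F : E → I → Z} (hc : ∀ e e' s, π e = π e' → F e s = F e' s)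
    (hpt : ∀ e s, s = 0 ∨ s = 1 ∨ π e = X.pt → F e s = Z.pt) {p p' : E × I}
    (h : suspCover π p = suspCover π p') : F p.1 p.2 = F p'.1 p'.2 := by
  rcases suspPoint_eq_iff.1 h with ⟨h, h'⟩ | ⟨h, h'⟩
  · rw [h']
    exact hc _ _ _ h
  · exact (hpt _ _ h).trans (hpt _ _ h').symm

/-- The pointed map out of `ΣX` that is induced by a map on `E × [0, 1]`, where `X` is a quotient
of `E`. -/
def suspLift (hπ : IsQuotientMap π) (F : E → I → Z) (hF : Continuous fun p : E × I => F p.1 p.2)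
    (hc : ∀ e e' s, π e = π e' → F e s = F e' s)
    (hpt : ∀ e s, s = 0 ∨ s = 1 ∨ π e = X.pt → F e s = Z.pt) :
    PointedMap (reducedSuspension X) Z :=
  .ofQuotient (isQuotientMap_suspCover hπ) (fun p => F p.1 p.2) hF
    (fun _ _ => eq_of_suspCover_eq hc hpt) fun p h => hpt p.1 p.2 (suspPoint_eq_pt_iff.1 h)

@[simp]
theorem suspLift_apply (hπ : IsQuotientMap π) (F : E → I → Z)
    (hF : Continuous fun p : E × I => F p.1 p.2) (hc : ∀ e e' s, π e = π e' → F e s = F e' s)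
    (hpt : ∀ e s, s = 0 ∨ s = 1 ∨ π e = X.pt → F e s = Z.pt) (e : E) (s : I) :
    suspLift hπ F hF hc hpt (suspPoint X (π e, s)) = F e s :=
  PointedMap.ofQuotient_apply (isQuotientMap_suspCover hπ) (fun p : E × I => F p.1 p.2) hF
    (fun _ _ => eq_of_suspCover_eq hc hpt) (fun _ h => hpt _ _ (suspPoint_eq_pt_iff.1 h)) (e, s)

theorem PointedMap.Homotopic.of_susp (hπ : IsQuotientMap π)
    {f g : PointedMap (reducedSuspension X) Z} (H : I → E → I → Z)
    (hH : Continuous fun p : I × E × I => H p.1 p.2.1 p.2.2)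
    (hc : ∀ t e e' s, π e = π e' → H t e s = H t e' s)
    (hpt : ∀ t e s, s = 0 ∨ s = 1 ∨ π e = X.pt → H t e s = Z.pt)
    (h0 : ∀ e s, H 0 e s = f (suspPoint X (π e, s)))
    (h1 : ∀ e s, H 1 e s = g (suspPoint X (π e, s))) : f.Homotopic g :=
  .of_quotient (isQuotientMap_suspCover hπ) (fun t p => H t p.1 p.2) hH
    (fun t _ _ => eq_of_suspCover_eq (hc t) (hpt t))
    (fun t p h => hpt t p.1 p.2 (suspPoint_eq_pt_iff.1 h)) (fun p => h0 p.1 p.2)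
    fun p => h1 p.1 p.2

end Cover

/-- The suspension of a pointed map. -/
def suspMap (f : PointedMap X Y) : PointedMap (reducedSuspension X) (reducedSuspension Y) :=
  suspLift (π := ContinuousMap.id X) IsQuotientMap.id (fun x s => suspPoint Y (f x, s))
    (by fun_prop) (fun _ _ s h => congrArg (fun x => suspPoint Y (f x, s)) h)
    fun x s h => suspPoint_eq_pt_iff.2 <| h.imp_right <| Or.imp_right fun h =>
      (congrArg f h).trans f.map_pt

@[simp]
theorem suspMap_apply (f : PointedMap X Y) (x : X) (s : ℝ) :
    suspMap f (suspPoint X (x, s)) = suspPoint Y (f x, s) := by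
  rw [← suspPoint_projIcc x, ← suspPoint_projIcc (f x)]
  exact suspLift_apply (π := ContinuousMap.id X) ..

theorem reducedSuspension_ind {p : reducedSuspension X → Prop}
    (h : ∀ x s, p (suspPoint X (x, s))) (w : reducedSuspension X) : p w := by
  obtain ⟨⟨x, s⟩, rfl⟩ :=
    (isQuotientMap_suspCover (π := ContinuousMap.id X) IsQuotientMap.id).surjective w
  exact h x s

theorem suspMap_id : suspMap (.id X) = .id (reducedSuspension X) :=
  PointedMap.ext <| reducedSuspension_ind <| by simp

theorem suspMap_comp {Z : PointedSpace} (g : PointedMap Y Z) (f : PointedMap X Y) :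
    suspMap (g.comp f) = (suspMap g).comp (suspMap f) :=
  PointedMap.ext <| reducedSuspension_ind <| by simp

theorem PointedMap.Homotopic.susp {f g : PointedMap X Y} (h : f.Homotopic g) :
    (suspMap f).Homotopic (suspMap g) := by
  obtain ⟨H, h0, h1, hpt⟩ := PointedMap.homotopic_iff.1 h
  refine .of_susp (π := ContinuousMap.id X) IsQuotientMap.id
    (fun t x s => suspPoint Y (H (t, x), s)) (by fun_prop)
    (fun t _ _ s h => congrArg (fun x => suspPoint Y (H (t, x), s)) h) (fun t x s h => ?_)
    (by simp [h0]) (by simp [h1])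
  exact suspPoint_eq_pt_iff.2 <| h.imp_right <| Or.imp_right fun (h : x = X.pt) => by rw [h, hpt]

theorem PointedHomotopyEquivalent.susp (h : PointedHomotopyEquivalent X Y) :
    PointedHomotopyEquivalent (reducedSuspension X) (reducedSuspension Y) := by
  obtain ⟨f, g, hgf, hfg⟩ := pointedHomotopyEquivalent_iff.1 h
  refine pointedHomotopyEquivalent_iff.2 ⟨suspMap f, suspMap g, ?_, ?_⟩
  · simpa only [suspMap_comp, suspMap_id] using hgf.susp
  · simpa only [suspMap_comp, suspMap_id] using hfg.susp

end Suspension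

/-! ### Wedges -/

section Wedge

variable {X Y X' Y' Z : PointedSpace}

/-- The inclusion of the first summand. -/
def wedgeInl (X Y : PointedSpace) : PointedMap X (wedge X Y) where
  toContinuousMap :=
    (collapseMk {Sum.inl X.pt, Sum.inr Y.pt} (Sum.inl X.pt)).comp ⟨Sum.inl, continuous_inl⟩
  map_pt' := rfl

/-- The inclusion of the second summand. -/
def wedgeInr (X Y : PointedSpace) : PointedMap Y (wedge X Y) where
  toContinuousMap :=
    (collapseMk {Sum.inl X.pt, Sum.inr Y.pt} (Sum.inl X.pt)).comp ⟨Sum.inr, continuous_inr⟩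
  map_pt' := (collapseMk_eq_pt_iff (mem_insert _ _)).2 (mem_insert_of_mem _ rfl)

theorem wedge_ind {p : wedge X Y → Prop} (hl : ∀ x, p (wedgeInl X Y x))
    (hr : ∀ y, p (wedgeInr X Y y)) (w : wedge X Y) : p w := by
  obtain ⟨x | y, rfl⟩ := (isQuotientMap_collapseMk
    (A := ({Sum.inl X.pt, Sum.inr Y.pt} : Set (X ⊕ Y)))).surjective w
  exacts [hl x, hr y]

/-- The pointed map out of a wedge with given restrictions to the summands. -/
def wedgeLift (f : PointedMap X Z) (g : PointedMap Y Z) : PointedMap (wedge X Y) Z :=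
  collapseLift (mem_insert _ _) (Sum.elim f g) (by fun_prop) <| by
    rintro _ (rfl | rfl)
    exacts [f.map_pt, g.map_pt]

@[simp]
theorem wedgeLift_inl (f : PointedMap X Z) (g : PointedMap Y Z) (x : X) :
    wedgeLift f g (wedgeInl X Y x) = f x := collapseLift_mk ..

@[simp]
theorem wedgeLift_inr (f : PointedMap X Z) (g : PointedMap Y Z) (y : Y) :
    wedgeLift f g (wedgeInr X Y y) = g y := collapseLift_mk ..

theorem PointedMap.Homotopic.of_wedge {f g : PointedMap (wedge X Y) Z}
    (hl : (f.comp (wedgeInl X Y)).Homotopic (g.comp (wedgeInl X Y)))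
    (hr : (f.comp (wedgeInr X Y)).Homotopic (g.comp (wedgeInr X Y))) : f.Homotopic g := by
  obtain ⟨F, hF0, hF1, hF⟩ := homotopic_iff.1 hl
  obtain ⟨G, hG0, hG1, hG⟩ := homotopic_iff.1 hr
  let paths : X ⊕ Y → C(I, Z) :=
    Sum.elim (F.comp .prodSwap).curry (G.comp .prodSwap).curry
  have _ : Continuous paths := by fun_prop
  refine .of_collapse (mem_insert _ _) (fun t w => paths w t) (by fun_prop) ?_ ?_ ?_
  · rintro t _ (rfl | rfl)
    exacts [hF t, hG t]
  · rintro (x | y)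
    exacts [hF0 x, hG0 y]
  · rintro (x | y)
    exacts [hF1 x, hG1 y]

/-- The wedge of two pointed maps. -/
def wedgeMap (f : PointedMap X X') (g : PointedMap Y Y') :
    PointedMap (wedge X Y) (wedge X' Y') :=
  wedgeLift ((wedgeInl X' Y').comp f) ((wedgeInr X' Y').comp g)

theorem wedgeMap_homotopic_id {f : PointedMap X X'} {f' : PointedMap X' X} {g : PointedMap Y Y'}
    {g' : PointedMap Y' Y} (hf : (f'.comp f).Homotopic (.id X))
    (hg : (g'.comp g).Homotopic (.id Y)) :
    ((wedgeMap f' g').comp (wedgeMap f g)).Homotopic (.id (wedge X Y)) := by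
  refine .of_wedge ?_ ?_
  · convert (PointedMap.Homotopic.refl (wedgeInl X Y)).comp hf using 1
    · ext
      simp [wedgeMap]
    · rfl
  · convert (PointedMap.Homotopic.refl (wedgeInr X Y)).comp hg using 1
    · ext
      simp [wedgeMap]
    · rfl

theorem PointedHomotopyEquivalent.wedge_congr (h : PointedHomotopyEquivalent X X')
    (h' : PointedHomotopyEquivalent Y Y') :
    PointedHomotopyEquivalent (wedge X Y) (wedge X' Y') := by
  obtain ⟨f, g, hgf, hfg⟩ := pointedHomotopyEquivalent_iff.1 h
  obtain ⟨f', g', hgf', hfg'⟩ := pointedHomotopyEquivalent_iff.1 h'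
  exact pointedHomotopyEquivalent_iff.2 ⟨wedgeMap f f', wedgeMap g g',
    wedgeMap_homotopic_id hgf hgf', wedgeMap_homotopic_id hfg hfg'⟩

end Wedge

section BigWedge

variable {ι κ : Type} {X X' : ι → PointedSpace} {Y : κ → PointedSpace} {Z : PointedSpace}

/-- The points of the disjoint union that are identified in the wedge. -/
abbrev basepoints (X : ι → PointedSpace) : Set (Unit ⊕ Σ i, X i) :=
  {Sum.inl ()} ∪ range fun i => Sum.inr ⟨i, (X i).pt⟩

theorem inl_mem_basepoints : Sum.inl () ∈ basepoints X := mem_union_left _ rfl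

theorem inr_mem_basepoints_iff {i : ι} {x : X i} :
    Sum.inr ⟨i, x⟩ ∈ basepoints X ↔ x = (X i).pt := by
  refine ⟨?_, fun h => Or.inr ⟨i, h ▸ rfl⟩⟩
  rintro (h | ⟨_, h⟩) <;> cases h
  rfl

/-- The inclusion of a summand. -/
def bigWedgeIn (X : ι → PointedSpace) (i : ι) : PointedMap (X i) (bigWedge X) where
  toContinuousMap := (collapseMk (basepoints X) (Sum.inl ())).comp
    ⟨fun x => Sum.inr ⟨i, x⟩, continuous_inr.comp continuous_sigmaMk⟩
  map_pt' := (collapseMk_eq_pt_iff inl_mem_basepoints).2 (inr_mem_basepoints_iff.2 rfl)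

theorem bigWedge_ind {p : bigWedge X → Prop} (h0 : p (bigWedge X).pt)
    (h : ∀ i x, p (bigWedgeIn X i x)) (w : bigWedge X) : p w := by
  obtain ⟨x | ⟨i, x⟩, rfl⟩ :=
    (isQuotientMap_collapseMk (A := basepoints X) (a := Sum.inl ())).surjective w
  exacts [h0, h i x]

/-- The pointed map out of a wedge with given restrictions to the summands. -/
def bigWedgeLift (f : ∀ i, PointedMap (X i) Z) : PointedMap (bigWedge X) Z :=
  collapseLift (A := basepoints X) inl_mem_basepoints (Sum.elim (fun _ => Z.pt) fun p => f p.1 p.2)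
    (continuous_const.sumElim (continuous_sigma fun i => map_continuous (f i))) <| by
    rintro _ (rfl | ⟨i, rfl⟩)
    exacts [rfl, (f i).map_pt]

@[simp]
theorem bigWedgeLift_in (f : ∀ i, PointedMap (X i) Z) (i : ι) (x : X i) :
    bigWedgeLift f (bigWedgeIn X i x) = f i x :=
  collapseLift_mk (A := basepoints X) ..

theorem PointedMap.Homotopic.of_bigWedge {f g : PointedMap (bigWedge X) Z}
    (h : ∀ i, (f.comp (bigWedgeIn X i)).Homotopic (g.comp (bigWedgeIn X i))) : f.Homotopic g := by
  choose F hF0 hF1 hF using fun i => homotopic_iff.1 (h i)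
  let paths : Unit ⊕ (Σ i, X i) → C(I, Z) :=
    Sum.elim (fun _ => .const I Z.pt) fun p => ((F p.1).comp .prodSwap).curry p.2
  have _ : Continuous paths :=
    continuous_const.sumElim (continuous_sigma fun i => ((F i).comp .prodSwap).curry.continuous)
  refine .of_collapse (A := basepoints X) inl_mem_basepoints (fun t w => paths w t)
    (by fun_prop) ?_ ?_ ?_
  · rintro t _ (rfl | ⟨i, rfl⟩)
    exacts [rfl, hF i t]
  · rintro (_ | ⟨i, x⟩)
    exacts [f.map_pt.symm, hF0 i x]
  · rintro (_ | ⟨i, x⟩)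
    exacts [g.map_pt.symm, hF1 i x]

/-- The wedge of a family of pointed maps. -/
def bigWedgeMap (f : ∀ i, PointedMap (X i) (X' i)) : PointedMap (bigWedge X) (bigWedge X') :=
  bigWedgeLift fun i => (bigWedgeIn X' i).comp (f i)

theorem bigWedgeMap_homotopic_id {f : ∀ i, PointedMap (X i) (X' i)}
    {g : ∀ i, PointedMap (X' i) (X i)} (h : ∀ i, ((g i).comp (f i)).Homotopic (.id (X i))) :
    ((bigWedgeMap g).comp (bigWedgeMap f)).Homotopic (.id (bigWedge X)) := by
  refine .of_bigWedge fun i => ?_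
  convert (PointedMap.Homotopic.refl (bigWedgeIn X i)).comp (h i) using 1
  · ext
    simp [bigWedgeMap]
  · rfl

namespace PointedHomotopyEquivalent

theorem bigWedge_congr (h : ∀ i, PointedHomotopyEquivalent (X i) (X' i)) :
    PointedHomotopyEquivalent (bigWedge X) (bigWedge X') := by
  choose f g hgf hfg using fun i => pointedHomotopyEquivalent_iff.1 (h i)
  exact pointedHomotopyEquivalent_iff.2 ⟨bigWedgeMap f, bigWedgeMap g,
    bigWedgeMap_homotopic_id hgf, bigWedgeMap_homotopic_id hfg⟩

theorem bigWedge_reindex (e : ι ≃ κ) :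
    PointedHomotopyEquivalent (bigWedge fun i => Y (e i)) (bigWedge Y) := by
  let φ : (Unit ⊕ Σ i, Y (e i)) ≃ₜ (Unit ⊕ Σ j, Y j) :=
    (Homeomorph.refl Unit).sumCongr <| (Equiv.sigmaCongrLeft e).toHomeomorphOfContinuousOpen
      (continuous_sigma fun i => @continuous_sigmaMk _ (fun j => Y j) _ (e i))
      (isOpenMap_sigma.2 fun i => @isOpenMap_sigmaMk _ (fun j => Y j) _ (e i))
  refine collapse_congr (A := basepoints fun i => Y (e i)) (B := basepoints Y) φ rfl ?_
  rintro (_ | ⟨i, y⟩)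
  · exact iff_of_true inl_mem_basepoints inl_mem_basepoints
  · have hφ : φ (Sum.inr ⟨i, y⟩) = Sum.inr ⟨e i, y⟩ := rfl
    rw [hφ, inr_mem_basepoints_iff, inr_mem_basepoints_iff]

theorem bigWedge_sum (X : ι ⊕ κ → PointedSpace) : PointedHomotopyEquivalent (bigWedge X)
    (wedge (bigWedge fun i => X (Sum.inl i)) (bigWedge fun j => X (Sum.inr j))) := by
  refine of_inverse
    (bigWedgeLift <| Sum.rec
      (fun i => (wedgeInl _ _).comp (bigWedgeIn (fun i => X (Sum.inl i)) i))
      (fun j => (wedgeInr _ _).comp (bigWedgeIn (fun j => X (Sum.inr j)) j)))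
    (wedgeLift (bigWedgeLift fun i => bigWedgeIn X (Sum.inl i))
      (bigWedgeLift fun j => bigWedgeIn X (Sum.inr j))) ?_ ?_
  · refine bigWedge_ind (by simp) ?_
    rintro (i | j) x <;> simp
  · exact wedge_ind (bigWedge_ind (by simp) (by simp)) (bigWedge_ind (by simp) (by simp))

theorem bigWedge_unique [Unique ι] (X : ι → PointedSpace) :
    PointedHomotopyEquivalent (bigWedge X) (X default) := by
  obtain ⟨Z, rfl⟩ : ∃ Z, X = fun _ => Z :=
    ⟨X default, funext fun i => congrArg X (Unique.eq_default i)⟩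
  refine of_inverse (bigWedgeLift fun _ => .id Z) (bigWedgeIn (fun _ => Z) default)
    (bigWedge_ind (by simp) fun i z => ?_) fun z => bigWedgeLift_in ..
  rw [bigWedgeLift_in, Unique.eq_default i]
  rfl

end PointedHomotopyEquivalent

end BigWedge

/-! ### Splitting the suspension of a space with a retract -/

theorem wedgeInl_suspPoint_eq_pt {X Y : PointedSpace} {x : X} {s : ℝ}
    (h : s ≤ 0 ∨ 1 ≤ s ∨ x = X.pt) :
    wedgeInl (reducedSuspension X) Y (suspPoint X (x, s)) = (wedge (reducedSuspension X) Y).pt := by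
  rw [suspPoint_eq_pt h, PointedMap.map_pt]

theorem wedgeInr_suspPoint_eq_pt {X Y : PointedSpace} {y : Y} {s : ℝ}
    (h : s ≤ 0 ∨ 1 ≤ s ∨ y = Y.pt) :
    wedgeInr X (reducedSuspension Y) (suspPoint Y (y, s)) = (wedge X (reducedSuspension Y)).pt := by
  rw [suspPoint_eq_pt h, PointedMap.map_pt]

/-- A retract `A` of `X` with a fibrewise deformation of `X` that fixes `A` and whose end map is the
retraction near `A`, namely where `dist` is not `1`. The function `dist` lives on a space `E` of
which `X` is a quotient, since in the applications it descends to `X` only away from the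
basepoint. -/
structure FibrewiseRetraction (X A : PointedSpace) (E : Type) [TopologicalSpace E] where
  incl : PointedMap A X
  retr : PointedMap X A
  deform : C(I × X, X)
  cover : C(E, X)
  dist : C(E, I)
  retr_incl : ∀ a, retr (incl a) = a
  deform_zero : ∀ x, deform (0, x) = x
  deform_incl : ∀ t a, deform (t, incl a) = incl a
  retr_deform : ∀ t x, retr (deform (t, x)) = retr x
  isQuotientMap_cover : IsQuotientMap cover
  dist_eq : ∀ e e', cover e = cover e' → cover e = X.pt ∨ dist e = dist e'
  dist_incl : ∀ e a, cover e = incl a → cover e = X.pt ∨ dist e = 0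
  deform_one : ∀ e, dist e ≠ 1 → deform (1, cover e) = incl (retr (cover e))

namespace FibrewiseRetraction

variable {X A : PointedSpace} {E : Type} [TopologicalSpace E] (D : FibrewiseRetraction X A E)
  {Z : PointedSpace}

/-- The quotient `X / A`. -/
abbrev cofiber : PointedSpace := collapse (range D.incl) X.pt

/-- The projection `X → X / A`. -/
def proj : PointedMap X D.cofiber := ⟨collapseMk (range D.incl) X.pt, rfl⟩

theorem pt_mem_range : X.pt ∈ range D.incl := ⟨A.pt, D.incl.map_pt⟩

theorem deform_pt (t : I) : D.deform (t, X.pt) = X.pt := by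
  simpa only [D.incl.map_pt] using D.deform_incl t A.pt

theorem proj_eq_pt_iff {x : X} : D.proj x = D.cofiber.pt ↔ x ∈ range D.incl :=
  collapseMk_eq_pt_iff D.pt_mem_range

@[simp]
theorem proj_incl (a : A) : D.proj (D.incl a) = D.cofiber.pt :=
  D.proj_eq_pt_iff.2 (mem_range_self a)

/-- The cover of `X / A`. -/
def cofiberCover : C(E, D.cofiber) := (D.proj : C(X, D.cofiber)).comp D.cover

@[simp]
theorem cofiberCover_apply (e : E) : D.cofiberCover e = D.proj (D.cover e) := rfl

theorem isQuotientMap_cofiberCover : IsQuotientMap D.cofiberCover :=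
  isQuotientMap_collapseMk.comp D.isQuotientMap_cover

section Descent

variable {G : X → I → Z} {e e' : E}

theorem eq_of_cover_eq (hpt : ∀ l, G X.pt l = Z.pt) (h : D.cover e = D.cover e') :
    G (D.cover e) (D.dist e) = G (D.cover e') (D.dist e') := by
  rcases D.dist_eq e e' h with h' | h'
  · rw [← h, h', hpt, hpt]
  · rw [h, h']

theorem eq_pt_of_cofiberCover_eq_pt (hpt : ∀ l, G X.pt l = Z.pt)
    (hA : ∀ a, G (D.incl a) 0 = Z.pt) (h : D.cofiberCover e = D.cofiber.pt) :
    G (D.cover e) (D.dist e) = Z.pt := by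
  obtain ⟨a, ha⟩ := D.proj_eq_pt_iff.1 h
  rcases D.dist_incl e a ha.symm with h' | h'
  · rw [h', hpt]
  · rw [h', ← ha, hA]

theorem eq_of_cofiberCover_eq (hpt : ∀ l, G X.pt l = Z.pt) (hA : ∀ a, G (D.incl a) 0 = Z.pt)
    (h : D.cofiberCover e = D.cofiberCover e') :
    G (D.cover e) (D.dist e) = G (D.cover e') (D.dist e') := by
  rcases collapseMk_eq_iff.1 h with h' | ⟨he, he'⟩
  · exact D.eq_of_cover_eq hpt h'
  · rw [D.eq_pt_of_cofiberCover_eq_pt hpt hA (D.proj_eq_pt_iff.2 he),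
      D.eq_pt_of_cofiberCover_eq_pt hpt hA (D.proj_eq_pt_iff.2 he')]

end Descent

/-- The pointed map out of `ΣX` given by a formula in the point, its distance and its height. -/
def lift (G : X → I → I → Z) (hG : Continuous fun p : E × I => G (D.cover p.1) (D.dist p.1) p.2)
    (hpt : ∀ x l s, s = 0 ∨ s = 1 ∨ x = X.pt → G x l s = Z.pt) :
    PointedMap (reducedSuspension X) Z :=
  suspLift D.isQuotientMap_cover (fun e s => G (D.cover e) (D.dist e) s) hG
    (fun _ _ s => D.eq_of_cover_eq (G := fun x l => G x l s) fun l =>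
      hpt X.pt l s (Or.inr (Or.inr rfl)))
    fun _ _ h => hpt _ _ _ h

@[simp]
theorem lift_suspPoint (G : X → I → I → Z)
    (hG : Continuous fun p : E × I => G (D.cover p.1) (D.dist p.1) p.2)
    (hpt : ∀ x l s, s = 0 ∨ s = 1 ∨ x = X.pt → G x l s = Z.pt) (e : E) (s : I) :
    D.lift G hG hpt (suspPoint X (D.cover e, s)) = G (D.cover e) (D.dist e) s :=
  suspLift_apply ..

theorem homotopic_of_susp {f g : PointedMap (reducedSuspension X) Z} (H : I → X → I → I → Z)
    (hH : Continuous fun p : I × E × I => H p.1 (D.cover p.2.1) (D.dist p.2.1) p.2.2)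
    (hpt : ∀ t x l s, s = 0 ∨ s = 1 ∨ x = X.pt → H t x l s = Z.pt)
    (h0 : ∀ e s, H 0 (D.cover e) (D.dist e) s = f (suspPoint X (D.cover e, s)))
    (h1 : ∀ e s, H 1 (D.cover e) (D.dist e) s = g (suspPoint X (D.cover e, s))) :
    f.Homotopic g :=
  .of_susp D.isQuotientMap_cover (fun t e s => H t (D.cover e) (D.dist e) s) hH
    (fun t _ _ s => D.eq_of_cover_eq (G := fun x l => H t x l s) fun l =>
      hpt t X.pt l s (Or.inr (Or.inr rfl)))
    (fun t _ _ h => hpt t _ _ _ h) h0 h1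

/-- The pointed map out of `Σ(X / A)` given by a formula in the point, its distance and its
height. -/
def cofiberLift (G : X → I → I → Z)
    (hG : Continuous fun p : E × I => G (D.cover p.1) (D.dist p.1) p.2)
    (hpt : ∀ x l s, s = 0 ∨ s = 1 ∨ x = X.pt → G x l s = Z.pt)
    (hA : ∀ a s, G (D.incl a) 0 s = Z.pt) : PointedMap (reducedSuspension D.cofiber) Z :=
  have hpt' s l : G X.pt l s = Z.pt := hpt X.pt l s (Or.inr (Or.inr rfl))
  suspLift D.isQuotientMap_cofiberCover (fun e s => G (D.cover e) (D.dist e) s) hG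
    (fun _ _ s => D.eq_of_cofiberCover_eq (G := fun x l => G x l s) (hpt' s) fun a => hA a s) <| by
    rintro e s (h | h | h)
    · exact hpt _ _ _ (Or.inl h)
    · exact hpt _ _ _ (Or.inr (Or.inl h))
    · exact D.eq_pt_of_cofiberCover_eq_pt (G := fun x l => G x l s) (hpt' s) (fun a => hA a s) h

@[simp]
theorem cofiberLift_suspPoint (G : X → I → I → Z)
    (hG : Continuous fun p : E × I => G (D.cover p.1) (D.dist p.1) p.2)
    (hpt : ∀ x l s, s = 0 ∨ s = 1 ∨ x = X.pt → G x l s = Z.pt)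
    (hA : ∀ a s, G (D.incl a) 0 s = Z.pt) (e : E) (s : I) :
    D.cofiberLift G hG hpt hA (suspPoint D.cofiber (D.cofiberCover e, s)) =
      G (D.cover e) (D.dist e) s :=
  suspLift_apply ..

theorem homotopic_of_susp_cofiber {f g : PointedMap (reducedSuspension D.cofiber) Z}
    (H : I → X → I → I → Z)
    (hH : Continuous fun p : I × E × I => H p.1 (D.cover p.2.1) (D.dist p.2.1) p.2.2)
    (hpt : ∀ t x l s, s = 0 ∨ s = 1 ∨ x = X.pt → H t x l s = Z.pt)
    (hA : ∀ t a s, H t (D.incl a) 0 s = Z.pt)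
    (h0 : ∀ e s, H 0 (D.cover e) (D.dist e) s = f (suspPoint D.cofiber (D.cofiberCover e, s)))
    (h1 : ∀ e s, H 1 (D.cover e) (D.dist e) s = g (suspPoint D.cofiber (D.cofiberCover e, s))) :
    f.Homotopic g := by
  have hpt' t s l : H t X.pt l s = Z.pt := hpt t X.pt l s (Or.inr (Or.inr rfl))
  refine .of_susp D.isQuotientMap_cofiberCover (fun t e s => H t (D.cover e) (D.dist e) s) hH
    (fun t _ _ s => D.eq_of_cofiberCover_eq (G := fun x l => H t x l s) (hpt' t s)
      fun a => hA t a s) ?_ h0 h1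
  rintro t e s (h | h | h)
  · exact hpt _ _ _ _ (Or.inl h)
  · exact hpt _ _ _ _ (Or.inr (Or.inl h))
  · exact D.eq_pt_of_cofiberCover_eq_pt (G := fun x l => H t x l s) (hpt' t s)
      (fun a => hA t a s) h

theorem suspPoint_deform_one (e : E) {s : ℝ} (hs : (D.dist e : ℝ) ≤ s) :
    suspPoint X (D.deform (1, D.cover e), s) = suspPoint X (D.incl (D.retr (D.cover e)), s) := by
  by_cases h : D.dist e = 1
  · rw [h] at hs
    rw [suspPoint_eq_pt (Or.inr (Or.inl hs)), suspPoint_eq_pt (Or.inr (Or.inl hs))]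
  · rw [D.deform_one e h]

/-- The wedge `ΣA ∨ Σ(X / A)`. -/
abbrev splitting : PointedSpace := wedge (reducedSuspension A) (reducedSuspension D.cofiber)

/-- The loop of `x` in `ΣA ∨ Σ(X / A)`, at height `p`: first the loop of the image in `X / A`, then
the loop of the image in `A`. At parameter `t` only the part of the second loop below height `1 - t`
is traversed. -/
def splitPoint (t : ℝ) (x : X) (p : ℝ) : D.splitting :=
  if p ≤ 1 / 2 then wedgeInr _ _ (suspPoint D.cofiber (D.proj x, 2 * p))
  else wedgeInl _ _ (suspPoint A (D.retr x, (1 - t) * (2 * p - 1)))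

@[fun_prop]
theorem continuous_splitPoint {W : Type*} [TopologicalSpace W] {t : W → ℝ} {x : W → X} {p : W → ℝ}
    (ht : Continuous t) (hx : Continuous x) (hp : Continuous p) :
    Continuous fun w => D.splitPoint (t w) (x w) (p w) := by
  refine Continuous.if_le (by fun_prop) (by fun_prop) hp continuous_const fun w hw => ?_
  rw [wedgeInl_suspPoint_eq_pt (by simp [hw]), wedgeInr_suspPoint_eq_pt (by simp [hw])]

theorem splitPoint_eq_pt {t : ℝ} {x : X} {p : ℝ} (h : p ≤ 0 ∨ x = X.pt) :
    D.splitPoint t x p = D.splitting.pt := by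
  unfold splitPoint
  rcases h with h | rfl
  · rw [if_pos (by linarith), wedgeInr_suspPoint_eq_pt (by left; linarith)]
  · rw [wedgeInl_suspPoint_eq_pt (by simp), wedgeInr_suspPoint_eq_pt (by simp), ite_self]

theorem splitPoint_zero_eq_pt {x : X} {p : ℝ} (h : 1 ≤ p) :
    D.splitPoint 0 x p = D.splitting.pt := by
  rw [splitPoint, if_neg (by linarith), wedgeInl_suspPoint_eq_pt (by right; left; linarith)]

theorem splitPoint_incl (t : I) (a : A) (p : ℝ) :
    D.splitPoint t (D.incl a) p = wedgeInl _ _ (suspPoint A (a, (1 - t) * (2 * p - 1))) := by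
  have ht : (t : ℝ) ≤ 1 := t.2.2
  rw [splitPoint, D.retr_incl]
  split_ifs with hp
  · rw [wedgeInr_suspPoint_eq_pt (by simp), wedgeInl_suspPoint_eq_pt]
    exact Or.inl (mul_nonpos_of_nonneg_of_nonpos (by linarith) (by linarith))
  · rfl

/-- The comparison map `ΣX → ΣA ∨ Σ(X / A)`. -/
def split : PointedMap (reducedSuspension X) D.splitting :=
  D.lift (fun x _ s => D.splitPoint 0 x s) (by fun_prop) <| by
    rintro x _ s (rfl | rfl | h)
    exacts [D.splitPoint_eq_pt (by simp), D.splitPoint_zero_eq_pt (by simp),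
      D.splitPoint_eq_pt (Or.inr h)]

@[simp]
theorem split_suspPoint (x : X) (p : ℝ) : D.split (suspPoint X (x, p)) = D.splitPoint 0 x p := by
  obtain ⟨e, rfl⟩ := D.isQuotientMap_cover.surjective x
  rcases le_total p 0 with h0 | h0
  · rw [D.splitPoint_eq_pt (Or.inl h0), suspPoint_eq_pt (Or.inl h0), PointedMap.map_pt]
  rcases le_total 1 p with h1 | h1
  · rw [D.splitPoint_zero_eq_pt h1, suspPoint_eq_pt (Or.inr (Or.inl h1)), PointedMap.map_pt]
  · exact D.lift_suspPoint _ _ _ e ⟨p, h0, h1⟩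

/-- The loop of the class of `x` in `ΣX`: up to height `l` along the loop of the end point of the
deformation, and back down along the loop of the image of `x` in `A`. -/
def joinPoint (x : X) (l : I) (s : ℝ) : reducedSuspension X :=
  if s ≤ 1 / 2 then suspPoint X (D.deform (1, x), 2 * s * l)
  else suspPoint X (D.incl (D.retr x), (2 - 2 * s) * l)

theorem joinPoint_eq_pt {x : X} {l : I} {s : ℝ} (h : s = 0 ∨ s = 1 ∨ x = X.pt ∨ l = 0) :
    D.joinPoint x l s = (reducedSuspension X).pt := by
  unfold joinPoint
  rcases h with rfl | rfl | rfl | rfl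
  · rw [if_pos (by norm_num), suspPoint_eq_pt (by simp)]
  · rw [if_neg (by norm_num), suspPoint_eq_pt (by simp)]
  · simp [D.deform_pt]
  · simp

/-- The map `Σ(X / A) → ΣX`. -/
def join : PointedMap (reducedSuspension D.cofiber) (reducedSuspension X) :=
  D.cofiberLift (fun x l s => D.joinPoint x l s)
    (Continuous.if_le (by fun_prop) (by fun_prop) (by fun_prop) continuous_const fun w hw => by
      convert D.suspPoint_deform_one w.1 (s := 2 * w.2 * D.dist w.1) (by simp [hw]) using 3
      rw [hw]
      ring)
    (fun x l s h => D.joinPoint_eq_pt (by simpa [or_assoc] using h.imp_right (Or.imp_right Or.inl)))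
    fun _ _ => D.joinPoint_eq_pt (by simp)

theorem join_suspPoint (e : E) (s : I) :
    D.join (suspPoint D.cofiber (D.cofiberCover e, s)) = D.joinPoint (D.cover e) (D.dist e) s :=
  D.cofiberLift_suspPoint ..

/-- The homotopy inverse of the comparison map. -/
def unsplit : PointedMap D.splitting (reducedSuspension X) := wedgeLift (suspMap D.incl) D.join

/-- A reparametrisation of the unit interval that maps `[0, 1 / 4]` to `[0, l]`. -/
def stretch (l s : ℝ) : ℝ := l * min (4 * s) 1 + (1 - l) * max 0 ((4 * s - 1) / 3)

@[fun_prop]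
theorem continuous_stretch {W : Type*} [TopologicalSpace W] {l s : W → ℝ} (hl : Continuous l)
    (hs : Continuous s) : Continuous fun w => stretch (l w) (s w) := by
  unfold stretch
  fun_prop

@[simp]
theorem stretch_zero (l : ℝ) : stretch l 0 = 0 := by
  rw [stretch, min_eq_left (by norm_num), max_eq_left (by norm_num)]
  ring

@[simp]
theorem stretch_one (l : ℝ) : stretch l 1 = 1 := by
  rw [stretch, min_eq_right (by norm_num), max_eq_right (by norm_num)]
  ring

theorem stretch_of_le {l s : ℝ} (hs : s ≤ 1 / 4) : stretch l s = 4 * s * l := by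
  rw [stretch, min_eq_left (by linarith), max_eq_left (by linarith)]
  ring

theorem le_stretch {l s : ℝ} (hl : l ≤ 1) (hs : 1 / 4 ≤ s) : l ≤ stretch l s := by
  rw [stretch, min_eq_right (by linarith), mul_one]
  exact le_add_of_nonneg_right (mul_nonneg (by linarith) (le_max_left _ _))

/-- The end map of the deformation, with the heights reparametrised. -/
def stretchedDeform : PointedMap (reducedSuspension X) (reducedSuspension X) :=
  D.lift (fun x l s => suspPoint X (D.deform (1, x), stretch l s)) (by fun_prop) <| by
    rintro x l s (rfl | rfl | rfl) <;> exact suspPoint_eq_pt (by simp [D.deform_pt])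

theorem stretchedDeform_homotopic_id : D.stretchedDeform.Homotopic (.id _) :=
  D.homotopic_of_susp
    (fun t x l s => suspPoint X (D.deform (σ t, x), (1 - t) * stretch l s + t * s)) (by fun_prop)
    (by rintro t x l s (rfl | rfl | rfl) <;> exact suspPoint_eq_pt (by simp [D.deform_pt]))
    (by simp [stretchedDeform]) (by simp [D.deform_zero])

/-- The homotopy from `unsplit ∘ split` to `stretchedDeform`. Above height `1 / 4` the deformation
does not matter anymore, and the height function interpolates between its values in the two maps. -/
def unsplitSplitPoint (t : ℝ) (x : X) (l : I) (s : ℝ) : reducedSuspension X :=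
  if s ≤ 1 / 4 then suspPoint X (D.deform (1, x), 4 * s * l)
  else suspPoint X (D.incl (D.retr x),
    (1 - t) * (l * max (2 - 4 * s) 0 + max (2 * s - 1) 0) + t * stretch l s)

theorem continuous_unsplitSplitPoint : Continuous fun p : I × E × I =>
    D.unsplitSplitPoint p.1 (D.cover p.2.1) (D.dist p.2.1) p.2.2 := by
  refine Continuous.if_le (by fun_prop) (by fun_prop) (by fun_prop) continuous_const fun w hw => ?_
  have hl : 4 * (w.2.2 : ℝ) * D.dist w.2.1 = D.dist w.2.1 := by rw [hw]; ring
  rw [stretch_of_le hw.le, hl, D.suspPoint_deform_one _ le_rfl, hw]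
  norm_num
  ring_nf

theorem unsplitSplitPoint_zero (e : E) (s : I) :
    D.unsplitSplitPoint 0 (D.cover e) (D.dist e) s =
      D.unsplit (D.split (suspPoint X (D.cover e, s))) := by
  have hs0 := s.2.1
  rw [split_suspPoint, splitPoint, unsplitSplitPoint]
  split_ifs with h4 h2 h2
  · rw [unsplit, wedgeLift_inr]
    have := D.join_suspPoint e ⟨2 * s, by linarith, by linarith⟩
    rw [cofiberCover_apply] at this
    rw [this, joinPoint, if_pos (by linarith)]
    ring_nf
  · linarith
  · rw [unsplit, wedgeLift_inr]
    have := D.join_suspPoint e ⟨2 * s, by linarith, by linarith⟩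
    rw [cofiberCover_apply] at this
    rw [this, joinPoint, if_neg (by linarith), max_eq_left (by linarith),
      max_eq_right (by linarith)]
    ring_nf
  · rw [unsplit, wedgeLift_inl, suspMap_apply, max_eq_right (by linarith),
      max_eq_left (by linarith)]
    ring_nf

theorem unsplitSplitPoint_one (e : E) (s : I) :
    D.unsplitSplitPoint 1 (D.cover e) (D.dist e) s =
      suspPoint X (D.deform (1, D.cover e), stretch (D.dist e) s) := by
  rw [unsplitSplitPoint]
  split_ifs with h
  · rw [stretch_of_le h]
  · rw [D.suspPoint_deform_one e (le_stretch (D.dist e).2.2 (not_le.1 h).le)]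
    ring_nf

theorem unsplit_split_homotopic_id : (D.unsplit.comp D.split).Homotopic (.id _) := by
  refine .trans (D.homotopic_of_susp (fun t x l s => D.unsplitSplitPoint t x l s)
    D.continuous_unsplitSplitPoint ?_ D.unsplitSplitPoint_zero fun e s => ?_)
    D.stretchedDeform_homotopic_id
  · rintro t x l s (rfl | rfl | rfl)
    · rw [unsplitSplitPoint, if_pos (by simp), suspPoint_eq_pt (by simp)]
    · rw [unsplitSplitPoint, if_neg (by norm_num), suspPoint_eq_pt]
      norm_num
    · simp [unsplitSplitPoint, D.deform_pt]
  · rw [stretchedDeform, lift_suspPoint]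
    exact D.unsplitSplitPoint_one e s

/-- The deformation of `Σ(X / A)` at its end, with the loops traversed at fourfold speed. -/
def spedDeform : PointedMap (reducedSuspension D.cofiber) D.splitting :=
  D.cofiberLift (fun x _ s => wedgeInr _ _ (suspPoint D.cofiber (D.proj (D.deform (1, x)), 4 * s)))
    (by fun_prop)
    (by
      rintro x _ s (rfl | rfl | rfl) <;> refine wedgeInr_suspPoint_eq_pt ?_ <;>
        norm_num [D.deform_pt])
    fun a s => wedgeInr_suspPoint_eq_pt (by simp [D.deform_incl])

theorem spedDeform_homotopic_inr : D.spedDeform.Homotopic (wedgeInr _ _) := by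
  refine D.homotopic_of_susp_cofiber
    (fun t x _ s => wedgeInr _ _ (suspPoint D.cofiber (D.proj (D.deform (σ t, x)),
      (1 - t) * (4 * s) + t * s))) (by fun_prop) ?_
    (fun t a s => wedgeInr_suspPoint_eq_pt (by simp [D.deform_incl]))
    (fun e s => by rw [spedDeform, cofiberLift_suspPoint]; simp) (by simp [D.deform_zero])
  rintro t x _ s (rfl | rfl | rfl) <;> refine wedgeInr_suspPoint_eq_pt ?_
  · simp
  · have := t.2.2
    right; left
    norm_num
    linarith
  · simp [D.deform_pt]

/-- The homotopy from `split ∘ join` to `spedDeform`. At parameter `t` the loops in `ΣA` are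
traversed only below height `1 - t`. -/
def splitUnsplitPoint (t : ℝ) (x : X) (l : I) (s : ℝ) : D.splitting :=
  if s ≤ 1 / 2 then D.splitPoint t (D.deform (1, x)) (2 * s * l)
  else wedgeInl _ _ (suspPoint A (D.retr x, (1 - t) * ((4 - 4 * s) * l - 1)))

theorem splitUnsplitPoint_eq_pt {t : I} {x : X} {l : I} {s : ℝ}
    (h : s = 0 ∨ s = 1 ∨ x = X.pt ∨ l = 0) : D.splitUnsplitPoint t x l s = D.splitting.pt := by
  have ht : (t : ℝ) ≤ 1 := t.2.2
  unfold splitUnsplitPoint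
  rcases h with rfl | rfl | rfl | rfl
  · rw [if_pos (by norm_num), D.splitPoint_eq_pt (by simp)]
  · rw [if_neg (by norm_num), wedgeInl_suspPoint_eq_pt (by simp [ht])]
  · rw [D.splitPoint_eq_pt (by simp [D.deform_pt]), wedgeInl_suspPoint_eq_pt (by simp), ite_self]
  · rw [D.splitPoint_eq_pt (by simp), wedgeInl_suspPoint_eq_pt (by simp [ht]), ite_self]

theorem splitPoint_deform_one (t : I) (e : E) :
    D.splitPoint t (D.deform (1, D.cover e)) (D.dist e) =
      wedgeInl _ _ (suspPoint A (D.retr (D.cover e), (1 - t) * (2 * D.dist e - 1))) := by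
  by_cases h : D.dist e = 1
  · rw [splitPoint, D.retr_deform, if_neg (by rw [h]; norm_num)]
  · rw [D.deform_one e h, splitPoint_incl]

theorem continuous_splitUnsplitPoint : Continuous fun p : I × E × I =>
    D.splitUnsplitPoint p.1 (D.cover p.2.1) (D.dist p.2.1) p.2.2 := by
  refine Continuous.if_le (by fun_prop) (by fun_prop) (by fun_prop) continuous_const fun w hw => ?_
  convert D.splitPoint_deform_one w.1 w.2.1 using 5 <;> rw [hw] <;> ring

theorem splitUnsplitPoint_zero (e : E) (s : I) :
    D.splitUnsplitPoint 0 (D.cover e) (D.dist e) s =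
      D.split (D.joinPoint (D.cover e) (D.dist e) s) := by
  rw [splitUnsplitPoint, joinPoint]
  split_ifs with hs
  · rw [split_suspPoint]
  · have := D.splitPoint_incl 0 (D.retr (D.cover e)) ((2 - 2 * s) * D.dist e)
    rw [Icc.coe_zero] at this
    rw [split_suspPoint, this]
    ring_nf

theorem splitUnsplitPoint_one (e : E) (s : I) :
    D.splitUnsplitPoint 1 (D.cover e) (D.dist e) s =
      wedgeInr _ _ (suspPoint D.cofiber (D.proj (D.deform (1, D.cover e)), 4 * s)) := by
  rw [splitUnsplitPoint]
  by_cases hl : D.dist e = 1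
  · rw [hl, splitPoint]
    split_ifs with hs hs' <;> rw [Icc.coe_one] at *
    · ring_nf
    all_goals
      rw [wedgeInl_suspPoint_eq_pt (by simp), wedgeInr_suspPoint_eq_pt (by right; left; linarith)]
  · have := D.splitPoint_incl 1 (D.retr (D.cover e)) (2 * s * D.dist e)
    rw [Icc.coe_one] at this
    rw [D.deform_one e hl, this, wedgeInl_suspPoint_eq_pt (by simp),
      wedgeInl_suspPoint_eq_pt (by simp), wedgeInr_suspPoint_eq_pt (by simp), ite_self]

theorem split_suspMap_homotopic_inl :
    (D.split.comp (suspMap D.incl)).Homotopic (wedgeInl _ _) := by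
  refine .of_susp (π := ContinuousMap.id A) IsQuotientMap.id
    (fun t a s => wedgeInl _ _ (suspPoint A (a, (1 - t) * (2 * s - 1) + t * s))) (by fun_prop)
    (by rintro t a _ s rfl; rfl) ?_ (fun a s => ?_) (by simp)
  · rintro t a s (rfl | rfl | h) <;> refine wedgeInl_suspPoint_eq_pt ?_
    · simp [t.2.2]
    · norm_num
    · exact Or.inr (Or.inr h)
  · have := D.splitPoint_incl 0 a s
    rw [Icc.coe_zero] at this
    simp [this]

theorem split_join_homotopic_inr : (D.split.comp D.join).Homotopic (wedgeInr _ _) := by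
  refine .trans (D.homotopic_of_susp_cofiber (fun t x l s => D.splitUnsplitPoint t x l s)
    D.continuous_splitUnsplitPoint ?_ (fun _ _ _ => D.splitUnsplitPoint_eq_pt (by simp))
    (fun e s => ?_) fun e s => ?_) D.spedDeform_homotopic_inr
  · rintro t x l s (rfl | rfl | rfl) <;> exact D.splitUnsplitPoint_eq_pt (by simp)
  · rw [PointedMap.comp_apply, join_suspPoint]
    exact D.splitUnsplitPoint_zero e s
  · rw [spedDeform, cofiberLift_suspPoint]
    exact D.splitUnsplitPoint_one e s

theorem split_unsplit_homotopic_id : (D.split.comp D.unsplit).Homotopic (.id _) := by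
  refine .of_wedge ?_ ?_
  · exact (PointedMap.ext fun w => by simp [unsplit] :
      (D.split.comp D.unsplit).comp (wedgeInl _ _) = D.split.comp (suspMap D.incl)) ▸
        D.split_suspMap_homotopic_inl
  · exact (PointedMap.ext fun w => by simp [unsplit] :
      (D.split.comp D.unsplit).comp (wedgeInr _ _) = D.split.comp D.join) ▸
        D.split_join_homotopic_inr

theorem susp_equivalent_splitting :
    PointedHomotopyEquivalent (reducedSuspension X) D.splitting :=
  pointedHomotopyEquivalent_iff.2
    ⟨D.split, D.unsplit, D.unsplit_split_homotopic_id, D.split_unsplit_homotopic_id⟩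

end FibrewiseRetraction

/-! ### Circle coordinates -/

section Shrink

variable {F : Type*} [NormedAddCommGroup F] [InnerProductSpace ℝ F] {e v : F}

/-- The contraction of the unit sphere towards `e`, before normalisation. The last summand keeps
the vector away from `0` on the hemisphere opposite to `e`. -/
def shrinkVec (e : F) (t : ℝ) (v : F) : F :=
  (inner ℝ e v + t * (1 - |inner ℝ e v|)) • e +
    ((1 - t) + t * max 0 (-inner ℝ e v)) • (v - inner ℝ e v • e)

/-- A homotopy of the unit sphere from the identity, relative to `e`, whose end map sends the
hemisphere around `e` to `e`. -/
def shrink (e : F) (t : ℝ) (v : F) : F := ‖shrinkVec e t v‖⁻¹ • shrinkVec e t v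

theorem inner_shrinkVec (he : ‖e‖ = 1) (t : ℝ) (v : F) :
    inner ℝ e (shrinkVec e t v) = inner ℝ e v + t * (1 - |inner ℝ e v|) := by
  simp [shrinkVec, inner_add_right, inner_sub_right, inner_smul_right, he]

theorem shrinkVec_ne_zero (he : ‖e‖ = 1) (hv : ‖v‖ = 1) (t : I) : shrinkVec e t v ≠ 0 := by
  intro h
  have h0 := t.2.1
  have h1 := t.2.2
  have hx : inner ℝ e v + t * (1 - |inner ℝ e v|) = 0 := by
    rw [← inner_shrinkVec he, h, inner_zero_right]
  rw [shrinkVec, hx, zero_smul, zero_add, smul_eq_zero] at h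
  set x : ℝ := inner ℝ e v
  rcases h with h | h
  · have hmax := mul_nonneg h0 (le_max_left 0 (-x))
    have ht : (t : ℝ) = 1 := by linarith
    rw [ht, one_mul] at h hx
    have hx0 : 0 ≤ x := by linarith [le_max_right 0 (-x)]
    rw [abs_of_nonneg hx0] at hx
    linarith
  · have hvx : v = x • e := sub_eq_zero.1 h
    have hx1 : |x| = 1 := by rw [← hv, hvx, norm_smul, he, mul_one, Real.norm_eq_abs]
    rw [hx1, sub_self, mul_zero, add_zero] at hx
    simp [hx] at hx1

theorem norm_shrink (he : ‖e‖ = 1) (hv : ‖v‖ = 1) (t : I) : ‖shrink e t v‖ = 1 := by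
  rw [shrink, norm_smul, norm_inv, norm_norm]
  exact inv_mul_cancel₀ (norm_ne_zero_iff.2 (shrinkVec_ne_zero he hv t))

theorem shrink_zero (hv : ‖v‖ = 1) : shrink e 0 v = v := by
  simp [shrink, shrinkVec, hv]

theorem shrink_self (he : ‖e‖ = 1) (t : ℝ) : shrink e t e = e := by
  simp [shrink, shrinkVec, he]

theorem shrink_one (he : ‖e‖ = 1) (hv : 0 ≤ inner ℝ e v) : shrink e 1 v = e := by
  simp [shrink, shrinkVec, he, hv, abs_of_nonneg]

theorem shrink_map (φ : F →ₗᵢ[ℝ] F) (hφ : φ e = e) (t : ℝ) (v : F) :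
    shrink e t (φ v) = φ (shrink e t v) := by
  have hinner : inner ℝ e (φ v) = inner ℝ e v := by
    conv_lhs => rw [← hφ]
    exact φ.inner_map_map e v
  have hvec : shrinkVec e t (φ v) = φ (shrinkVec e t v) := by
    simp only [shrinkVec, hinner, map_add, map_smul, map_sub, hφ]
  rw [shrink, shrink, hvec, φ.norm_map, map_smul]

theorem continuous_shrink {W : Type*} [TopologicalSpace W] (he : ‖e‖ = 1) {t : W → I} {v : W → F}
    (ht : Continuous t) (hv : Continuous v) (hv1 : ∀ w, ‖v w‖ = 1) :
    Continuous fun w => shrink e (t w) (v w) := by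
  have : Continuous fun w => shrinkVec e (t w) (v w) := by
    unfold shrinkVec
    fun_prop
  exact (this.norm.inv₀ fun w => norm_ne_zero_iff.2 (shrinkVec_ne_zero he (hv1 w) (t w))).smul this

end Shrink

/-- The contraction of a half-circle to `1`. -/
def circleShrink : C(I × Circle, Circle) where
  toFun p := ⟨shrink (1 : ℂ) p.1 p.2, mem_sphere_zero_iff_norm.2 <|
    norm_shrink norm_one p.2.norm_coe p.1⟩
  continuous_toFun := (continuous_shrink norm_one continuous_fst
    (continuous_subtype_val.comp continuous_snd) fun p => Circle.norm_coe p.2).subtype_mk _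

theorem circleShrink_zero (z : Circle) : circleShrink (0, z) = z :=
  Circle.ext (shrink_zero z.norm_coe)

theorem circleShrink_apply_one (t : I) : circleShrink (t, 1) = 1 :=
  Circle.ext (shrink_self norm_one _)

theorem circleShrink_inv (t : I) (z : Circle) :
    circleShrink (t, z⁻¹) = (circleShrink (t, z))⁻¹ := by
  refine Circle.ext ?_
  rw [Circle.coe_inv_eq_conj]
  change shrink (1 : ℂ) t (z⁻¹ : Circle) = _
  rw [Circle.coe_inv_eq_conj]
  exact shrink_map Complex.conjLIE.toLinearIsometry (by simp) t z

/-- A measure for the distance of a point of the circle from `1`, which is constantly `1` on the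
opposite half-circle. -/
def circleDist : C(Circle, I) where
  toFun z := projIcc 0 1 zero_le_one (1 - (z : ℂ).re)
  continuous_toFun := continuous_projIcc.comp (by fun_prop)

theorem circleDist_one : circleDist 1 = 0 := by
  simp [circleDist]

theorem circleDist_inv (z : Circle) : circleDist z⁻¹ = circleDist z := by
  simp [circleDist]

theorem circleShrink_one {z : Circle} (hz : circleDist z ≠ 1) : circleShrink (1, z) = 1 := by
  have hre : 0 ≤ (z : ℂ).re := by
    by_contra! h
    exact hz (projIcc_of_right_le zero_le_one (by linarith))
  exact Circle.ext (shrink_one norm_one (by simpa using hre))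

/-- A common cover `E` of `X` and `A` with a circle coordinate, which is determined up to inversion
by the point of `X` away from the basepoint, and such that `A` is obtained from `X` by forgetting
the coordinate. -/
structure CircleCoordinate (X A : PointedSpace) (E : Type) [TopologicalSpace E] where
  cover : C(E, X)
  forget : C(E, A)
  coord : C(E, Circle)
  setCoord : C(Circle × E, E)
  base : E
  isQuotientMap_cover : IsQuotientMap cover
  isQuotientMap_forget : IsQuotientMap forget
  setCoord_coord : ∀ e, setCoord (coord e, e) = e
  coord_setCoord : ∀ z e, coord (setCoord (z, e)) = z
  setCoord_setCoord : ∀ z w e, setCoord (z, setCoord (w, e)) = setCoord (z, e)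
  forget_setCoord : ∀ z e, forget (setCoord (z, e)) = forget e
  forget_eq : ∀ e e', cover e = cover e' → forget e = forget e'
  cover_setCoord_one : ∀ e e', forget e = forget e' →
    cover (setCoord (1, e)) = cover (setCoord (1, e'))
  cover_setCoord : ∀ (f : Circle → Circle) (e e'), f 1 = 1 → (∀ z, f z⁻¹ = (f z)⁻¹) →
    cover e = cover e' → cover (setCoord (f (coord e), e)) = cover (setCoord (f (coord e'), e'))
  coord_eq : ∀ e e', cover e = cover e' →
    cover e = X.pt ∨ coord e = coord e' ∨ coord e = (coord e')⁻¹
  coord_base : coord base = 1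
  cover_base : cover base = X.pt
  forget_base : forget base = A.pt

namespace CircleCoordinate

variable {X A : PointedSpace} {E : Type} [TopologicalSpace E] (C : CircleCoordinate X A E)

/-- The inclusion of `A` as the part of `X` where the coordinate is `1`. -/
def incl : PointedMap A X :=
  .ofQuotient C.isQuotientMap_forget (fun e => C.cover (C.setCoord (1, e))) (by fun_prop)
    C.cover_setCoord_one fun e he => by
      rw [C.cover_setCoord_one e C.base (he.trans C.forget_base.symm), ← C.coord_base,
        C.setCoord_coord, C.cover_base]

@[simp]
theorem incl_forget (e : E) : C.incl (C.forget e) = C.cover (C.setCoord (1, e)) :=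
  PointedMap.ofQuotient_apply ..

theorem cover_mem_range_incl_iff {e : E} :
    C.cover e ∈ range C.incl ↔ C.cover e = X.pt ∨ C.coord e = 1 := by
  constructor
  · rintro ⟨a, ha⟩
    obtain ⟨e', rfl⟩ := C.isQuotientMap_forget.surjective a
    rw [incl_forget] at ha
    simpa [C.coord_setCoord] using C.coord_eq _ _ ha.symm
  · rintro (h | h)
    · exact ⟨A.pt, C.incl.map_pt.trans h.symm⟩
    · exact ⟨C.forget e, by rw [incl_forget, ← h, C.setCoord_coord]⟩

/-- The retraction that forgets the coordinate. -/
def retr : PointedMap X A :=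
  .ofQuotient C.isQuotientMap_cover C.forget C.forget.continuous C.forget_eq fun e he =>
    (C.forget_eq e C.base (he.trans C.cover_base.symm)).trans C.forget_base

@[simp]
theorem retr_cover (e : E) : C.retr (C.cover e) = C.forget e := PointedMap.ofQuotient_apply ..

/-- The deformation of `E` that contracts a half-circle in the coordinate. -/
def coverDeform (t : I) (e : E) : E := C.setCoord (circleShrink (t, C.coord e), e)

@[fun_prop]
theorem continuous_coverDeform : Continuous fun p : I × E => C.coverDeform p.1 p.2 := by
  unfold coverDeform
  fun_prop

theorem cover_coverDeform_eq (t : I) {e e' : E} (h : C.cover e = C.cover e') :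
    C.cover (C.coverDeform t e) = C.cover (C.coverDeform t e') :=
  C.cover_setCoord (fun z => circleShrink (t, z)) e e' (circleShrink_apply_one t)
    (circleShrink_inv t) h

/-- The deformation of `X` that contracts a half-circle in the coordinate. -/
def deform : C(I × X, X) where
  toFun p := C.cover (C.coverDeform p.1 (Function.surjInv C.isQuotientMap_cover.surjective p.2))
  continuous_toFun := by
    refine C.isQuotientMap_cover.continuous_lift_prod_right ?_
    convert C.cover.continuous.comp C.continuous_coverDeform using 2 with p
    exact C.cover_coverDeform_eq _ (Function.surjInv_eq _ _)

@[simp]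
theorem deform_cover (t : I) (e : E) : C.deform (t, C.cover e) = C.cover (C.coverDeform t e) :=
  C.cover_coverDeform_eq t (Function.surjInv_eq _ _)

/-- The fibrewise retraction that sets the coordinate to `1`. -/
def fibrewiseRetraction : FibrewiseRetraction X A E where
  incl := C.incl
  retr := C.retr
  deform := C.deform
  cover := C.cover
  dist := circleDist.comp C.coord
  retr_incl a := by
    obtain ⟨e, rfl⟩ := C.isQuotientMap_forget.surjective a
    rw [incl_forget, retr_cover, C.forget_setCoord]
  deform_zero x := by
    obtain ⟨e, rfl⟩ := C.isQuotientMap_cover.surjective x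
    rw [deform_cover, coverDeform, circleShrink_zero, C.setCoord_coord]
  deform_incl t a := by
    obtain ⟨e, rfl⟩ := C.isQuotientMap_forget.surjective a
    rw [incl_forget, deform_cover, coverDeform, C.coord_setCoord, circleShrink_apply_one,
      C.setCoord_setCoord]
  retr_deform t x := by
    obtain ⟨e, rfl⟩ := C.isQuotientMap_cover.surjective x
    rw [deform_cover, retr_cover, coverDeform, C.forget_setCoord, retr_cover]
  isQuotientMap_cover := C.isQuotientMap_cover
  dist_eq e e' h := by
    refine (C.coord_eq e e' h).imp_right ?_
    rintro (h | h) <;> simp [h, circleDist_inv]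
  dist_incl e a h := by
    refine (C.cover_mem_range_incl_iff.1 ⟨a, h.symm⟩).imp_right fun h => ?_
    simp [h, circleDist_one]
  deform_one e h := by
    rw [deform_cover, coverDeform, circleShrink_one h, retr_cover, incl_forget]

theorem cofiberCover_eq_iff {e e' : E} :
    C.fibrewiseRetraction.cofiberCover e = C.fibrewiseRetraction.cofiberCover e' ↔
      C.cover e = C.cover e' ∨
        (C.cover e = X.pt ∨ C.coord e = 1) ∧ (C.cover e' = X.pt ∨ C.coord e' = 1) :=
  collapseMk_eq_iff.trans
    (or_congr_right (and_congr C.cover_mem_range_incl_iff C.cover_mem_range_incl_iff))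

theorem susp_equivalent {Y : PointedSpace} {ρ : C(E, Y)} (hρ : IsQuotientMap ρ)
    (hY : ρ C.base = Y.pt)
    (h : ∀ e e', ρ e = ρ e' ↔ C.cover e = C.cover e' ∨
      (C.cover e = X.pt ∨ C.coord e = 1) ∧ (C.cover e' = X.pt ∨ C.coord e' = 1)) :
    PointedHomotopyEquivalent (reducedSuspension X)
      (wedge (reducedSuspension A) (reducedSuspension Y)) := by
  have hpt : C.fibrewiseRetraction.cofiberCover C.base = C.fibrewiseRetraction.cofiber.pt :=
    congrArg C.fibrewiseRetraction.proj C.cover_base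
  have hcof : PointedHomotopyEquivalent C.fibrewiseRetraction.cofiber Y :=
    .of_quotients C.fibrewiseRetraction.isQuotientMap_cofiberCover hρ
      (fun e e' => C.cofiberCover_eq_iff.trans (h e e').symm) hpt hY
  exact C.fibrewiseRetraction.susp_equivalent_splitting.trans (.wedge_congr (.refl _) hcof.susp)

end CircleCoordinate

/-! ### Quotients of the torus -/

/-- The torus with coordinates indexed by `ι` and one further coordinate, on which the involution
acts freely. -/
abbrev Torus (ι : Type) : Type := (ι → Circle) × Circle

namespace Torus

variable {ι : Type}

/-- The involution that conjugates all coordinates but the last, which changes sign. -/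
def flip (x : Torus ι) : Torus ι := (x.1⁻¹, -x.2)

/-- The points of the torus that are collapsed in the quotient: some coordinate in `S` is `1`, or
the point lies over the basepoint. -/
def Degenerate (S : Finset ι) (x : Torus ι) : Prop :=
  (∃ i ∈ S, x.1 i = 1) ∨ (x.1 = 1 ∧ (x.2 = 1 ∨ x.2 = -1))

/-- The relation that identifies the orbits of the involution and collapses the degenerate
points. -/
def Rel (S : Finset ι) (x y : Torus ι) : Prop :=
  (Degenerate S x ∧ Degenerate S y) ∨ x = y ∨ x = flip y

variable {S : Finset ι} {x y z : Torus ι}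

theorem flip_flip (x : Torus ι) : flip (flip x) = x := by simp [flip]

theorem degenerate_one (S : Finset ι) : Degenerate S 1 := Or.inr ⟨rfl, Or.inl rfl⟩

theorem Degenerate.flip (h : Degenerate S x) : Degenerate S x.flip := by
  rcases h with ⟨i, hi, h⟩ | ⟨h1, h2⟩
  · exact Or.inl ⟨i, hi, by simp [Torus.flip, h]⟩
  · exact Or.inr ⟨by simp [Torus.flip, h1],
      h2.symm.imp (fun h => by simp [Torus.flip, h]) fun h => by simp [Torus.flip, h]⟩

theorem Rel.refl (S : Finset ι) (x : Torus ι) : Rel S x x := Or.inr (Or.inl rfl)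

theorem Rel.symm (h : Rel S x y) : Rel S y x := by
  rcases h with h | rfl | rfl
  · exact Or.inl h.symm
  · exact .refl S x
  · exact Or.inr (Or.inr (flip_flip y).symm)

theorem Rel.degenerate (h : Rel S x y) (hx : Degenerate S x) : Degenerate S y := by
  rcases h with h | rfl | rfl
  · exact h.2
  · exact hx
  · exact flip_flip y ▸ hx.flip

theorem Rel.trans (hxy : Rel S x y) (hyz : Rel S y z) : Rel S x z := by
  rcases hxy with hxy | rfl | rfl
  · exact Or.inl ⟨hxy.1, hyz.degenerate hxy.2⟩
  · exact hyz
  · rcases hyz with hyz | rfl | rfl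
    · exact Or.inl ⟨hyz.1.flip, hyz.2⟩
    · exact Or.inr (Or.inr rfl)
    · rw [flip_flip]
      exact .refl S z

theorem Rel.coord_eq (h : Rel S x y) (j : ι) :
    Degenerate S x ∨ x.1 j = y.1 j ∨ x.1 j = (y.1 j)⁻¹ := by
  rcases h with h | rfl | rfl
  exacts [Or.inl h.1, Or.inr (Or.inl rfl), Or.inr (Or.inr rfl)]

/-- The setoid of the relation `Rel S`. -/
def setoid (S : Finset ι) : Setoid (Torus ι) := ⟨Rel S, Rel.refl S, Rel.symm, Rel.trans⟩

variable [DecidableEq ι] {J : Finset ι} {j : ι}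

/-- Replaces the coordinates outside `J` by `1`. -/
def restr (J : Finset ι) (x : Torus ι) : Torus ι := (fun j => if j ∈ J then x.1 j else 1, x.2)

/-- The quotient of the subtorus with coordinates in `J` by the involution and the subset with some
coordinate in `S` equal to `1`, as a quotient of the whole torus. -/
def quotient (J S : Finset ι) : PointedSpace where
  carrier := Quotient ((setoid S).comap (restr J))
  pt := Quotient.mk _ 1

/-- The quotient map from the torus to `quotient J S`. -/
def mk (J S : Finset ι) : C(Torus ι, quotient J S) where
  toFun := Quotient.mk _
  continuous_toFun := continuous_quotient_mk'

theorem isQuotientMap_mk (J S : Finset ι) : IsQuotientMap (mk J S) := isQuotientMap_quotient_mk'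

theorem mk_eq_iff : mk J S x = mk J S y ↔ Rel S (restr J x) (restr J y) := Quotient.eq

theorem mk_one (J S : Finset ι) : mk J S 1 = (quotient J S).pt := rfl

theorem restr_one (J : Finset ι) : restr J 1 = 1 := by
  ext j <;> simp [restr]

theorem restr_fst (hj : j ∈ J) (x : Torus ι) : (restr J x).1 j = x.1 j := if_pos hj

theorem restr_univ [Fintype ι] (x : Torus ι) : restr Finset.univ x = x := by
  simp [restr]

theorem mk_eq_pt_iff : mk J S x = (quotient J S).pt ↔ Degenerate S (restr J x) := by
  rw [← mk_one, mk_eq_iff, restr_one]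
  exact ⟨fun h => h.symm.degenerate (degenerate_one S), fun h => Or.inl ⟨h, degenerate_one S⟩⟩

/-- Replaces the coordinate `j` of `x` by `z`. -/
def setCoord (j : ι) (z : Circle) (x : Torus ι) : Torus ι := (Function.update x.1 j z, x.2)

theorem setCoord_fst (j : ι) (z : Circle) (x : Torus ι) : (setCoord j z x).1 j = z :=
  Function.update_self ..

theorem setCoord_self (j : ι) (x : Torus ι) : setCoord j (x.1 j) x = x :=
  Prod.ext (Function.update_eq_self ..) rfl

theorem setCoord_setCoord (j : ι) (z w : Circle) (x : Torus ι) :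
    setCoord j z (setCoord j w x) = setCoord j z x :=
  Prod.ext (Function.update_idem ..) rfl

theorem continuous_setCoord (j : ι) :
    Continuous fun p : Circle × Torus ι => setCoord j p.1 p.2 := by
  have : Continuous fun p : Circle × Torus ι => p.2.1 := by fun_prop
  exact (this.update j continuous_fst).prodMk (by fun_prop)

theorem flip_setCoord (j : ι) (z : Circle) (x : Torus ι) :
    flip (setCoord j z x) = setCoord j z⁻¹ (flip x) := by
  ext i
  · by_cases h : i = j
    · subst h
      simp [flip, setCoord]
    · simp [flip, setCoord, h]
  · rfl

theorem restr_setCoord (hj : j ∈ J) (z : Circle) (x : Torus ι) :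
    restr J (setCoord j z x) = setCoord j z (restr J x) := by
  ext i
  · by_cases h : i = j
    · subst h
      simp [restr, setCoord, hj]
    · simp [restr, setCoord, h]
  · rfl

theorem restr_erase (J : Finset ι) (j : ι) (x : Torus ι) :
    restr (J.erase j) x = setCoord j 1 (restr J x) := by
  ext i
  · by_cases h : i = j
    · subst h
      simp [restr, setCoord]
    · simp [restr, setCoord, h]
  · rfl

theorem Degenerate.setCoord {f : Circle → Circle} (hj : j ∉ S) (hf : f 1 = 1)
    (h : Degenerate S x) : Degenerate S (setCoord j (f (x.1 j)) x) := by
  rcases h with ⟨i, hi, h⟩ | ⟨h1, h2⟩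
  · have : i ≠ j := fun h => hj (h ▸ hi)
    exact Or.inl ⟨i, hi, by simp [Torus.setCoord, h, this]⟩
  · refine Or.inr ⟨?_, h2⟩
    simp only [Torus.setCoord, h1, Pi.one_apply, hf]
    exact Function.update_eq_self j 1

theorem Rel.setCoord {f : Circle → Circle} (hj : j ∉ S) (hf : f 1 = 1)
    (hf' : ∀ z, f z⁻¹ = (f z)⁻¹) (h : Rel S x y) :
    Rel S (setCoord j (f (x.1 j)) x) (setCoord j (f (y.1 j)) y) := by
  rcases h with h | rfl | rfl
  · exact Or.inl ⟨h.1.setCoord hj hf, h.2.setCoord hj hf⟩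
  · exact .refl S _
  · refine Or.inr (Or.inr ?_)
    rw [flip_setCoord, ← hf']
    rfl

theorem degenerate_insert_iff (hj : j ∈ J) :
    Degenerate (insert j S) (restr J x) ↔ Degenerate S (restr J x) ∨ x.1 j = 1 := by
  rw [or_comm, Degenerate, Finset.exists_mem_insert, or_assoc, restr_fst hj, Degenerate]

/-- The coordinate `j ∈ J \ S` of `quotient J S`. -/
def circleCoordinate (hJ : j ∈ J) (hS : j ∉ S) :
    CircleCoordinate (quotient J S) (quotient (J.erase j) S) (Torus ι) where
  cover := mk J S
  forget := mk (J.erase j) S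
  coord := ⟨fun x => x.1 j, by fun_prop⟩
  setCoord := ⟨fun p => setCoord j p.1 p.2, continuous_setCoord j⟩
  base := 1
  isQuotientMap_cover := isQuotientMap_mk J S
  isQuotientMap_forget := isQuotientMap_mk _ S
  setCoord_coord := setCoord_self j
  coord_setCoord := setCoord_fst j
  setCoord_setCoord := setCoord_setCoord j
  forget_setCoord z x := mk_eq_iff.2 <| by
    change Rel S (restr (J.erase j) (setCoord j z x)) _
    rw [restr_erase, restr_setCoord hJ, setCoord_setCoord, restr_erase]
    exact .refl S _
  forget_eq x y h := mk_eq_iff.2 <| by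
    rw [restr_erase, restr_erase]
    exact (mk_eq_iff.1 h).setCoord (f := fun _ => 1) hS rfl (by simp)
  cover_setCoord_one x y h := mk_eq_iff.2 <| by
    rw [mk_eq_iff, restr_erase, restr_erase] at h
    exact (restr_setCoord hJ 1 x).symm ▸ (restr_setCoord hJ 1 y).symm ▸ h
  cover_setCoord f x y hf hf' h := mk_eq_iff.2 <| by
    have := (mk_eq_iff.1 h).setCoord hS hf hf'
    rw [restr_fst hJ, restr_fst hJ, ← restr_setCoord hJ, ← restr_setCoord hJ] at this
    exact this
  coord_eq x y h := by
    have := (mk_eq_iff.1 h).coord_eq j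
    rwa [restr_fst hJ, restr_fst hJ, ← mk_eq_pt_iff] at this
  coord_base := rfl
  cover_base := mk_one J S
  forget_base := mk_one _ S

theorem susp_quotient_split (hJ : j ∈ J) (hS : j ∉ S) :
    PointedHomotopyEquivalent (reducedSuspension (quotient J S))
      (wedge (reducedSuspension (quotient (J.erase j) S))
        (reducedSuspension (quotient J (insert j S)))) := by
  refine (circleCoordinate hJ hS).susp_equivalent (isQuotientMap_mk J (insert j S))
    (mk_one J (insert j S)) fun x y => ?_
  have hcover (x : Torus ι) : Degenerate (insert j S) (restr J x) ↔
      mk J S x = (quotient J S).pt ∨ x.1 j = 1 := by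
    rw [degenerate_insert_iff hJ, mk_eq_pt_iff]
  have hdeg (x : Torus ι) (h : Degenerate S (restr J x)) : Degenerate (insert j S) (restr J x) :=
    (degenerate_insert_iff hJ).2 (Or.inl h)
  change _ ↔ mk J S x = mk J S y ∨ (mk J S x = _ ∨ x.1 j = 1) ∧ (mk J S y = _ ∨ y.1 j = 1)
  rw [← hcover, ← hcover, mk_eq_iff, mk_eq_iff, Rel, Rel]
  have := hdeg x
  have := hdeg y
  tauto

/-- The sets between `S` and `J` either avoid `j` or contain it. -/
def intervalEquivSum (S J : Finset ι) (j : ι) :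
    {K // S ⊆ K ∧ K ⊆ J.erase j} ⊕ {K // insert j S ⊆ K ∧ K ⊆ J} ≃ {K // S ⊆ K ∧ K ⊆ J} where
  toFun := Sum.elim (fun K => ⟨K, K.2.1, K.2.2.trans (J.erase_subset j)⟩)
    fun K => ⟨K, (S.subset_insert j).trans K.2.1, K.2.2⟩
  invFun K := if h : j ∈ K.1 then Sum.inr ⟨K, Finset.insert_subset h K.2.1, K.2.2⟩
    else Sum.inl ⟨K, K.2.1, Finset.subset_erase.2 ⟨K.2.2, h⟩⟩
  left_inv := by
    rintro (⟨K, hK⟩ | ⟨K, hK⟩)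
    · exact dif_neg fun h => J.notMem_erase j (hK.2 h)
    · exact dif_pos (hK.1 (S.mem_insert_self j))
  right_inv K := by
    by_cases h : j ∈ K.1 <;> simp [h]

theorem susp_quotient (h : S ⊆ J) :
    PointedHomotopyEquivalent (reducedSuspension (quotient J S))
      (bigWedge fun K : {K // S ⊆ K ∧ K ⊆ J} => reducedSuspension (quotient K.1 K.1)) := by
  induction hn : (J \ S).card generalizing S J with
  | zero =>
    obtain rfl : S = J := h.antisymm (Finset.sdiff_eq_empty_iff_subset.1 (Finset.card_eq_zero.1 hn))
    let _ : Unique {K // S ⊆ K ∧ K ⊆ S} :=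
      { default := ⟨S, subset_rfl, subset_rfl⟩
        uniq := fun K => Subtype.ext (K.2.2.antisymm K.2.1) }
    exact (PointedHomotopyEquivalent.bigWedge_unique
      fun K : {K // S ⊆ K ∧ K ⊆ S} => reducedSuspension (quotient K.1 K.1)).symm
  | succ n ih =>
    obtain ⟨j, hj⟩ : (J \ S).Nonempty := Finset.card_pos.1 (by omega)
    obtain ⟨hJ, hS⟩ := Finset.mem_sdiff.1 hj
    have hcard : ((J \ S).erase j).card = n := by
      rw [Finset.card_erase_of_mem hj, hn, Nat.add_sub_cancel]
    have hsplit := (susp_quotient_split hJ hS).trans <|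
      .wedge_congr (ih (Finset.subset_erase.2 ⟨h, hS⟩) (by rwa [Finset.erase_sdiff_comm]))
        (ih (Finset.insert_subset hJ h) (by rwa [Finset.sdiff_insert]))
    exact hsplit.trans <| (PointedHomotopyEquivalent.bigWedge_sum
      fun K => reducedSuspension (quotient (intervalEquivSum S J j K).1
        (intervalEquivSum S J j K).1)).symm.trans (.bigWedge_reindex
        (Y := fun K : {K // S ⊆ K ∧ K ⊆ J} => reducedSuspension (quotient K.1 K.1)) _)

end Torus

/-! ### The Klein bottle as a quotient of the torus -/

section Klein

variable {k : ℕ}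

theorem torusInvolution_torusInvolution (n : ℕ) (z : Fin n → Circle) :
    torusInvolution n (torusInvolution n z) = z := by
  ext j
  by_cases h : (j : ℕ) + 1 = n <;> simp [torusInvolution, h]

/-- The orbit relation of the involution of the torus. -/
def kleinSetoid (n : ℕ) : Setoid (Fin n → Circle) where
  r z w := z = w ∨ z = torusInvolution n w
  iseqv :=
    { refl := fun _ => Or.inl rfl
      symm := by
        rintro z w (rfl | rfl)
        · exact Or.inl rfl
        · exact Or.inr (torusInvolution_torusInvolution n w).symm
      trans := by
        rintro z w v (rfl | rfl) (rfl | rfl)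
        · exact Or.inl rfl
        · exact Or.inr rfl
        · exact Or.inr rfl
        · exact Or.inl (torusInvolution_torusInvolution n v) }

/-- The projection of the torus onto the Klein bottle. -/
def kleinMk (n : ℕ) (z : Fin n → Circle) : Klein n := Quot.mk _ z

theorem isQuotientMap_kleinMk (n : ℕ) : IsQuotientMap (kleinMk n) := isQuotientMap_quot_mk

theorem kleinMk_eq_iff {n : ℕ} {z w : Fin n → Circle} :
    kleinMk n z = kleinMk n w ↔ z = w ∨ z = torusInvolution n w := by
  constructor
  · intro h
    have : kleinSetoid n z w := (kleinSetoid n).iseqv.eqvGen_iff.1 <|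
      (Quot.eqvGen_exact h).mono fun z w h => Or.inr (by rw [h, torusInvolution_torusInvolution])
    exact this
  · rintro (rfl | rfl)
    · rfl
    · exact (Quot.sound (r := fun z w : Fin n → Circle => w = torusInvolution n z) rfl).symm

/-- The homeomorphism of the torus onto the product of `k + 1` circles that commutes with the
involutions and sends the point `1` to the point with coordinates `exp (θ j)` and `b`. -/
def torusHomeo (θ : Fin k → ℝ) (b : Circle) : Torus (Fin k) ≃ₜ (Fin (k + 1) → Circle) where
  toFun x := Fin.snoc (α := fun _ => Circle)
    (fun j => x.1 j * Circle.exp (θ j * (x.2 : ℂ).re)) (x.2 * b)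
  invFun y := (fun j => y j.castSucc *
      Circle.exp (-(θ j * ((y (Fin.last k) * b⁻¹ : Circle) : ℂ).re)),
    y (Fin.last k) * b⁻¹)
  left_inv x := by
    ext j
    · simp [mul_assoc]
    · simp
  right_inv y := by
    ext j
    refine Fin.lastCases ?_ (fun j => ?_) j
    · simp
    · simp [mul_assoc]
  continuous_toFun := by
    refine continuous_pi fun j => Fin.lastCases ?_ (fun j => ?_) j
    · simp only [Fin.snoc_last]
      fun_prop
    · simp only [Fin.snoc_castSucc]
      fun_prop
  continuous_invFun := by fun_prop

theorem torusHomeo_flip (θ : Fin k → ℝ) (b : Circle) (x : Torus (Fin k)) :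
    torusHomeo θ b x.flip = torusInvolution (k + 1) (torusHomeo θ b x) := by
  ext j
  refine Fin.lastCases ?_ (fun j => ?_) j
  · simp [torusHomeo, torusInvolution, Torus.flip]
  · have : (j : ℕ) ≠ k := j.2.ne
    simp [torusHomeo, torusInvolution, Torus.flip, this, mul_comm]

theorem exists_torusHomeo_one (y : Fin (k + 1) → Circle) : ∃ θ b, torusHomeo θ b 1 = y := by
  have hθ (j : Fin k) : Circle.exp (Complex.arg (y j.castSucc)) = y j.castSucc :=
    Circle.exp_arg _
  refine ⟨fun j => Complex.arg (y j.castSucc), y (Fin.last k),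
    funext fun j => Fin.lastCases ?_ (fun j => ?_) j⟩
  · simp [torusHomeo]
  · simp [torusHomeo, hθ]

theorem Torus.rel_empty_iff {ι : Type} {x y : Torus ι} : Rel ∅ x y ↔ x = y ∨ x = flip y := by
  refine ⟨?_, Or.inr⟩
  rintro (⟨hx, hy⟩ | h)
  · simp only [Degenerate, Finset.notMem_empty, false_and, exists_false, false_or] at hx hy
    have : x.2 = y.2 ∨ x.2 = -y.2 := by
      rcases hx.2 with h | h <;> rcases hy.2 with h' | h' <;> simp [h, h']
    exact this.imp (Prod.ext (hx.1.trans hy.1.symm)) (Prod.ext (by simp [flip, hx.1, hy.1]))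
  · exact h

theorem klein_equivalent (x₀ : Klein (k + 1)) :
    PointedHomotopyEquivalent { carrier := Klein (k + 1), pt := x₀ }
      (Torus.quotient (Finset.univ : Finset (Fin k)) ∅) := by
  obtain ⟨y, rfl⟩ := (isQuotientMap_kleinMk _).surjective x₀
  obtain ⟨θ, b, rfl⟩ := exists_torusHomeo_one y
  let π : C(Torus (Fin k), Klein (k + 1)) :=
    ⟨fun x => kleinMk _ (torusHomeo θ b x),
      (isQuotientMap_kleinMk _).continuous.comp (torusHomeo θ b).continuous⟩
  refine .of_quotients (X := ⟨Klein (k + 1), _⟩) (π := π)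
    ((isQuotientMap_kleinMk _).comp (torusHomeo θ b).isQuotientMap)
    (Torus.isQuotientMap_mk Finset.univ ∅) (fun x x' => ?_) (e₀ := 1) rfl (Torus.mk_one _ _)
  rw [Torus.mk_eq_iff, Torus.restr_univ, Torus.restr_univ, Torus.rel_empty_iff]
  refine kleinMk_eq_iff.trans ?_
  rw [← torusHomeo_flip, (torusHomeo θ b).injective.eq_iff, (torusHomeo θ b).injective.eq_iff]

theorem susp_klein (x₀ : Klein (k + 1)) :
    PointedHomotopyEquivalent (reducedSuspension { carrier := Klein (k + 1), pt := x₀ })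
      (bigWedge fun K : Finset (Fin k) => reducedSuspension (Torus.quotient K K)) :=
  (klein_equivalent x₀).susp.trans <| (Torus.susp_quotient (Finset.empty_subset _)).trans <|
    .bigWedge_reindex (Y := fun K : Finset (Fin k) => reducedSuspension (Torus.quotient K K))
      (Equiv.subtypeUnivEquiv fun K => ⟨Finset.empty_subset K, Finset.subset_univ K⟩)

end Klein

/-! ### One-point compactifications -/

section OnePoint

open OnePoint

/-- The one-point compactification, pointed by the point at infinity. -/
def onePt (V : Type) [TopologicalSpace V] : PointedSpace where
  carrier := OnePoint V
  pt := ∞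

section CollapseOnto

variable {P W : Type*} {e : W → P}

/-- The inverse of an injective map `e`, extended by the value `∞` outside the range of `e`. For an
open embedding this is the map that collapses the complement of an open set to one point. -/
def collapseOnto (e : W → P) (p : P) : OnePoint W := Function.partialInv e p

theorem collapseOnto_apply (he : Function.Injective e) (w : W) : collapseOnto e (e w) = w :=
  Function.partialInv_left he w

theorem collapseOnto_of_notMem {p : P} (h : p ∉ range e) : collapseOnto e p = ∞ := dif_neg h

theorem continuous_collapseOnto [TopologicalSpace P] [TopologicalSpace W] [T2Space P]
    (he : IsOpenEmbedding e) : Continuous (collapseOnto e) := by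
  refine continuous_iff_continuousAt.2 fun p => ?_
  by_cases hp : p ∈ range e
  · obtain ⟨w, rfl⟩ := hp
    have : collapseOnto e ∘ e = ((↑) : W → OnePoint W) := funext (collapseOnto_apply he.injective)
    rw [← he.continuousAt_iff, this]
    exact continuous_coe.continuousAt
  · rw [ContinuousAt, collapseOnto_of_notMem hp, hasBasis_nhds_infty.tendsto_right_iff]
    rintro s ⟨-, hs⟩
    have hc : IsClosed (e '' s) := (hs.image he.continuous).isClosed
    filter_upwards [hc.isOpen_compl.mem_nhds fun h => hp (image_subset_range _ _ h)] with q hq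
    by_cases hq' : q ∈ range e
    · obtain ⟨w, rfl⟩ := hq'
      rw [collapseOnto_apply he.injective]
      exact Or.inl ⟨w, fun h => hq ⟨w, h, rfl⟩, rfl⟩
    · rw [collapseOnto_of_notMem hq']
      exact Or.inr rfl

end CollapseOnto

theorem continuous_onePoint_map {V W : Type*} [TopologicalSpace W] [TopologicalSpace V]
    [T2Space V] [T2Space W] [WeaklyLocallyCompactSpace V] {f : W → V} (hf : IsProperMap f) :
    Continuous (OnePoint.map f) := by
  refine continuous_map hf.continuous ?_
  rw [Filter.coclosedCompact_eq_cocompact, Filter.coclosedCompact_eq_cocompact]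
  exact (isProperMap_iff_tendsto_cocompact.1 hf).2

theorem PointedHomotopyEquivalent.onePt_of_surjective {Y : PointedSpace} {E : Type*} {V : Type}
    [TopologicalSpace E] [CompactSpace E] [TopologicalSpace V] [T2Space V]
    [WeaklyLocallyCompactSpace V] {π : C(E, Y)} (hπ : IsQuotientMap π) {F : C(E, OnePoint V)}
    (hF : Function.Surjective F) (h : ∀ c c', π c = π c' ↔ F c = F c') {c₀ : E}
    (h₀ : π c₀ = Y.pt) (h₀' : F c₀ = ∞) : PointedHomotopyEquivalent Y (onePt V) :=
  .of_quotients (Y := onePt V) (ρ := F) hπ (F.continuous.isClosedMap.isQuotientMap F.continuous hF)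
    h h₀ h₀'

theorem PointedHomotopyEquivalent.onePt_of_cover {Y : PointedSpace} {E P W : Type*} {V : Type}
    [TopologicalSpace E] [CompactSpace E] [TopologicalSpace P] [T2Space P]
    [TopologicalSpace W] [T2Space W] [TopologicalSpace V] [T2Space V] [WeaklyLocallyCompactSpace V]
    {π : C(E, Y)} (hπ : IsQuotientMap π) {ρ : E → P} (hρ : Continuous ρ)
    (hρs : Function.Surjective ρ) {e : W → P} (he : IsOpenEmbedding e) {f : W → V}
    (hf : IsProperMap f) (hfs : Function.Surjective f) {c₀ : E} (h₀ : π c₀ = Y.pt)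
    (h₀' : ρ c₀ ∉ range e)
    (hout : ∀ c c', ρ c ∉ range e → (π c = π c' ↔ ρ c' ∉ range e))
    (hin : ∀ c c' w w', ρ c = e w → ρ c' = e w' → (π c = π c' ↔ f w = f w')) :
    PointedHomotopyEquivalent Y (onePt V) := by
  let F : C(E, OnePoint V) := ⟨fun c => OnePoint.map f (collapseOnto e (ρ c)),
    (continuous_onePoint_map hf).comp ((continuous_collapseOnto he).comp hρ)⟩
  have hF {c w} (h : e w = ρ c) : F c = f w := by
    simp only [F, ContinuousMap.coe_mk, ← h, collapseOnto_apply he.injective, OnePoint.map_some]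
  have hF_infty {c} (h : ρ c ∉ range e) : F c = ∞ := by
    simp only [F, ContinuousMap.coe_mk, collapseOnto_of_notMem h, OnePoint.map_infty]
  refine .onePt_of_surjective hπ (F := F) (fun z => ?_) (fun c c' => ?_) h₀ (hF_infty h₀')
  · induction z using OnePoint.rec with
    | infty => exact ⟨c₀, hF_infty h₀'⟩
    | coe v =>
      obtain ⟨w, rfl⟩ := hfs v
      obtain ⟨c, hc⟩ := hρs (e w)
      exact ⟨c, hF hc.symm⟩
  · by_cases h : ρ c ∈ range e
    · obtain ⟨w, hw⟩ := id h
      by_cases h' : ρ c' ∈ range e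
      · obtain ⟨w', hw'⟩ := h'
        rw [hF hw, hF hw', hin c c' w w' hw.symm hw'.symm, coe_eq_coe]
      · simp [hF hw, hF_infty h', eq_comm (a := π c), hout c' c h', h]
    · by_cases h' : ρ c' ∈ range e
      · obtain ⟨w', hw'⟩ := id h'
        simp [hF hw', hF_infty h, hout c c' h, h']
      · simp [hF_infty h, hF_infty h', hout c c' h, h']

theorem PointedHomotopyEquivalent.collapse_compl_range {P W : Type} [TopologicalSpace P]
    [CompactSpace P] [T2Space P] [TopologicalSpace W] {e : W → P} (he : IsOpenEmbedding e)
    {A : Set P} {a : P} (ha : a ∈ A) (hA : ∀ p, p ∈ A ↔ p ∉ range e) :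
    PointedHomotopyEquivalent (collapse A a) (onePt W) := by
  have : T2Space W := he.isEmbedding.t2Space
  have : LocallyCompactSpace W := he.locallyCompactSpace
  refine .onePt_of_cover isQuotientMap_collapseMk continuous_id Function.surjective_id he
    isProperMap_id Function.surjective_id (c₀ := a) rfl ((hA a).1 ha) (fun p q hp => ?_)
    fun p q w w' hp hq => ?_
  · have hp : p ∈ A := (hA p).2 hp
    rw [id, ← hA, collapseMk_eq_iff]
    exact ⟨by rintro (rfl | h); exacts [hp, h.2], fun hq => Or.inr ⟨hp, hq⟩⟩
  · have : p ∉ A := fun h => (hA p).1 h ⟨w, hp.symm⟩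
    obtain rfl : p = e w := hp
    obtain rfl : q = e w' := hq
    simp [collapseMk_eq_iff, this, he.injective.eq_iff]

theorem isOpenEmbedding_of_leftInverse {W P : Type*} [TopologicalSpace W] [TopologicalSpace P]
    {e : W → P} (he : Continuous e) (hr : IsOpen (range e)) {g : P → W}
    (hg : ContinuousOn g (range e)) (hge : Function.LeftInverse g e) : IsOpenEmbedding e :=
  OpenPartialHomeomorph.isOpenEmbedding
    { toFun := e
      invFun := g
      source := univ
      target := range e
      map_source' := fun w _ => mem_range_self w
      map_target' := fun _ _ => mem_univ _
      left_inv' := fun w _ => hge w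
      right_inv' := by
        rintro _ ⟨w, rfl⟩
        rw [hge]
      open_source := isOpen_univ
      open_target := hr
      continuousOn_toFun := he.continuousOn
      continuousOn_invFun := hg } rfl

theorem isOpenEmbedding_sigmoid : IsOpenEmbedding unitInterval.sigmoid :=
  ⟨isEmbedding_sigmoid, by rw [unitInterval.range_sigmoid]; exact isOpen_Ioo⟩

theorem mem_range_sigmoid {s : I} : s ∈ range unitInterval.sigmoid ↔ ¬(s = 0 ∨ s = 1) := by
  rw [unitInterval.range_sigmoid, mem_Ioo, not_or, unitInterval.pos_iff_ne_zero,
    unitInterval.lt_one_iff_ne_one]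

theorem mem_range_coe_onePoint {V : Type*} {y : OnePoint V} :
    y ∈ range ((↑) : V → OnePoint V) ↔ y ≠ ∞ := by
  rw [← compl_infty, mem_compl_singleton_iff]

theorem susp_onePt (V : Type) [TopologicalSpace V] [T2Space V] [WeaklyLocallyCompactSpace V] :
    PointedHomotopyEquivalent (reducedSuspension (onePt V)) (onePt (V × ℝ)) := by
  refine .collapse_compl_range (P := OnePoint V × I)
    (isOpenEmbedding_coe.prodMap isOpenEmbedding_sigmoid) (Or.inl rfl) ?_
  rintro ⟨y, s⟩
  rw [range_prodMap, mem_prod, mem_range_sigmoid, mem_range_coe_onePoint]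
  change s = 0 ∨ s = 1 ∨ y = ∞ ↔ _
  tauto

theorem onePt_congr {V W : Type} [TopologicalSpace V] [TopologicalSpace W] (h : V ≃ₜ W) :
    PointedHomotopyEquivalent (onePt V) (onePt W) :=
  .of_homeomorph (X := onePt V) (Y := onePt W) h.onePointCongr rfl

theorem onePt_sphere (V : Type) [AddCommGroup V] [Module ℝ V] [FiniteDimensional ℝ V]
    [TopologicalSpace V] [IsTopologicalAddGroup V] [ContinuousSMul ℝ V] [T2Space V] {k : ℕ}
    (h : Module.finrank ℝ V = k) : PointedHomotopyEquivalent (onePt V) (sphere k) := by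
  let v : EuclideanSpace ℝ (Fin (k + 1)) := EuclideanSpace.single 0 1
  have hv : ‖v‖ = 1 := by simp [v]
  have hv₀ : v ≠ 0 := fun h => by simp [h] at hv
  have : Fact (Module.finrank ℝ (EuclideanSpace ℝ (Fin (k + 1))) = k + 1) := ⟨by simp⟩
  have hV : Module.finrank ℝ V = Module.finrank ℝ (Submodule.span ℝ {v})ᗮ :=
    h.trans (Submodule.finrank_orthogonal_span_singleton hv₀).symm
  obtain ⟨e⟩ := FiniteDimensional.nonempty_continuousLinearEquiv_of_finrank_eq hV
  exact (onePt_congr e.toHomeomorph).trans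
    (.of_homeomorph (X := onePt _) (Y := sphere k) (onePointHyperplaneHomeoUnitSphere hv) rfl)

end OnePoint

/-! ### The circle as a one-point compactification -/

/-- The Cayley transform `a ↦ (a + i) / (a - i)`. -/
def cayley (a : ℝ) : Circle :=
  ⟨⟨(a ^ 2 - 1) / (a ^ 2 + 1), 2 * a / (a ^ 2 + 1)⟩, by
    have : a ^ 2 + 1 ≠ 0 := by positivity
    refine mem_sphere_zero_iff_norm.2 ?_
    rw [← sq_eq_sq₀ (norm_nonneg _) zero_le_one, Complex.sq_norm, Complex.normSq_mk]
    field_simp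
    ring⟩

theorem cayley_re (a : ℝ) : (cayley a : ℂ).re = (a ^ 2 - 1) / (a ^ 2 + 1) := rfl

theorem cayley_im (a : ℝ) : (cayley a : ℂ).im = 2 * a / (a ^ 2 + 1) := rfl

theorem circle_ext_re_im {z w : Circle} (hr : (z : ℂ).re = (w : ℂ).re)
    (hi : (z : ℂ).im = (w : ℂ).im) : z = w := Circle.ext (Complex.ext hr hi)

theorem circle_re_sq_add_im_sq (z : Circle) : (z : ℂ).re ^ 2 + (z : ℂ).im ^ 2 = 1 := by
  have := Circle.normSq_coe z
  rw [Complex.normSq_apply] at this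
  linarith

theorem one_sub_circle_re_ne_zero {z : Circle} (hz : z ≠ 1) : 1 - (z : ℂ).re ≠ 0 := by
  intro h
  have h1 := circle_re_sq_add_im_sq z
  have h2 : (z : ℂ).re = 1 := by linarith
  rw [h2] at h1
  refine hz (circle_ext_re_im (by simp [h2]) ?_)
  have : (z : ℂ).im ^ 2 = 0 := by linarith
  simpa using this

theorem cayley_neg (a : ℝ) : cayley (-a) = (cayley a)⁻¹ := by
  refine circle_ext_re_im ?_ ?_
  · rw [Circle.coe_inv_eq_conj, Complex.conj_re, cayley_re, cayley_re, neg_sq]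
  · rw [Circle.coe_inv_eq_conj, Complex.conj_im, cayley_im, cayley_im, neg_sq]
    ring

theorem continuous_cayley : Continuous cayley := by
  have h : ∀ a : ℝ, a ^ 2 + 1 ≠ 0 := fun a => by positivity
  refine Continuous.subtype_mk ?_ _
  refine Complex.equivRealProdCLM.symm.continuous.comp
    (f := fun a : ℝ => ((a ^ 2 - 1) / (a ^ 2 + 1), 2 * a / (a ^ 2 + 1))) ?_
  exact (Continuous.div (by fun_prop) (by fun_prop) h).prodMk
    (Continuous.div (by fun_prop) (by fun_prop) h)

theorem range_cayley : range cayley = {1}ᶜ := by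
  ext z
  rw [mem_compl_singleton_iff]
  constructor
  · rintro ⟨a, rfl⟩ h
    have := congrArg (fun z : Circle => (z : ℂ).re) h
    simp only [cayley_re, Circle.coe_one, Complex.one_re] at this
    rw [div_eq_one_iff_eq (by positivity)] at this
    linarith
  · intro hz
    have h := one_sub_circle_re_ne_zero hz
    have h1 := circle_re_sq_add_im_sq z
    refine ⟨(z : ℂ).im / (1 - (z : ℂ).re), ?_⟩
    have h2 : ((z : ℂ).im / (1 - (z : ℂ).re)) ^ 2 + 1 = 2 / (1 - (z : ℂ).re) := by
      field_simp
      linear_combination h1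
    refine circle_ext_re_im ?_ ?_
    · rw [cayley_re, h2, show ((z : ℂ).im / (1 - (z : ℂ).re)) ^ 2 - 1 =
        2 / (1 - (z : ℂ).re) - 2 by linarith]
      field_simp
      ring
    · rw [cayley_im, h2]
      field_simp

theorem mem_range_cayley {z : Circle} : z ∈ range cayley ↔ z ≠ 1 := by
  rw [range_cayley, mem_compl_singleton_iff]

theorem isOpenEmbedding_cayley : IsOpenEmbedding cayley := by
  have hopen : IsOpen (range cayley) := range_cayley ▸ isOpen_compl_singleton
  refine isOpenEmbedding_of_leftInverse (g := fun z => (z : ℂ).im / (1 - (z : ℂ).re))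
    continuous_cayley hopen ?_ fun a => ?_
  · exact ContinuousOn.div (by fun_prop) (by fun_prop) fun z hz =>
      one_sub_circle_re_ne_zero (mem_range_cayley.1 hz)
  · have h : 1 - (a ^ 2 - 1) / (a ^ 2 + 1) = 2 / (a ^ 2 + 1) := by
      field_simp
      ring
    change (cayley a : ℂ).im / (1 - (cayley a : ℂ).re) = a
    rw [cayley_re, cayley_im, h]
    field_simp

theorem circle_sq_eq_iff {z w : Circle} : z ^ 2 = w ^ 2 ↔ z = w ∨ z = -w := by
  rw [← Circle.coe_inj, ← Circle.coe_inj, ← Circle.coe_inj]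
  simpa using sq_eq_sq_iff_eq_or_eq_neg (a := (z : ℂ)) (b := w)

theorem exists_circle_sq_eq (z : Circle) : ∃ w : Circle, w ^ 2 = z :=
  ⟨Circle.exp ((z : ℂ).arg / 2), by
    rw [sq, ← Circle.exp_add, add_halves, Circle.exp_arg]⟩

/-! ### The quotients of the tori as one-point compactifications -/

namespace Torus

variable {ι T : Type} {K : Finset ι}

/-- The coordinates with indices in `K`, together with the last one. -/
def coords (ε : T ≃ K) (x : Torus ι) : (T → Circle) × Circle := (fun s => x.1 (ε s), x.2)

theorem continuous_coords (ε : T ≃ K) : Continuous (coords ε) := by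
  unfold coords
  fun_prop

theorem coords_flip (ε : T ≃ K) (x : Torus ι) :
    coords ε (flip x) = ((coords ε x).1⁻¹, -(coords ε x).2) := rfl

/-- The part of the torus on which no coordinate in `T` is `1`. -/
def cayleyCoords (T : Type) : (T → ℝ) × Circle → (T → Circle) × Circle :=
  Prod.map (Pi.map fun _ => cayley) id

theorem isOpenEmbedding_cayleyCoords (T : Type) [Finite T] : IsOpenEmbedding (cayleyCoords T) :=
  (IsOpenEmbedding.piMap fun _ => isOpenEmbedding_cayley).prodMap IsOpenEmbedding.id

theorem cayleyCoords_neg (p : (T → ℝ) × Circle) :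
    cayleyCoords T (-p) = ((cayleyCoords T p).1⁻¹, -(cayleyCoords T p).2) :=
  Prod.ext (funext fun s => cayley_neg (p.1 s)) rfl

theorem coords_mem_range_cayleyCoords (ε : T ≃ K) {x : Torus ι} :
    coords ε x ∈ range (cayleyCoords T) ↔ ∀ i ∈ K, x.1 i ≠ 1 := by
  simp only [cayleyCoords, coords, range_prodMap, mem_prod, range_id, mem_univ, and_true,
    range_piMap, mem_univ_pi, mem_range_cayley]
  exact ε.forall_congr_left.trans (by simp)

theorem coords_surjective (ε : T ≃ K) : Function.Surjective (coords ε) := by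
  classical
  rintro ⟨y, w⟩
  exact ⟨(fun i => if h : i ∈ K then y (ε.symm ⟨i, h⟩) else 1, w),
    Prod.ext (funext fun s => by simp [coords]) rfl⟩

variable [DecidableEq ι]

theorem restr_eq_iff (ε : T ≃ K) {x y : Torus ι} :
    restr K x = restr K y ↔ coords ε x = coords ε y := by
  rw [Prod.ext_iff, Prod.ext_iff]
  refine and_congr_left fun _ => ⟨fun h => funext fun s => ?_, fun h => funext fun i => ?_⟩
  · simpa [restr, coords] using congrFun h (ε s)
  · by_cases hi : i ∈ K
    · simpa [restr, hi, coords] using congrFun h (ε.symm ⟨i, hi⟩)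
    · simp [restr, hi]

theorem flip_restr (x : Torus ι) : flip (restr K x) = restr K (flip x) := by
  ext j
  · by_cases hj : j ∈ K <;> simp [flip, restr, hj]
  · rfl

theorem degenerate_restr_self_iff (hK : K.Nonempty) {x : Torus ι} :
    Degenerate K (restr K x) ↔ ∃ i ∈ K, x.1 i = 1 := by
  have hone {i : ι} (hi : i ∈ K) : (restr K x).1 i = 1 ↔ x.1 i = 1 := by rw [restr_fst hi]
  constructor
  · rintro (⟨i, hi, h⟩ | ⟨h, -⟩)
    · exact ⟨i, hi, (hone hi).1 h⟩
    · obtain ⟨i, hi⟩ := hK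
      exact ⟨i, hi, (hone hi).1 (congrFun h i)⟩
  · rintro ⟨i, hi, h⟩
    exact Or.inl ⟨i, hi, (hone hi).2 h⟩

/-- Away from the collapsed subset, the Cayley transform turns conjugation of a coordinate into
negation, so that the involution becomes the antipodal map on `ℝ^K × S^1`. -/
theorem quotient_equivalent_onePt (hK : K.Nonempty) [Finite T] (ε : T ≃ K) {V : Type}
    [TopologicalSpace V] [T2Space V] [WeaklyLocallyCompactSpace V]
    {f : (T → ℝ) × Circle → V} (hf : IsProperMap f) (hfs : Function.Surjective f)
    (hfe : ∀ p q, f p = f q ↔ p = q ∨ p = -q) :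
    PointedHomotopyEquivalent (quotient K K) (onePt V) := by
  have hdeg (x : Torus ι) : coords ε x ∉ range (cayleyCoords T) ↔ Degenerate K (restr K x) := by
    rw [coords_mem_range_cayleyCoords, degenerate_restr_self_iff hK]
    push Not
    rfl
  have he := (isOpenEmbedding_cayleyCoords T).injective
  refine .onePt_of_cover (isQuotientMap_mk _ _) (continuous_coords ε) (coords_surjective ε)
    (isOpenEmbedding_cayleyCoords T) hf hfs (mk_one _ _) ?_ (fun x y h => ?_)
    fun x y p q hp hq => ?_
  · rw [hdeg, restr_one]
    exact degenerate_one K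
  · rw [hdeg] at h ⊢
    rw [mk_eq_iff]
    exact ⟨fun h' => h'.degenerate h, fun h' => Or.inl ⟨h, h'⟩⟩
  · have hx : ¬ Degenerate K (restr K x) := by
      rw [← hdeg, hp, not_not]
      exact mem_range_self p
    have hq' : coords ε (flip y) = cayleyCoords T (-q) := by
      rw [coords_flip, cayleyCoords_neg, hq]
    rw [mk_eq_iff, hfe, Rel, flip_restr, restr_eq_iff ε, restr_eq_iff ε, hp, hq, hq',
      he.eq_iff, he.eq_iff]
    simp [hx]

theorem mk_empty_eq_iff {x y : Torus ι} : mk ∅ ∅ x = mk ∅ ∅ y ↔ x.2 ^ 2 = y.2 ^ 2 := by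
  rw [mk_eq_iff, rel_empty_iff, circle_sq_eq_iff]
  simp [restr, flip, Prod.ext_iff, funext_iff]

theorem quotient_empty : PointedHomotopyEquivalent (quotient (∅ : Finset ι) ∅) (onePt ℝ) := by
  refine .onePt_of_cover (isQuotientMap_mk _ _) (ρ := fun x : Torus ι => x.2 ^ 2) (by fun_prop)
    (fun z => ?_) isOpenEmbedding_cayley isProperMap_id Function.surjective_id (mk_one _ _) ?_
    (fun x y h => ?_) fun x y a b ha hb => ?_
  · obtain ⟨w, hw⟩ := exists_circle_sq_eq z
    exact ⟨(1, w), hw⟩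
  · exact fun h => mem_range_cayley.1 h (one_pow 2)
  · rw [mem_range_cayley, not_not] at h ⊢
    rw [mk_empty_eq_iff, h, eq_comm]
  · rw [mk_empty_eq_iff, ha, hb, isOpenEmbedding_cayley.injective.eq_iff, id, id]

theorem susp_quotient_empty :
    PointedHomotopyEquivalent (reducedSuspension (quotient (∅ : Finset ι) ∅)) (sphere 2) :=
  quotient_empty.susp.trans ((susp_onePt ℝ).trans (onePt_sphere _ (by simp)))

variable (κ T : Type)

/-- Pairs `2κ` real coordinates to `κ` complex ones and rotates these by the coordinate on the
circle, so that they become invariant under the antipodal map. -/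
def rotate : ((κ ⊕ κ) ⊕ T → ℝ) × Circle ≃ₜ (κ → ℂ) × ((T → ℝ) × Circle) where
  toFun p := (fun j => p.2 * (p.1 (.inl (.inl j)) + p.1 (.inl (.inr j)) * Complex.I),
    (fun t => p.1 (.inr t), p.2))
  invFun q := (Sum.elim (Sum.elim (fun j => ((q.2.2⁻¹ : Circle) * q.1 j : ℂ).re)
    fun j => ((q.2.2⁻¹ : Circle) * q.1 j : ℂ).im) q.2.1, q.2.2)
  left_inv p := by
    refine Prod.ext (funext ?_) rfl
    rintro ((j | j) | t)
    · simp only [Sum.elim_inl, ← mul_assoc, ← Circle.coe_mul, inv_mul_cancel]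
      simp
    · simp only [Sum.elim_inl, Sum.elim_inr, ← mul_assoc, ← Circle.coe_mul, inv_mul_cancel]
      simp
    · rfl
  right_inv q := by
    refine Prod.ext (funext fun j => ?_) rfl
    simp only [Sum.elim_inl, Sum.elim_inr, Complex.re_add_im, ← mul_assoc, ← Circle.coe_mul,
      mul_inv_cancel, Circle.coe_one, one_mul]
  continuous_toFun := by fun_prop
  continuous_invFun := by
    refine Continuous.prodMk (continuous_pi ?_) (by fun_prop)
    rintro ((j | j) | t) <;> simp only [Sum.elim_inl, Sum.elim_inr] <;> fun_prop

variable {κ T}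

theorem rotate_neg (p : ((κ ⊕ κ) ⊕ T → ℝ) × Circle) :
    rotate κ T (-p) = ((rotate κ T p).1, -(rotate κ T p).2) := by
  refine Prod.ext (funext fun j => ?_) rfl
  change ((-p.2 : Circle) : ℂ) * (((-p.1 _ : ℝ) : ℂ) + ((-p.1 _ : ℝ) : ℂ) * Complex.I) = _
  rw [Circle.coe_neg]
  push_cast
  change _ = (p.2 : ℂ) * (p.1 _ + p.1 _ * Complex.I)
  ring

theorem quotient_equivalent_onePt_prod (hK : K.Nonempty) [Finite T] [Finite κ]
    (ε : (κ ⊕ κ) ⊕ T ≃ K) {V : Type} [TopologicalSpace V] [T2Space V] [LocallyCompactSpace V]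
    {f : (T → ℝ) × Circle → V} (hf : IsProperMap f) (hfs : Function.Surjective f)
    (hfe : ∀ p q, f p = f q ↔ p = q ∨ p = -q) :
    PointedHomotopyEquivalent (quotient K K) (onePt ((κ → ℂ) × V)) := by
  refine quotient_equivalent_onePt hK ε (f := Prod.map id f ∘ rotate κ T)
    ((isProperMap_id.prodMap hf).comp (rotate κ T).isProperMap)
    ((Function.surjective_id.prodMap hfs).comp (rotate κ T).surjective) fun p q => ?_
  rw [← (rotate κ T).injective.eq_iff (a := p) (b := q),
    ← (rotate κ T).injective.eq_iff (a := p) (b := -q), rotate_neg]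
  simp only [Function.comp_apply, Prod.map, id, Prod.ext_iff (x := rotate _ _ _), Prod.mk.injEq,
    hfe]
  tauto

end Torus

/-! ### The case of an even number of coordinates -/

/-- The half-smash product of `Y` with the circle. -/
def halfSmash (Y : PointedSpace) : PointedSpace :=
  collapse {p : Y × Circle | p.1 = Y.pt} (Y.pt, 1)

/-- The circle coordinate of the half-smash product; forgetting it gives `Y`. -/
def halfSmashCoordinate (Y : PointedSpace) : CircleCoordinate (halfSmash Y) Y (Y × Circle) where
  cover := collapseMk _ _
  forget := ⟨Prod.fst, continuous_fst⟩
  coord := ⟨Prod.snd, continuous_snd⟩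
  setCoord := ⟨fun p => (p.2.1, p.1), by fun_prop⟩
  base := (Y.pt, 1)
  isQuotientMap_cover := isQuotientMap_collapseMk
  isQuotientMap_forget := isOpenMap_fst.isQuotientMap continuous_fst Prod.fst_surjective
  setCoord_coord _ := rfl
  coord_setCoord _ _ := rfl
  setCoord_setCoord _ _ _ := rfl
  forget_setCoord _ _ := rfl
  forget_eq p q h := by
    rcases collapseMk_eq_iff.1 h with rfl | ⟨hp, hq⟩
    exacts [rfl, hp.trans hq.symm]
  cover_setCoord_one p q h := congrArg (fun y => collapseMk _ _ (y, 1)) h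
  cover_setCoord f p q _ _ h := by
    rcases collapseMk_eq_iff.1 h with rfl | h
    exacts [rfl, collapseMk_eq_iff.2 (Or.inr h)]
  coord_eq p q h := by
    rcases collapseMk_eq_iff.1 h with rfl | ⟨hp, -⟩
    · exact Or.inr (Or.inl rfl)
    · exact Or.inl ((collapseMk_eq_pt_iff (A := {p : Y × Circle | p.1 = Y.pt}) rfl).2 hp)
  coord_base := rfl
  cover_base := rfl
  forget_base := rfl

theorem susp_halfSmash (Y : PointedSpace) :
    PointedHomotopyEquivalent (reducedSuspension (halfSmash Y))
      (wedge (reducedSuspension Y)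
        (reducedSuspension (collapse {p : Y × Circle | p.1 = Y.pt ∨ p.2 = 1} (Y.pt, 1)))) := by
  refine (halfSmashCoordinate Y).susp_equivalent isQuotientMap_collapseMk rfl fun p q => ?_
  have hcover : (halfSmashCoordinate Y).cover p = (halfSmashCoordinate Y).cover q ↔
      p = q ∨ (p.1 = Y.pt ∧ q.1 = Y.pt) := collapseMk_eq_iff
  have hpt (r : Y × Circle) : (halfSmashCoordinate Y).cover r = (halfSmash Y).pt ↔ r.1 = Y.pt :=
    collapseMk_eq_pt_iff (A := {p : Y × Circle | p.1 = Y.pt}) rfl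
  rw [collapseMk_eq_iff, hcover, hpt, hpt]
  change _ ↔ _ ∨ (_ ∨ p.2 = 1) ∧ (_ ∨ q.2 = 1)
  simp only [mem_ofPred_eq]
  tauto

section HalfSmashOnePt

open OnePoint

variable (V : Type) [TopologicalSpace V] [T2Space V] [LocallyCompactSpace V]

theorem halfSmash_onePt :
    PointedHomotopyEquivalent (halfSmash (onePt V)) (onePt (V × Circle)) := by
  refine .collapse_compl_range (P := OnePoint V × Circle)
    (isOpenEmbedding_coe.prodMap IsOpenEmbedding.id) rfl ?_
  rintro ⟨y, z⟩
  rw [range_prodMap, mem_prod, mem_range_coe_onePoint, range_id]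
  change y = ∞ ↔ _
  simp

theorem smash_onePt_circle :
    PointedHomotopyEquivalent
      (collapse {p : onePt V × Circle | p.1 = (onePt V).pt ∨ p.2 = 1} ((onePt V).pt, 1))
      (onePt (V × ℝ)) := by
  refine .collapse_compl_range (P := OnePoint V × Circle)
    (isOpenEmbedding_coe.prodMap isOpenEmbedding_cayley) (Or.inl rfl) ?_
  rintro ⟨y, z⟩
  rw [range_prodMap, mem_prod, mem_range_coe_onePoint, mem_range_cayley]
  change y = ∞ ∨ z = 1 ↔ _
  tauto

theorem susp_onePt_prod_circle :
    PointedHomotopyEquivalent (reducedSuspension (onePt (V × Circle)))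
      (wedge (onePt (V × ℝ)) (onePt ((V × ℝ) × ℝ))) :=
  (halfSmash_onePt V).symm.susp.trans <| (susp_halfSmash (onePt V)).trans <|
    .wedge_congr (susp_onePt V) ((smash_onePt_circle V).susp.trans (susp_onePt _))

end HalfSmashOnePt

namespace Torus

variable {ι : Type} [DecidableEq ι] {K : Finset ι}

theorem quotient_even (hK : K.Nonempty) {b : ℕ} (hb : K.card = b + b) :
    PointedHomotopyEquivalent (quotient K K) (onePt ((Fin b → ℂ) × Circle)) := by
  let ε : (Fin b ⊕ Fin b) ⊕ Empty ≃ K := Fintype.equivOfCardEq (by simp [hb])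
  refine quotient_equivalent_onePt_prod hK ε (f := fun p => p.2 ^ 2)
    (Continuous.isProperMap (by fun_prop)) (fun z => ?_) fun p q => ?_
  · obtain ⟨w, hw⟩ := exists_circle_sq_eq z
    exact ⟨(Empty.elim, w), hw⟩
  · simp [circle_sq_eq_iff, Prod.ext_iff, eq_iff_true_of_subsingleton]

theorem susp_quotient_even (hK : K.Nonempty) (hb : Even K.card) :
    PointedHomotopyEquivalent (reducedSuspension (quotient K K))
      (wedge (sphere (K.card + 1)) (sphere (K.card + 2))) := by
  obtain ⟨b, hb⟩ := hb
  refine (quotient_even hK hb).susp.trans ((susp_onePt_prod_circle _).trans (.wedge_congr ?_ ?_))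
  · exact onePt_sphere _ (by simp [Module.finrank_pi_fintype, hb, mul_two])
  · exact onePt_sphere _ (by simp [Module.finrank_pi_fintype, hb, mul_two])

end Torus

/-! ### The case of an odd number of coordinates -/

/-- The map `(a, w) ↦ (w a, w²)`, which identifies antipodal points. -/
def moebiusFun (p : ℝ × Circle) : ℂ × Circle := (p.2 * p.1, p.2 ^ 2)

theorem moebiusFun_eq_iff {p q : ℝ × Circle} : moebiusFun p = moebiusFun q ↔ p = q ∨ p = -q := by
  obtain ⟨a, w⟩ := p
  obtain ⟨c, v⟩ := q
  simp only [moebiusFun, Prod.mk.injEq, Prod.neg_mk, circle_sq_eq_iff]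
  have hmul {a c : ℝ} : (v * a : ℂ) = v * c ↔ a = c := by
    rw [mul_right_inj' v.coe_ne_zero, Complex.ofReal_inj]
  have hneg : ((-v : Circle) * a : ℂ) = v * c ↔ a = -c := by
    rw [← hmul, Circle.coe_neg, Complex.ofReal_neg, mul_neg, neg_mul, neg_eq_iff_eq_neg]
  constructor
  · rintro ⟨h, rfl | rfl⟩
    exacts [Or.inl ⟨hmul.1 h, rfl⟩, Or.inr ⟨hneg.1 h, rfl⟩]
  · rintro (⟨rfl, rfl⟩ | ⟨h, rfl⟩)
    exacts [⟨rfl, Or.inl rfl⟩, ⟨hneg.2 h, Or.inr rfl⟩]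

theorem isProperMap_moebiusFun : IsProperMap moebiusFun := by
  have hsq : IsProperMap fun z : Circle => z ^ 2 := (continuous_pow 2).isProperMap
  refine (isProperMap_id (X := ℂ)).prodMap hsq |>.comp
    (Function.LeftInverse.isClosedEmbedding (f := fun p : ℂ × Circle =>
      (((p.2⁻¹ : Circle) * p.1 : ℂ).re, p.2)) (g := fun p : ℝ × Circle => (p.2 * p.1, p.2))
      (fun p => ?_) (by fun_prop) (by fun_prop)).isProperMap
  refine Prod.ext ?_ rfl
  change (((p.2⁻¹ : Circle) : ℂ) * (p.2 * p.1)).re = p.1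
  rw [← mul_assoc, ← Circle.coe_mul, inv_mul_cancel, Circle.coe_one, one_mul, Complex.ofReal_re]

/-- The open Möbius strip, as the quotient of `ℝ × Circle` by the antipodal map. It is realized as
a closed subset of `ℂ × Circle`, so that it is visibly a locally compact Hausdorff space. -/
def Moebius : Type := range moebiusFun

instance : TopologicalSpace Moebius := inferInstanceAs (TopologicalSpace (range moebiusFun))

instance : T2Space Moebius := inferInstanceAs (T2Space (range moebiusFun))

instance : LocallyCompactSpace Moebius :=
  isProperMap_moebiusFun.isClosedMap.isClosed_range.isClosedEmbedding_subtypeVal.locallyCompactSpace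

/-- The double covering of the open Möbius strip. -/
def moebius (p : ℝ × Circle) : Moebius := rangeFactorization moebiusFun p

theorem moebius_surjective : Function.Surjective moebius := rangeFactorization_surjective

theorem moebius_eq_iff {p q : ℝ × Circle} : moebius p = moebius q ↔ p = q ∨ p = -q :=
  Subtype.ext_iff.trans moebiusFun_eq_iff

theorem isProperMap_moebius : IsProperMap moebius :=
  isProperMap_of_comp_of_inj (g := (Subtype.val : range moebiusFun → ℂ × Circle))
    (isProperMap_moebiusFun.continuous.subtype_mk _) continuous_subtype_val
    isProperMap_moebiusFun Subtype.val_injective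

namespace Torus

variable {ι : Type} [DecidableEq ι] {K : Finset ι}

theorem quotient_odd {b : ℕ} (hb : K.card = b + b + 1) :
    PointedHomotopyEquivalent (quotient K K) (onePt ((Fin b → ℂ) × Moebius)) := by
  let ε : (Fin b ⊕ Fin b) ⊕ Unit ≃ K := Fintype.equivOfCardEq (by simp [hb])
  let e : (Unit → ℝ) × Circle ≃ₜ ℝ × Circle := (Homeomorph.funUnique Unit ℝ).prodCongr (.refl _)
  refine quotient_equivalent_onePt_prod (Finset.card_pos.1 (by omega)) ε (f := moebius ∘ e)
    (isProperMap_moebius.comp e.isProperMap) (moebius_surjective.comp e.surjective) fun p q => ?_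
  rw [Function.comp_apply, Function.comp_apply, moebius_eq_iff, e.injective.eq_iff,
    ← e.injective.eq_iff (b := -q)]
  rfl

end Torus

/-- The upper half of the circle, parametrized by the real part. -/
def halfCircle (c : Icc (-1 : ℝ) 1) : Circle :=
  ⟨c + √(1 - c ^ 2) * Complex.I, mem_sphere_zero_iff_norm.2 <| by
    have h : (0 : ℝ) ≤ 1 - c ^ 2 := by nlinarith [c.2.1, c.2.2]
    rw [← sq_eq_sq₀ (norm_nonneg _) zero_le_one, Complex.sq_norm,
      Complex.normSq_add_mul_I, Real.sq_sqrt h]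
    ring⟩

theorem halfCircle_re (c : Icc (-1 : ℝ) 1) : (halfCircle c : ℂ).re = c := by
  simp [halfCircle]

theorem halfCircle_im (c : Icc (-1 : ℝ) 1) : (halfCircle c : ℂ).im = √(1 - c ^ 2) := by
  simp only [halfCircle, Complex.add_im, Complex.ofReal_im, Complex.im_ofReal_mul, Complex.I_im,
    mul_one, zero_add]

theorem continuous_halfCircle : Continuous halfCircle :=
  Continuous.subtype_mk (by fun_prop) _

theorem halfCircle_injective : Function.Injective halfCircle := fun c c' h =>
  Subtype.ext (by rw [← halfCircle_re, h, halfCircle_re])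

theorem exists_halfCircle_of_im_nonneg {z : Circle} (h : 0 ≤ (z : ℂ).im) :
    ∃ c, halfCircle c = z := by
  have h1 := circle_re_sq_add_im_sq z
  have hre : |(z : ℂ).re| ≤ 1 := (Complex.abs_re_le_norm z).trans z.norm_coe.le
  refine ⟨⟨(z : ℂ).re, abs_le.1 hre⟩, circle_ext_re_im (halfCircle_re _) ?_⟩
  rw [halfCircle_im, sub_eq_iff_eq_add'.2 h1.symm, Real.sqrt_sq h]

theorem halfCircle_eq_neg_iff {c c' : Icc (-1 : ℝ) 1} :
    halfCircle c = -halfCircle c' ↔ (c : ℝ) = -c' ∧ (c : ℝ) ^ 2 = 1 := by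
  have h : (0 : ℝ) ≤ 1 - c ^ 2 := by nlinarith [c.2.1, c.2.2]
  have hre : (-halfCircle c' : ℂ).re = -c' := by rw [Complex.neg_re, halfCircle_re]
  have him : (-halfCircle c' : ℂ).im = -√(1 - c' ^ 2) := by rw [Complex.neg_im, halfCircle_im]
  constructor
  · intro hc
    have hc : (halfCircle c : ℂ) = -halfCircle c' := congrArg Subtype.val hc
    have hi : √(1 - (c : ℝ) ^ 2) = -√(1 - (c' : ℝ) ^ 2) := by rw [← halfCircle_im, hc, him]
    have h0 : √(1 - (c : ℝ) ^ 2) = 0 :=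
      le_antisymm (hi ▸ neg_nonpos.2 (Real.sqrt_nonneg _)) (Real.sqrt_nonneg _)
    rw [Real.sqrt_eq_zero h] at h0
    exact ⟨by rw [← halfCircle_re, hc, hre], by linarith⟩
  · rintro ⟨hr, h1⟩
    refine circle_ext_re_im ((halfCircle_re c).trans (hr.trans hre.symm)) ?_
    refine (halfCircle_im c).trans (Eq.trans ?_ him.symm)
    rw [← neg_sq (c' : ℝ), ← hr, h1]
    simp

/-- The open Möbius strip as the strip `ℝ × [-1, 1]` whose ends are glued with a twist. -/
def moebiusStrip (p : ℝ × Icc (-1 : ℝ) 1) : Moebius := moebius (p.1, halfCircle p.2)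

theorem isProperMap_moebiusStrip : IsProperMap moebiusStrip :=
  isProperMap_moebius.comp (isProperMap_id.prodMap continuous_halfCircle.isProperMap)

theorem moebiusStrip_surjective : Function.Surjective moebiusStrip := by
  intro y
  obtain ⟨⟨a, w⟩, rfl⟩ := moebius_surjective y
  rcases le_total 0 (w : ℂ).im with h | h
  · obtain ⟨c, rfl⟩ := exists_halfCircle_of_im_nonneg h
    exact ⟨(a, c), rfl⟩
  · obtain ⟨c, hc⟩ := exists_halfCircle_of_im_nonneg (z := -w) (neg_nonneg.2 h)
    exact ⟨(-a, c), moebius_eq_iff.2 (Or.inr (Prod.ext rfl hc))⟩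

theorem moebiusStrip_eq_iff {a a' : ℝ} {c c' : Icc (-1 : ℝ) 1} :
    moebiusStrip (a, c) = moebiusStrip (a', c') ↔
      (a = a' ∧ c = c') ∨ (a = -a' ∧ (c : ℝ) = -c' ∧ (c : ℝ) ^ 2 = 1) := by
  refine moebius_eq_iff.trans ?_
  rw [Prod.neg_mk, Prod.mk.injEq, Prod.mk.injEq, halfCircle_injective.eq_iff,
    halfCircle_eq_neg_iff]

/-! ### The Moore space as a quotient of the ball -/

section AngleDouble

variable {m : ℕ}

/-- The first two coordinates of a vector, as a complex number. -/
def planar (x : EuclideanSpace ℝ (Fin (m + 2))) : ℂ := ⟨x 0, x 1⟩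

theorem norm_planar (x : EuclideanSpace ℝ (Fin (m + 2))) :
    ‖planar x‖ = √(x 0 ^ 2 + x 1 ^ 2) :=
  Complex.norm_eq_sqrt_sq_add_sq _

theorem ext_planar {x y : EuclideanSpace ℝ (Fin (m + 2))} (h : planar x = planar y)
    (h' : ∀ j : Fin m, x j.succ.succ = y j.succ.succ) : x = y := by
  ext j
  exact Fin.cases (congrArg Complex.re h) (fun j => Fin.cases (congrArg Complex.im h) h' j) j

theorem planar_angleDouble (x : EuclideanSpace ℝ (Fin (m + 2))) :
    planar (angleDouble m x) = planar x ^ 2 / ‖planar x‖ := by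
  refine Complex.ext ?_ ?_
  · rw [Complex.div_ofReal_re, norm_planar, sq, Complex.mul_re, ← sq, ← sq]
    rfl
  · rw [Complex.div_ofReal_im, norm_planar, sq, Complex.mul_im, mul_comm _ (planar x).re, ← two_mul,
      ← mul_assoc]
    rfl

theorem sq_div_norm_eq_iff {z w : ℂ} : z ^ 2 / ‖z‖ = w ^ 2 / ‖w‖ ↔ z = w ∨ z = -w := by
  have hnorm (z : ℂ) : ‖z ^ 2 / ‖z‖‖ = ‖z‖ := by
    rw [norm_div, norm_pow, Complex.norm_real, norm_norm, sq, mul_self_div_self]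
  have hmul (z : ℂ) : z ^ 2 / ‖z‖ * ‖z‖ = z ^ 2 := by
    rcases eq_or_ne z 0 with rfl | hz
    · simp
    · exact div_mul_cancel₀ _ (by simpa using hz)
  rw [← sq_eq_sq_iff_eq_or_eq_neg]
  constructor <;> intro h
  · have hzw : ‖z‖ = ‖w‖ := by rw [← hnorm z, h, hnorm]
    rw [← hmul z, h, hzw, hmul]
  · have hzw : ‖z‖ = ‖w‖ := by
      rw [← sq_eq_sq₀ (norm_nonneg z) (norm_nonneg w), ← norm_pow, h, norm_pow]
    rw [h, hzw]

/-- The rotation by `π` in the plane of the first two coordinates: the ambiguity in halving the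
angle. -/
def halfTurn (x : EuclideanSpace ℝ (Fin (m + 2))) : EuclideanSpace ℝ (Fin (m + 2)) :=
  WithLp.toLp 2 (Fin.cons (-x 0) (Fin.cons (-x 1) fun j : Fin m => x j.succ.succ))

theorem angleDouble_eq_iff {x y : EuclideanSpace ℝ (Fin (m + 2))} :
    angleDouble m x = angleDouble m y ↔ x = y ∨ x = halfTurn y := by
  have hdouble (x : EuclideanSpace ℝ (Fin (m + 2))) (j : Fin m) :
      angleDouble m x j.succ.succ = x j.succ.succ := rfl
  have hturn : planar (halfTurn y) = -planar y := rfl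
  constructor
  · intro h
    have hrest (j : Fin m) : x j.succ.succ = y j.succ.succ := by rw [← hdouble, h, hdouble]
    have hplane := congrArg planar h
    rw [planar_angleDouble, planar_angleDouble, sq_div_norm_eq_iff] at hplane
    exact hplane.imp (ext_planar · hrest) (ext_planar · hrest)
  · rintro (rfl | rfl)
    · rfl
    · refine ext_planar ?_ fun j => rfl
      rw [planar_angleDouble, planar_angleDouble, sq_div_norm_eq_iff]
      exact Or.inr hturn

theorem angleDouble_surjective : Function.Surjective (angleDouble m) := by
  intro y
  obtain ⟨ζ, hζ⟩ := IsAlgClosed.exists_pow_nat_eq (planar y) zero_lt_two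
  let z : ℂ := ‖ζ‖ * ζ
  have hz : z ^ 2 / ‖z‖ = ζ ^ 2 := by
    rcases eq_or_ne ζ 0 with rfl | h
    · simp [z]
    · have : (‖ζ‖ : ℂ) ≠ 0 := by simpa using h
      simp only [z, norm_mul, norm_norm, Complex.norm_real, Complex.ofReal_mul]
      field_simp
  refine ⟨WithLp.toLp 2 (Fin.cons z.re (Fin.cons z.im fun j => y j.succ.succ)),
    ext_planar ?_ fun j => rfl⟩
  rw [planar_angleDouble, ← hζ, ← hz]
  rfl

theorem degreeTwo_surjective : Function.Surjective (degreeTwo m) := by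
  intro y
  obtain ⟨x, hx⟩ := angleDouble_surjective (m := m) y.1
  have h : ‖x‖ = 1 := by
    rw [← norm_angleDouble, hx]
    exact mem_sphere_zero_iff_norm.1 y.2
  exact ⟨⟨x, mem_sphere_zero_iff_norm.2 h⟩, Subtype.ext hx⟩

theorem angleDouble_mem_halfPlane_iff {v : EuclideanSpace ℝ (Fin (m + 2))} :
    0 ≤ angleDouble m v 0 ∧ angleDouble m v 1 = 0 ↔ v 1 = 0 := by
  change 0 ≤ (v 0 ^ 2 - v 1 ^ 2) / √(v 0 ^ 2 + v 1 ^ 2) ∧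
    2 * v 0 * v 1 / √(v 0 ^ 2 + v 1 ^ 2) = 0 ↔ _
  constructor
  · rintro ⟨h0, h1⟩
    by_contra hv
    have hp : 0 < v 1 ^ 2 := by positivity
    have hs : 0 < √(v 0 ^ 2 + v 1 ^ 2) := Real.sqrt_pos.2 (by positivity)
    have h2 : v 0 = 0 := by simpa [hv, hs.ne'] using h1
    rw [le_div_iff₀ hs, h2] at h0
    linarith
  · intro h
    simp only [h, mul_zero, zero_div, and_true]
    exact div_nonneg (by nlinarith [sq_nonneg (v 0)]) (Real.sqrt_nonneg _)

end AngleDouble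

section MooreCells

variable {m : ℕ}

instance (k : ℕ) : CompactSpace (sphere k) :=
  inferInstanceAs (CompactSpace (Metric.sphere (0 : EuclideanSpace ℝ (Fin (k + 1))) 1))

instance (k : ℕ) : T2Space (sphere k) :=
  inferInstanceAs (T2Space (Metric.sphere (0 : EuclideanSpace ℝ (Fin (k + 1))) 1))

/-- The closed ball that is the top cell of the Moore space. -/
abbrev MooreCell (m : ℕ) : Type := Metric.closedBall (0 : EuclideanSpace ℝ (Fin (m + 2))) 1

/-- The inclusion of the boundary of the top cell. -/
def cellBoundary (m : ℕ) : C(sphere (m + 1), MooreCell m) :=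
  ⟨inclusion Metric.sphere_subset_closedBall, continuous_inclusion _⟩

/-- The inclusion of the bottom cell. -/
def mooreSphere (m : ℕ) : C(sphere (m + 1), moore m) :=
  ⟨fun x => Quot.mk _ (Sum.inl x), continuous_quot_mk.comp continuous_inl⟩

/-- The characteristic map of the top cell. -/
def mooreBall (m : ℕ) : C(MooreCell m, moore m) :=
  ⟨fun v => Quot.mk _ (Sum.inr v), continuous_quot_mk.comp continuous_inr⟩

theorem mooreBall_cellBoundary (x : sphere (m + 1)) :
    mooreBall m (cellBoundary m x) = mooreSphere m (degreeTwo m x) :=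
  Quot.sound ⟨x, rfl, rfl⟩

open Classical in
/-- The normal form of a point of the Moore space: a point of the bottom cell, or else an interior
point of the top cell. -/
def mooreNormal (m : ℕ) : moore m → sphere (m + 1) ⊕ MooreCell m :=
  Quot.lift (Sum.elim Sum.inl fun v => if h : ‖v.1‖ = 1 then
    Sum.inl (degreeTwo m ⟨v.1, mem_sphere_zero_iff_norm.2 h⟩) else Sum.inr v) <| by
      rintro _ _ ⟨x, rfl, rfl⟩
      exact dif_pos (mem_sphere_zero_iff_norm.1 x.2)

theorem mooreNormal_sphere (x : sphere (m + 1)) : mooreNormal m (mooreSphere m x) = Sum.inl x := rfl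

open Classical in
theorem mooreNormal_ball (v : MooreCell m) :
    mooreNormal m (mooreBall m v) = if h : ‖v.1‖ = 1 then
      Sum.inl (degreeTwo m ⟨v.1, mem_sphere_zero_iff_norm.2 h⟩) else Sum.inr v := rfl

theorem mooreNormal_injective : Function.Injective (mooreNormal m) := by
  refine Function.LeftInverse.injective (g := Sum.elim (mooreSphere m) (mooreBall m)) ?_
  rintro ⟨x | v⟩
  · rfl
  · change Sum.elim _ _ (mooreNormal m (mooreBall m v)) = mooreBall m v
    rw [mooreNormal_ball]
    split_ifs
    exacts [(mooreBall_cellBoundary _).symm, rfl]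

theorem mooreSphere_eq_ball_iff {x : sphere (m + 1)} {v : MooreCell m} :
    mooreSphere m x = mooreBall m v ↔ ‖v.1‖ = 1 ∧ x.1 = angleDouble m v := by
  rw [← mooreNormal_injective.eq_iff, mooreNormal_sphere, mooreNormal_ball]
  split_ifs with h
  · exact Sum.inl_injective.eq_iff.trans (Subtype.ext_iff.trans (and_iff_right h).symm)
  · simp [h]

theorem mooreBall_eq_iff {v w : MooreCell m} :
    mooreBall m v = mooreBall m w ↔
      v = w ∨ (‖v.1‖ = 1 ∧ ‖w.1‖ = 1 ∧ angleDouble m v = angleDouble m w) := by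
  rw [← mooreNormal_injective.eq_iff, mooreNormal_ball, mooreNormal_ball]
  split_ifs with hv hw hw
  · refine Sum.inl_injective.eq_iff.trans (Subtype.ext_iff.trans
      ⟨fun h => Or.inr ⟨hv, hw, h⟩, ?_⟩)
    rintro (rfl | h)
    exacts [rfl, h.2.2]
  · simp only [hw, false_and, and_false, or_false, false_iff]
    rintro rfl
    exact hw hv
  · simp only [hv, false_and, or_false, false_iff]
    rintro rfl
    exact hv hw
  · simp [hv]

theorem isQuotientMap_mooreBall : IsQuotientMap (mooreBall m) := by
  refine isQuotientMap_iff_isClosed.2 ⟨?_, fun s => ⟨fun h => h.preimage (mooreBall m).continuous,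
    fun h => isQuotientMap_quot_mk.isClosed_preimage.1 (isClosed_sum_iff.2 ⟨?_, h⟩)⟩⟩
  · rintro ⟨x | v⟩
    · obtain ⟨y, rfl⟩ := degreeTwo_surjective x
      exact ⟨_, mooreBall_cellBoundary y⟩
    · exact ⟨v, rfl⟩
  · have hdegree : IsQuotientMap (degreeTwo m) :=
      .of_surjective_continuous degreeTwo_surjective (degreeTwo m).continuous
    rw [← hdegree.isClosed_preimage]
    convert h.preimage (cellBoundary m).continuous using 1
    ext x
    exact iff_of_eq (congrArg (· ∈ s) (mooreBall_cellBoundary x).symm)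

end MooreCells

/-! ### The Moore space as a one-point compactification -/

section Polar

variable {m : ℕ}

theorem norm_sphere {k : ℕ} (x : sphere k) : ‖x.1‖ = 1 := mem_sphere_zero_iff_norm.1 x.2

/-- A homotopy of the sphere from the identity that contracts a hemisphere to the basepoint. -/
def sphereShrink (k : ℕ) : C(I × sphere k, sphere k) where
  toFun p := ⟨shrink (sphere k).pt.1 p.1 p.2.1,
    mem_sphere_zero_iff_norm.2 (norm_shrink (norm_sphere _) (norm_sphere _) p.1)⟩
  continuous_toFun := (continuous_shrink (norm_sphere _) continuous_fst
    (continuous_subtype_val.comp continuous_snd) fun p => norm_sphere p.2).subtype_mk _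

theorem sphereShrink_zero {k : ℕ} (x : sphere k) : sphereShrink k (0, x) = x :=
  Subtype.ext (shrink_zero (norm_sphere x))

theorem sphereShrink_pt {k : ℕ} (t : I) : sphereShrink k (t, (sphere k).pt) = (sphere k).pt :=
  Subtype.ext (shrink_self (norm_sphere _) t)

/-- Polar coordinates in the top cell of the Moore space. -/
def polar (m : ℕ) : C(sphere (m + 1) × I, MooreCell m) where
  toFun p := ⟨(p.2 : ℝ) • p.1.1, by
    rw [mem_closedBall_zero_iff, norm_smul, norm_sphere, mul_one, Real.norm_of_nonneg p.2.2.1]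
    exact p.2.2.2⟩
  continuous_toFun := ((continuous_subtype_val.comp continuous_snd).smul
    (continuous_subtype_val.comp continuous_fst)).subtype_mk _

theorem norm_polar (p : sphere (m + 1) × I) : ‖(polar m p).1‖ = p.2 := by
  change ‖(p.2 : ℝ) • p.1.1‖ = _
  rw [norm_smul, norm_sphere, mul_one, Real.norm_of_nonneg p.2.2.1]

theorem polar_one (x : sphere (m + 1)) : polar m (x, 1) = cellBoundary m x :=
  Subtype.ext (one_smul ℝ x.1)

theorem polar_eq_iff {x y : sphere (m + 1)} {r s : I} :
    polar m (x, r) = polar m (y, s) ↔ r = s ∧ (r = 0 ∨ x = y) := by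
  constructor
  · intro h
    obtain rfl : r = s := Subtype.ext (by
      simpa only [norm_polar] using congrArg (fun v : MooreCell m => ‖v.1‖) h)
    refine ⟨rfl, or_iff_not_imp_left.2 fun hr => Subtype.ext ?_⟩
    exact smul_right_injective _ (Subtype.coe_ne_coe.2 hr) (congrArg Subtype.val h)
  · rintro ⟨rfl, rfl | rfl⟩
    · exact Subtype.ext ((zero_smul ℝ _).trans (zero_smul ℝ _).symm)
    · rfl

theorem polar_surjective : Function.Surjective (polar m) := by
  intro v
  by_cases hv : v.1 = 0
  · exact ⟨((sphere (m + 1)).pt, 0), Subtype.ext ((zero_smul ℝ _).trans hv.symm)⟩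
  · have hn := norm_ne_zero_iff.2 hv
    refine ⟨(⟨‖v.1‖⁻¹ • v.1, ?_⟩, ⟨‖v.1‖, norm_nonneg _, mem_closedBall_zero_iff.1 v.2⟩),
      Subtype.ext (smul_inv_smul₀ hn v.1)⟩
    rw [mem_sphere_zero_iff_norm, norm_smul, norm_inv, norm_norm, inv_mul_cancel₀ hn]

/-- The characteristic map of the top cell of the Moore space, in polar coordinates. -/
def moorePolar (m : ℕ) : C(sphere (m + 1) × I, moore m) := (mooreBall m).comp (polar m)

theorem isQuotientMap_moorePolar : IsQuotientMap (moorePolar m) :=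
  isQuotientMap_mooreBall.comp (.of_surjective_continuous polar_surjective (polar m).continuous)

theorem moorePolar_one (x : sphere (m + 1)) :
    moorePolar m (x, 1) = mooreSphere m (degreeTwo m x) :=
  (congrArg (mooreBall m) (polar_one x)).trans (mooreBall_cellBoundary x)

theorem moorePolar_eq_iff {x y : sphere (m + 1)} {r s : I} :
    moorePolar m (x, r) = moorePolar m (y, s) ↔
      r = s ∧ (r = 0 ∨ x = y ∨ r = 1 ∧ degreeTwo m x = degreeTwo m y) := by
  refine mooreBall_eq_iff.trans ?_
  rw [polar_eq_iff, norm_polar, norm_polar, Icc.coe_eq_one, Icc.coe_eq_one]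
  have hdegree (hr : r = 1) (hs : s = 1) :
      angleDouble m (polar m (x, r)) = angleDouble m (polar m (y, s)) ↔
        degreeTwo m x = degreeTwo m y := by
    rw [hr, hs, polar_one, polar_one]
    exact (show degreeTwo m x = degreeTwo m y ↔ _ from Subtype.ext_iff).symm
  constructor
  · rintro (⟨rfl, h⟩ | ⟨rfl, rfl, h⟩)
    exacts [⟨rfl, h.imp_right Or.inl⟩, ⟨rfl, Or.inr (Or.inr ⟨rfl, (hdegree rfl rfl).1 h⟩)⟩]
  · rintro ⟨rfl, h | h | ⟨rfl, h⟩⟩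
    · exact Or.inl ⟨rfl, Or.inl h⟩
    · exact Or.inl ⟨rfl, Or.inr h⟩
    · exact Or.inr ⟨rfl, rfl, (hdegree rfl rfl).2 h⟩

/-- The extension over the top cell of the homotopy `sphereShrink` of the bottom cell: the top cell
is stretched radially, and what leaves it follows `sphereShrink`. -/
def mooreStretch (m : ℕ) (p : (sphere (m + 1) × I) × I) : moore m :=
  if (p.1.2 : ℝ) * (1 + p.2) ≤ 1 then
    moorePolar m (p.1.1, projIcc 0 1 zero_le_one (p.1.2 * (1 + p.2)))
  else mooreSphere m (sphereShrink (m + 1)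
    (projIcc 0 1 zero_le_one (p.1.2 * (1 + p.2) - 1), degreeTwo m p.1.1))

theorem continuous_mooreStretch : Continuous (mooreStretch m) := by
  have hradius : Continuous fun p : (sphere (m + 1) × I) × I => (p.1.2 : ℝ) * (1 + p.2) := by
    fun_prop
  have hdegree : Continuous fun p : (sphere (m + 1) × I) × I => degreeTwo m p.1.1 := by fun_prop
  refine Continuous.if_le (by fun_prop) ?_ hradius continuous_const fun p hp => ?_
  · exact (mooreSphere m).continuous.comp ((sphereShrink (m + 1)).continuous.comp
      ((continuous_projIcc.comp (hradius.sub continuous_const)).prodMk hdegree))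
  · rw [hp, sub_self, projIcc_of_right_le zero_le_one le_rfl, projIcc_of_le_left zero_le_one le_rfl]
    exact (moorePolar_one p.1.1).trans (congrArg (mooreSphere m) (sphereShrink_zero _).symm)

theorem mooreStretch_one (t : I) (x : sphere (m + 1)) :
    mooreStretch m ((x, 1), t) = mooreSphere m (sphereShrink (m + 1) (t, degreeTwo m x)) := by
  simp only [mooreStretch, Icc.coe_one, one_mul, add_sub_cancel_left, projIcc_val]
  split_ifs with h
  · obtain rfl : t = 0 := le_antisymm (Subtype.coe_le_coe.1 (by simpa using h)) t.2.1
    rw [sphereShrink_zero, projIcc_of_right_le zero_le_one (by simp)]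
    exact moorePolar_one x
  · rfl

theorem mooreStretch_zero (p : sphere (m + 1) × I) : mooreStretch m (p, 0) = moorePolar m p := by
  simp only [mooreStretch, Icc.coe_zero, add_zero, mul_one, p.2.2.2, if_true, projIcc_val]

theorem mooreStretch_origin (x y : sphere (m + 1)) (t : I) :
    mooreStretch m ((x, 0), t) = mooreStretch m ((y, 0), t) := by
  simp only [mooreStretch, Icc.coe_zero, zero_mul, zero_le_one, if_true]
  rw [moorePolar_eq_iff]
  exact ⟨rfl, Or.inl (projIcc_of_le_left zero_le_one le_rfl)⟩

theorem mooreStretch_congr {p q : sphere (m + 1) × I} (h : moorePolar m p = moorePolar m q)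
    (t : I) : mooreStretch m (p, t) = mooreStretch m (q, t) := by
  obtain ⟨x, r⟩ := p
  obtain ⟨y, s⟩ := q
  obtain ⟨rfl, rfl | rfl | ⟨rfl, hdegree⟩⟩ := moorePolar_eq_iff.1 h
  · exact mooreStretch_origin x y t
  · rfl
  · rw [mooreStretch_one, mooreStretch_one, hdegree]

theorem exists_mooreSphere_contraction (m : ℕ) :
    ∃ H : C(I × moore m, moore m), (∀ x, H (0, x) = x) ∧
      ∀ t x, H (t, mooreSphere m x) = mooreSphere m (sphereShrink (m + 1) (t, x)) := by
  let π : C((sphere (m + 1) × I) × I, moore m × I) := (moorePolar m).prodMap (.id I)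
  have hπ : IsQuotientMap π := isQuotientMap_prodMap_id isQuotientMap_moorePolar
  let G : C((sphere (m + 1) × I) × I, moore m) := ⟨mooreStretch m, continuous_mooreStretch⟩
  have hG : Function.FactorsThrough G π := by
    rintro ⟨p, t⟩ ⟨q, t'⟩ h
    obtain rfl : t = t' := congrArg Prod.snd h
    exact mooreStretch_congr (congrArg Prod.fst h) t
  let H : C(moore m × I, moore m) := hπ.lift G hG
  have hH (p t) : H (moorePolar m p, t) = mooreStretch m (p, t) :=
    DFunLike.congr_fun (hπ.lift_comp G hG) (p, t)
  refine ⟨H.comp .prodSwap, fun x => ?_, fun t x => ?_⟩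
  · obtain ⟨p, rfl⟩ := isQuotientMap_moorePolar.surjective x
    exact (hH p 0).trans (mooreStretch_zero p)
  · obtain ⟨y, rfl⟩ := degreeTwo_surjective x
    rw [← mooreStretch_one, ← hH, moorePolar_one]
    rfl

end Polar

section MooreArc

variable {m : ℕ}

/-- The half-equator `{x | 0 ≤ x₀, x₁ = 0}` of the bottom cell of the Moore space, a disc which
`sphereShrink` contracts to the basepoint. -/
def mooreArc (m : ℕ) : Set (moore m) := mooreSphere m '' {x | 0 ≤ x.1 0 ∧ x.1 1 = 0}

theorem sphere_pt_apply (k : ℕ) (i : Fin (k + 1)) : (sphere k).pt.1 i = if i = 0 then 1 else 0 := by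
  change (EuclideanSpace.single 0 1 : EuclideanSpace ℝ (Fin (k + 1))) i = _
  simp

theorem inner_sphere_pt (k : ℕ) (v : EuclideanSpace ℝ (Fin (k + 1))) :
    inner ℝ (sphere k).pt.1 v = v 0 :=
  (EuclideanSpace.inner_single_left 0 (1 : ℝ) v).trans (by simp)

theorem moore_pt_mem_mooreArc : (moore m).pt ∈ mooreArc m :=
  ⟨(sphere (m + 1)).pt, by simp [sphere_pt_apply], rfl⟩

theorem sphereShrink_mem_arc (t : I) {x : sphere (m + 1)} (h : 0 ≤ x.1 0 ∧ x.1 1 = 0) :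
    0 ≤ (sphereShrink (m + 1) (t, x)).1 0 ∧ (sphereShrink (m + 1) (t, x)).1 1 = 0 := by
  let e := (sphere (m + 1)).pt.1
  have hvec : shrinkVec e t x.1 = (t : ℝ) • e + (1 - t : ℝ) • x.1 := by
    rw [shrinkVec, inner_sphere_pt, abs_of_nonneg h.1, max_eq_left (neg_nonpos.2 h.1)]
    module
  change 0 ≤ (‖shrinkVec e t x.1‖⁻¹ • shrinkVec e t x.1) 0 ∧
    (‖shrinkVec e t x.1‖⁻¹ • shrinkVec e t x.1) 1 = 0
  have ht : (0 : ℝ) ≤ 1 - t := sub_nonneg.2 t.2.2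
  have h0 : shrinkVec e t x.1 0 = t + (1 - t) * x.1 0 := by simp [hvec, e, sphere_pt_apply]
  have h1 : shrinkVec e t x.1 1 = 0 := by simp [hvec, e, sphere_pt_apply, h.2]
  rw [PiLp.smul_apply, PiLp.smul_apply, h0, h1]
  exact ⟨mul_nonneg (by positivity) (add_nonneg t.2.1 (mul_nonneg ht h.1)), smul_zero _⟩

theorem moore_equivalent_collapse :
    PointedHomotopyEquivalent (moore m) (collapse (mooreArc m) (moore m).pt) := by
  obtain ⟨H, h0, hS⟩ := exists_mooreSphere_contraction m
  refine .collapse_of_contraction (moore m) (mooreArc m) H h0 ?_ ?_ (fun t => ?_)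
    moore_pt_mem_mooreArc
  · rintro t _ ⟨x, hx, rfl⟩
    rw [hS]
    exact ⟨_, sphereShrink_mem_arc t hx, rfl⟩
  · rintro _ ⟨x, hx, rfl⟩
    rw [hS]
    refine congrArg (mooreSphere m) (Subtype.ext (shrink_one (norm_sphere _) ?_))
    rw [inner_sphere_pt]
    exact hx.1
  · exact (hS t (sphere (m + 1)).pt).trans (congrArg (mooreSphere m) (sphereShrink_pt t))

theorem mooreBall_mem_mooreArc {v : MooreCell m} :
    mooreBall m v ∈ mooreArc m ↔ ‖v.1‖ = 1 ∧ v.1 1 = 0 := by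
  rw [← angleDouble_mem_halfPlane_iff]
  constructor
  · rintro ⟨x, hx, h⟩
    obtain ⟨hv, hxv⟩ := mooreSphere_eq_ball_iff.1 h
    exact ⟨hv, hxv ▸ hx⟩
  · rintro ⟨hv, h⟩
    have hdouble : ‖angleDouble m v.1‖ = 1 := by rw [norm_angleDouble, hv]
    exact ⟨⟨_, mem_sphere_zero_iff_norm.2 hdouble⟩, h, mooreSphere_eq_ball_iff.2 ⟨hv, rfl⟩⟩

end MooreArc

section Squeeze

variable {m : ℕ}

/-- The square of the norm of a vector with its second coordinate, the one that vanishes on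
`mooreArc`, left out. -/
def cutSq (v : EuclideanSpace ℝ (Fin (m + 2))) : ℝ := v 0 ^ 2 + ∑ j : Fin m, v j.succ.succ ^ 2

theorem cutSq_nonneg (v : EuclideanSpace ℝ (Fin (m + 2))) : 0 ≤ cutSq v := by
  unfold cutSq
  positivity

theorem continuous_cutSq : Continuous (cutSq (m := m)) := by
  unfold cutSq
  fun_prop

theorem norm_sq_eq_cutSq (v : EuclideanSpace ℝ (Fin (m + 2))) : ‖v‖ ^ 2 = v 1 ^ 2 + cutSq v := by
  rw [EuclideanSpace.real_norm_sq_eq, Fin.sum_univ_succ, Fin.sum_univ_succ, cutSq,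
    Fin.succ_zero_eq_one]
  ring

theorem cutSq_smul (r : ℝ) (v : EuclideanSpace ℝ (Fin (m + 2))) :
    cutSq (r • v) = r ^ 2 * cutSq v := by
  simp only [cutSq, PiLp.smul_apply, smul_eq_mul, mul_pow, mul_add, Finset.mul_sum]

theorem cutSq_halfTurn (v : EuclideanSpace ℝ (Fin (m + 2))) : cutSq (halfTurn v) = cutSq v := by
  change (-v 0) ^ 2 + _ = _
  rw [neg_sq]
  rfl

theorem halfTurn_smul (r : ℝ) (v : EuclideanSpace ℝ (Fin (m + 2))) :
    halfTurn (r • v) = r • halfTurn v :=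
  ext_planar (Complex.ext (mul_neg r (v 0)).symm (mul_neg r (v 1)).symm) fun _ => rfl

/-- The radial rescaling that maps the slab `{v | |v₁| ≤ 1}` into the unit ball. -/
def squeeze (v : EuclideanSpace ℝ (Fin (m + 2))) : EuclideanSpace ℝ (Fin (m + 2)) :=
  (√(1 + cutSq v))⁻¹ • v

/-- The inverse of `squeeze`, defined on `{v | cutSq v < 1}`. -/
def expand (v : EuclideanSpace ℝ (Fin (m + 2))) : EuclideanSpace ℝ (Fin (m + 2)) :=
  (√(1 - cutSq v))⁻¹ • v

theorem one_add_cutSq_pos (v : EuclideanSpace ℝ (Fin (m + 2))) : 0 < 1 + cutSq v :=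
  add_pos_of_pos_of_nonneg one_pos (cutSq_nonneg v)

theorem continuous_squeeze : Continuous (squeeze (m := m)) :=
  ((continuous_const.add continuous_cutSq).sqrt.inv₀ fun v =>
    (Real.sqrt_pos.2 (one_add_cutSq_pos v)).ne').smul continuous_id

theorem continuousOn_expand : ContinuousOn (expand (m := m)) {v | cutSq v < 1} :=
  ((continuous_const.sub continuous_cutSq).sqrt.continuousOn.inv₀ fun _ hv =>
    (Real.sqrt_pos.2 (sub_pos.2 hv)).ne').smul continuousOn_id

theorem one_sub_cutSq_squeeze (v : EuclideanSpace ℝ (Fin (m + 2))) :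
    1 - cutSq (squeeze v) = (1 + cutSq v)⁻¹ := by
  have h := one_add_cutSq_pos v
  rw [squeeze, cutSq_smul, inv_pow, Real.sq_sqrt h.le]
  field_simp
  ring

theorem one_add_cutSq_expand {v : EuclideanSpace ℝ (Fin (m + 2))} (hv : cutSq v < 1) :
    1 + cutSq (expand v) = (1 - cutSq v)⁻¹ := by
  have h := sub_pos.2 hv
  rw [expand, cutSq_smul, inv_pow, Real.sq_sqrt h.le]
  field_simp
  ring

theorem cutSq_squeeze_lt_one (v : EuclideanSpace ℝ (Fin (m + 2))) : cutSq (squeeze v) < 1 :=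
  sub_pos.1 (one_sub_cutSq_squeeze v ▸ inv_pos.2 (one_add_cutSq_pos v))

theorem expand_squeeze (v : EuclideanSpace ℝ (Fin (m + 2))) : expand (squeeze v) = v := by
  rw [expand, one_sub_cutSq_squeeze, Real.sqrt_inv, inv_inv, squeeze,
    smul_inv_smul₀ (Real.sqrt_pos.2 (one_add_cutSq_pos v)).ne']

theorem squeeze_expand {v : EuclideanSpace ℝ (Fin (m + 2))} (hv : cutSq v < 1) :
    squeeze (expand v) = v := by
  rw [squeeze, one_add_cutSq_expand hv, Real.sqrt_inv, inv_inv, expand,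
    smul_inv_smul₀ (Real.sqrt_pos.2 (sub_pos.2 hv)).ne']

theorem squeeze_injective : Function.Injective (squeeze (m := m)) :=
  Function.LeftInverse.injective expand_squeeze

theorem squeeze_halfTurn (v : EuclideanSpace ℝ (Fin (m + 2))) :
    squeeze (halfTurn v) = halfTurn (squeeze v) := by
  rw [squeeze, squeeze, cutSq_halfTurn, halfTurn_smul]

theorem norm_sq_squeeze (v : EuclideanSpace ℝ (Fin (m + 2))) :
    ‖squeeze v‖ ^ 2 = (v 1 ^ 2 + cutSq v) / (1 + cutSq v) := by
  rw [squeeze, norm_smul, mul_pow, norm_sq_eq_cutSq, norm_inv, inv_pow, Real.norm_eq_abs, sq_abs,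
    Real.sq_sqrt (one_add_cutSq_pos v).le, inv_mul_eq_div]

theorem norm_squeeze_le_one_iff {v : EuclideanSpace ℝ (Fin (m + 2))} :
    ‖squeeze v‖ ≤ 1 ↔ v 1 ^ 2 ≤ 1 := by
  rw [← sq_le_one_iff₀ (norm_nonneg _), norm_sq_squeeze, div_le_one (one_add_cutSq_pos v),
    add_le_add_iff_right]

theorem norm_squeeze_eq_one_iff {v : EuclideanSpace ℝ (Fin (m + 2))} :
    ‖squeeze v‖ = 1 ↔ v 1 ^ 2 = 1 := by
  rw [← pow_eq_one_iff_of_nonneg (norm_nonneg _) two_ne_zero, norm_sq_squeeze,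
    div_eq_one_iff_eq (one_add_cutSq_pos v).ne', add_left_inj]

end Squeeze

section MooreCompactification

variable {m : ℕ}

/-- The vector with coordinates `(a, c, y)`. -/
def stripVec (w : (Fin m → ℝ) × (ℝ × Icc (-1 : ℝ) 1)) : EuclideanSpace ℝ (Fin (m + 2)) :=
  WithLp.toLp 2 (Fin.cons w.2.1 (Fin.cons (w.2.2 : ℝ) w.1))

/-- A left inverse of `stripVec`. -/
def vecStrip (v : EuclideanSpace ℝ (Fin (m + 2))) : (Fin m → ℝ) × (ℝ × Icc (-1 : ℝ) 1) :=
  (fun j => v j.succ.succ, (v 0, projIcc (-1) 1 (by norm_num) (v 1)))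

theorem continuous_stripVec : Continuous (stripVec (m := m)) := by
  refine (PiLp.continuous_toLp 2 _).comp (continuous_pi fun j => ?_)
  refine Fin.cases ?_ (fun j => Fin.cases ?_ (fun j => ?_) j) j
  · exact continuous_snd.fst
  · exact continuous_subtype_val.comp continuous_snd.snd
  · exact (continuous_apply j).comp continuous_fst

theorem continuous_vecStrip : Continuous (vecStrip (m := m)) := by
  unfold vecStrip
  fun_prop

theorem vecStrip_stripVec (w : (Fin m → ℝ) × (ℝ × Icc (-1 : ℝ) 1)) : vecStrip (stripVec w) = w :=
  Prod.ext rfl (Prod.ext rfl (projIcc_val (by norm_num) _))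

theorem stripVec_vecStrip {v : EuclideanSpace ℝ (Fin (m + 2))} (hv : v 1 ^ 2 ≤ 1) :
    stripVec (vecStrip v) = v :=
  ext_planar (Complex.ext rfl (congrArg Subtype.val
    (projIcc_of_mem (by norm_num) (abs_le.1 ((sq_le_one_iff_abs_le_one _).1 hv))))) fun _ => rfl

/-- The strip `ℝᵐ × ℝ × [-1, 1]` as the complement of `{v | ‖v‖ = 1, v₁ = 0}` in the top cell. -/
def stripBall (w : (Fin m → ℝ) × (ℝ × Icc (-1 : ℝ) 1)) : MooreCell m :=
  ⟨squeeze (stripVec w), mem_closedBall_zero_iff.2 <| norm_squeeze_le_one_iff.2 <|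
    (sq_le_one_iff_abs_le_one _).2 (abs_le.2 w.2.2.2)⟩

theorem range_stripBall : range (stripBall (m := m)) = {v | cutSq v.1 < 1} := by
  ext v
  constructor
  · rintro ⟨w, rfl⟩
    exact cutSq_squeeze_lt_one _
  · intro hv
    have h : expand v.1 1 ^ 2 ≤ 1 := by
      rw [← norm_squeeze_le_one_iff, squeeze_expand hv]
      exact mem_closedBall_zero_iff.1 v.2
    exact ⟨vecStrip (expand v.1), Subtype.ext
      ((congrArg squeeze (stripVec_vecStrip h)).trans (squeeze_expand hv))⟩

theorem isOpenEmbedding_stripBall : IsOpenEmbedding (stripBall (m := m)) := by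
  refine isOpenEmbedding_of_leftInverse (g := fun v => vecStrip (expand v.1))
    ((continuous_squeeze.comp continuous_stripVec).subtype_mk _) ?_ ?_ fun w => ?_
  · rw [range_stripBall]
    exact isOpen_lt (continuous_cutSq.comp continuous_subtype_val) continuous_const
  · rw [range_stripBall]
    exact continuous_vecStrip.comp_continuousOn
      (continuousOn_expand.comp continuous_subtype_val.continuousOn fun v hv => hv)
  · exact (congrArg vecStrip (expand_squeeze _)).trans (vecStrip_stripVec w)

theorem notMem_range_stripBall {v : MooreCell m} :
    v ∉ range (stripBall (m := m)) ↔ mooreBall m v ∈ mooreArc m := by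
  have hle : ‖v.1‖ ^ 2 ≤ 1 := (sq_le_one_iff₀ (norm_nonneg _)).2 (mem_closedBall_zero_iff.1 v.2)
  rw [range_stripBall, mooreBall_mem_mooreArc, mem_ofPred_eq, not_lt,
    ← pow_eq_one_iff_of_nonneg (norm_nonneg v.1) two_ne_zero, ← sq_eq_zero_iff (a := v.1 1)]
  rw [norm_sq_eq_cutSq] at hle ⊢
  constructor
  · intro h
    constructor <;> linarith [sq_nonneg (v.1 1)]
  · rintro ⟨h, h0⟩
    linarith

theorem stripVec_injective : Function.Injective (stripVec (m := m)) :=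
  Function.LeftInverse.injective vecStrip_stripVec

theorem stripVec_eq_halfTurn_iff {y y' : Fin m → ℝ} {a a' : ℝ} {c c' : Icc (-1 : ℝ) 1} :
    stripVec (y, (a, c)) = halfTurn (stripVec (y', (a', c'))) ↔
      y = y' ∧ a = -a' ∧ (c : ℝ) = -c' := by
  constructor
  · intro h
    have hcoord (i) := congrArg (fun v : EuclideanSpace ℝ (Fin (m + 2)) => v i) h
    exact ⟨funext fun j => hcoord j.succ.succ, hcoord 0, hcoord 1⟩
  · rintro ⟨rfl, ha, hc⟩
    exact ext_planar (Complex.ext ha hc) fun j => rfl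

theorem mooreBall_stripBall_eq_iff {y y' : Fin m → ℝ} {a a' : ℝ} {c c' : Icc (-1 : ℝ) 1} :
    mooreBall m (stripBall (y, (a, c))) = mooreBall m (stripBall (y', (a', c'))) ↔
      y = y' ∧ moebiusStrip (a, c) = moebiusStrip (a', c') := by
  have hnorm (y : Fin m → ℝ) (a : ℝ) (c : Icc (-1 : ℝ) 1) :
      ‖(stripBall (y, (a, c))).1‖ = 1 ↔ (c : ℝ) ^ 2 = 1 := norm_squeeze_eq_one_iff
  have hdouble : angleDouble m (stripBall (y, (a, c))).1 =
      angleDouble m (stripBall (y', (a', c'))).1 ↔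
        (y, (a, c)) = (y', (a', c')) ∨ y = y' ∧ a = -a' ∧ (c : ℝ) = -c' := by
    rw [angleDouble_eq_iff, stripBall, stripBall, ← squeeze_halfTurn, squeeze_injective.eq_iff,
      squeeze_injective.eq_iff, stripVec_injective.eq_iff, stripVec_eq_halfTurn_iff]
  rw [mooreBall_eq_iff, isOpenEmbedding_stripBall.injective.eq_iff, moebiusStrip_eq_iff, hnorm,
    hnorm, hdouble, Prod.mk.injEq, Prod.mk.injEq]
  constructor
  · rintro (⟨hy, h⟩ | ⟨hc, -, ⟨hy, h⟩ | ⟨hy, ha, hc'⟩⟩)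
    exacts [⟨hy, Or.inl h⟩, ⟨hy, Or.inl h⟩, ⟨hy, Or.inr ⟨ha, hc', hc⟩⟩]
  · rintro ⟨hy, h | ⟨ha, hc', hc⟩⟩
    · exact Or.inl ⟨hy, h⟩
    · exact Or.inr ⟨hc, by rwa [hc', neg_sq] at hc, Or.inr ⟨hy, ha, hc'⟩⟩

theorem moore_onePt {b : ℕ} (hm : m = b + b + 1) :
    PointedHomotopyEquivalent (moore m) (onePt (((Fin b → ℂ) × ℝ) × Moebius)) := by
  have hrank : Module.finrank ℝ (Fin m → ℝ) = Module.finrank ℝ ((Fin b → ℂ) × ℝ) := by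
    simp [Module.finrank_pi_fintype, hm, mul_two]
  obtain ⟨L⟩ := FiniteDimensional.nonempty_continuousLinearEquiv_of_finrank_eq hrank
  obtain ⟨c₀, hc₀⟩ := isQuotientMap_mooreBall.surjective (moore m).pt
  refine moore_equivalent_collapse.trans ?_
  refine .onePt_of_cover (π := (collapseMk (mooreArc m) (moore m).pt).comp (mooreBall m))
    (isQuotientMap_collapseMk.comp isQuotientMap_mooreBall) continuous_id Function.surjective_id
    isOpenEmbedding_stripBall (f := Prod.map L moebiusStrip)
    (L.toHomeomorph.isProperMap.prodMap isProperMap_moebiusStrip)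
    (L.surjective.prodMap moebiusStrip_surjective) (c₀ := c₀) (congrArg _ hc₀) ?_ ?_ ?_
  · rw [id, notMem_range_stripBall, hc₀]
    exact moore_pt_mem_mooreArc
  · intro v v' h
    rw [id, notMem_range_stripBall] at h ⊢
    refine collapseMk_eq_iff.trans ⟨?_, fun h' => Or.inr ⟨h, h'⟩⟩
    rintro (h' | h')
    exacts [h' ▸ h, h'.2]
  · rintro _ _ ⟨y, a, c⟩ ⟨y', a', c'⟩ rfl rfl
    have hout : mooreBall m (stripBall (y, (a, c))) ∉ mooreArc m := fun h =>
      notMem_range_stripBall.2 h (mem_range_self _)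
    refine collapseMk_eq_iff.trans ?_
    rw [or_iff_left fun h => hout h.1, mooreBall_stripBall_eq_iff, Prod.map, Prod.map,
      Prod.mk.injEq, L.injective.eq_iff]

theorem Torus.susp_quotient_odd {ι : Type} [DecidableEq ι] {K : Finset ι} (hK : Odd K.card) :
    PointedHomotopyEquivalent (reducedSuspension (Torus.quotient K K)) (moore K.card) := by
  obtain ⟨b, hb⟩ := hK
  rw [two_mul] at hb
  refine (Torus.quotient_odd hb).susp.trans ((susp_onePt _).trans ?_)
  refine (onePt_congr ?_).trans (moore_onePt hb).symm
  exact (Homeomorph.prodAssoc _ _ _).trans (((Homeomorph.refl _).prodCongr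
    (Homeomorph.prodComm _ _)).trans (Homeomorph.prodAssoc _ _ _).symm)

end MooreCompactification

/-! ### Sorting the wedge summands by cardinality -/

/-- The empty subset of a finite type, its other subsets of even cardinality, and its subsets of odd
cardinality. -/
def finsetParityEquiv (α : Type*) :
    Unit ⊕ ({K : Finset α // Even K.card ∧ 0 < K.card} ⊕ {K : Finset α // Odd K.card}) ≃
      Finset α :=
  .ofBijective (Sum.elim (fun _ => ∅) (Sum.elim Subtype.val Subtype.val)) <| by
    refine ⟨?_, fun K => ?_⟩
    · refine (Function.injective_of_subsingleton _).sumElim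
        (Subtype.val_injective.sumElim Subtype.val_injective ?_) ?_
      · rintro ⟨K, hK⟩ ⟨_, hK'⟩ rfl
        exact Nat.not_odd_iff_even.2 hK.1 hK'
      · rintro - (⟨K, hK⟩ | ⟨K, hK⟩) rfl
        exacts [hK.2.false, absurd hK (by simp)]
    · rcases Nat.even_or_odd K.card with h | h
      · rcases K.eq_empty_or_nonempty with rfl | hK
        · exact ⟨.inl (), rfl⟩
        · exact ⟨.inr (.inl ⟨K, h, hK.card_pos⟩), rfl⟩
      · exact ⟨.inr (.inr ⟨K, h⟩), rfl⟩

/-- The enumeration, cardinality by cardinality, of the subsets of `Fin k` whose cardinality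
satisfies `p`. -/
def finsetSigmaEquiv (k : ℕ) (p : ℕ → Prop) :
    {K : Finset (Fin k) // p K.card} ≃ Σ i : {i : ℕ // p i}, Fin (k.choose i) :=
  (Equiv.sigmaSubtypeFiberEquivSubtype Finset.card fun _ => Iff.rfl).symm.trans <|
    Equiv.sigmaCongrRight fun _ => Fintype.equivFinOfCardEq (by simp)

namespace PointedHomotopyEquivalent

theorem bigWedge_finset {α : Type} (X : Finset α → PointedSpace) :
    PointedHomotopyEquivalent (bigWedge X) (wedge (X ∅)
      (wedge (bigWedge fun K : {K : Finset α // Even K.card ∧ 0 < K.card} => X K)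
        (bigWedge fun K : {K : Finset α // Odd K.card} => X K))) :=
  (bigWedge_reindex (finsetParityEquiv α)).symm.trans <| (bigWedge_sum _).trans <|
    .wedge_congr (bigWedge_unique _) (bigWedge_sum _)

theorem bigWedge_card {k : ℕ} {p : ℕ → Prop} {X : Finset (Fin k) → PointedSpace}
    {Y : ℕ → PointedSpace} (h : ∀ K, p K.card → PointedHomotopyEquivalent (X K) (Y K.card)) :
    PointedHomotopyEquivalent (bigWedge fun K : {K : Finset (Fin k) // p K.card} => X K)
      (bigWedge fun q : (Σ i : {i : ℕ // p i}, Fin (k.choose i)) => Y q.1) :=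
  (bigWedge_congr fun K : {K : Finset (Fin k) // p K.card} => h K.1 K.2).trans <|
    bigWedge_reindex (Y := fun q : (Σ i : {i : ℕ // p i}, Fin (k.choose i)) => Y q.1)
      (finsetSigmaEquiv k p)

end PointedHomotopyEquivalent

end HigherKlein

end

open HigherKlein

theorem mainTheorem1 (n : ℕ) (hn : 1 ≤ n) (x₀ : Klein n) :
    PointedHomotopyEquivalent
      (reducedSuspension { carrier := Klein n, pt := x₀ })
      (wedge (sphere 2)
        (wedge
          (bigWedge fun p : (Σ i : {i : ℕ // Even i ∧ 0 < i}, Fin ((n - 1).choose i)) =>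
            wedge (sphere (p.1 + 1)) (sphere (p.1 + 2)))
          (bigWedge fun p : (Σ i : {i : ℕ // Odd i}, Fin ((n - 1).choose i)) =>
            moore p.1))) := by
  obtain ⟨k, rfl⟩ := Nat.exists_eq_add_of_le' hn
  refine (susp_klein x₀).trans <| (PointedHomotopyEquivalent.bigWedge_finset _).trans <|
    .wedge_congr Torus.susp_quotient_empty (.wedge_congr ?even ?odd)
  case even =>
    exact .bigWedge_card (p := fun i => Even i ∧ 0 < i)
      (Y := fun i => wedge (sphere (i + 1)) (sphere (i + 2)))
      fun K hK => Torus.susp_quotient_even (Finset.card_pos.1 hK.2) hK.1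
  case odd => exact .bigWedge_card fun K hK => Torus.susp_quotient_odd hK
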